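/- **Setting.** On every bond of the square lattice $\mathbb{Z}^2$ there is a spin $1/2$. Let $\mathfrak{A}$ be the quasi-local $C^*$-algebra generated by the local algebras $\mathfrak{A}(\Lambda_f)=\bigotimes_{b\in\Lambda_f}M_2(\mathbb{C})$, $\Lambda_f$ a finite set of bonds; for a set $\Lambda$ of bonds let $\mathfrak{A}(\Lambda)$ be the norm closure of the union of the $\mathfrak{A}(\Lambda_f)$ with $\Lambda_f\subset\Lambda$ finite. Let $A_s=\prod_{j\in \mathrm{star}(s)}\sigma^x_j$ and $B_p=\prod_{j\in\mathrm{plaq}(p)}\sigma^z_j$ be the star and plaquette operators of the toric code, let $\omega_0$ be the ground state (the state on $\mathfrak{A}$ with $\omega_0(A_s)=\omega_0(B_p)=1$ for all $s,p$) and $(\pi_0,\mathcal{H}_0,\Omega)$ its GNS representation. Identify $A\in\mathfrak{A}$ with $\pi_0(A)$. *Excitations.* Let $\gamma$ be a path extending to infinity that uses no bond twice, on the dual lattice (type $k=X$, string operators formed with $\sigma^x$) or on the lattice (type $k=Z$, string operators formed with $\sigma^z$), and let $\Gamma_n$ be the product of the corresponding Pauli matrices over its first $n$ bonds. Put $\rho^k(A)=\lim_n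 \Gamma_nA\Gamma_n^*$ (norm limit). *Cones.* A cone consists of all bonds lying in, or touching, the closed area between two half-lines emanating from a lattice point at an angle in $(0,\pi)$. An endomorphism $\rho$ of $\mathfrak{A}$ is localized in $\Lambda$ if $\rho(A)=A$ for all $A\in\mathfrak{A}(\Lambda^c)$. Fix a ("forbidden") cone $\Lambda_a$. Write $\Lambda_1<\Lambda_2$ if the cones $\Lambda_1,\Lambda_2$ are disjoint and, for some $x\in\mathbb{Z}^2$, both are contained in $(\Lambda_a+x)^c$ and $\Lambda_1$ can be rotated counter-clockwise around its apex until it meets $\Lambda_a+x$, being disjoint from $\Lambda_2$ at all intermediate angles. The auxiliary algebra $\mathfrak{A}^{\Lambda_a}$ is the norm closure of $\bigcup_{x\in\mathbb{Z}^2}\mathfrak{A}((\Lambda_a+x)^c)''$ in $\mathfrak{B}(\mathcal{H}_0)$, and $\rho^{\Lambda_a}$ denotes the extension of $\rho$ to an endomorphism of $\mathfrak{A}^{\Lambda_a}$ that is weakly continuous on each $\mathfrak{A}((\Lambda_a+x)^c)''$. *Braiding, conjugates, twist.* Put $\rho_1\otimes\rho_2=\rho_1\circ\rho_2$. For $\rho_1,\rho_2$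 localized in cones $\Lambda_1,\Lambda_2$ that are contained in a common cone, the braiding is $\varepsilon_{\rho_1,\rho_2}=V^*\rho_1^{\Lambda_a}(V)$, where $V\in\mathfrak{A}^{\Lambda_a}$ is a unitary intertwining $\rho_2$ and an endomorphism of $\mathfrak{A}$ localized in some cone $\widehat\Lambda_2<\Lambda_1$. A standard conjugate of $\rho$ is a triple $(\bar\rho,R,\bar R)$, where $R,\bar R\in\mathfrak{A}^{\Lambda_a}$ intertwine the identity with $\bar\rho\otimes\rho$ and with $\rho\otimes\bar\rho$ respectively, such that $\bar R^*\rho^{\Lambda_a}(R)=I=R^*\bar\rho^{\Lambda_a}(\bar R)$, $R^*R=\bar R^*\bar R$, and $R^*\bar\rho^{\Lambda_a}(T)R=\bar R^*T\bar R$ for every self-intertwiner $T\in\mathfrak{A}^{\Lambda_a}$ of $\rho$. The twist is $\Theta_\rho=(R^*\otimes \mathrm{id}_\rho)(\mathrm{id}_{\bar\rho}\otimes\varepsilon_{\rho,\rho})(R\otimes \mathrm{id}_\rho)=R^*\,\bar\rho^{\Lambda_a}(\varepsilon_{\rho,\rho})\,R$. **Corollary (the excitations $X$ and $Z$ are bosonic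 and $Y$ is fermionic).** Let $\Lambda$ be a cone for which some cone $\widehat\Lambda<\Lambda$ exists. Let $\rho^X$ and $\rho^Z$ be given by any paths of type $X$ and $Z$ in $\Lambda$ extending to infinity, and let $\rho^Y=\rho^X\otimes\rho^Z$. For $k=X,Y,Z$ the triple $(\rho^k,I,I)$ is a standard conjugate of $\rho^k$, and the twist of $\rho^k$ formed with it and with $\Lambda_1=\Lambda_2=\Lambda$ exists and does not depend on the choices of $\widehat\Lambda_2$ and $V$; it is $$\Theta_{\rho^X}=I,\qquad \Theta_{\rho^Z}=I,\qquad \Theta_{\rho^Y}=-I .$$ -/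

import Mathlib

open Filter Topology
open scoped ComplexOrder InnerProductSpace

namespace ToricCode

/-- Points of the lattice; a plaquette is labelled by its lower left corner. -/
abbrev Vertex : Type := ℤ × ℤ
/-- Bonds: `(v, false)` joins `v` to `v + (1, 0)`, and `(v, true)` joins `v` to `v + (0, 1)`. -/
abbrev Bond : Type := Vertex × Bool

/-- The four bonds of `star(s)`. -/
def starBonds (s : Vertex) : List Bond :=
  [((s.1, s.2), false), ((s.1, s.2), true), ((s.1 - 1, s.2), false), ((s.1, s.2 - 1), true)]

/-- The four bonds of `plaq(p)`. -/
def plaqBonds (p : Vertex) : List Bond :=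
  [((p.1, p.2), false), ((p.1, p.2), true), ((p.1, p.2 + 1), false), ((p.1 + 1, p.2), true)]

/-- The incomplete infinite tensor product of the spaces `ℂ²` at the bonds, along the spin-up vectors:
it has the orthonormal basis `e_S`, with `S` the finite set of bonds where the spin is down. -/
noncomputable abbrev SpinSpace : Type := lp (fun _ : Finset Bond => ℂ) 2

/-- The bounded operators on the spin space. -/
noncomputable abbrev SpinOps : Type := SpinSpace →L[ℂ] SpinSpace

/-- Flip the spin at the bond `b`. -/
def flip (b : Bond) : Equiv.Perm (Finset Bond) where
  toFun S := symmDiff S {b}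
  invFun S := symmDiff S {b}
  left_inv _ := symmDiff_symmDiff_cancel_right _ _
  right_inv _ := symmDiff_symmDiff_cancel_right _ _

/-- The eigenvalue of `σᶻ_b` on `e_S`. -/
noncomputable def spin (b : Bond) (S : Finset Bond) : ℂ := if b ∈ S then -1 else 1

theorem norm_spin (b : Bond) (S : Finset Bond) : ‖spin b S‖ = 1 := by
  unfold spin; split <;> simp

theorem memlp_signedFlip (e : Equiv.Perm (Finset Bond)) (c : Finset Bond → ℂ)
    (hc : ∀ S, ‖c S‖ = 1) (f : SpinSpace) :
    Memℓp (fun S => c S * f (e S)) 2 := by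
  have hf := lp.memℓp f
  rw [memℓp_gen_iff (by simp)] at hf ⊢
  simp only [norm_mul, hc, one_mul]
  exact (e.summable_iff (f := fun S => ‖f S‖ ^ (2 : ENNReal).toReal)).2 hf

/-- The operator `(T ψ)(S) = c(S) ψ(e S)`. -/
noncomputable def signedFlip (e : Equiv.Perm (Finset Bond)) (c : Finset Bond → ℂ)
    (hc : ∀ S, ‖c S‖ = 1) : SpinOps :=
  LinearMap.mkContinuous
    { toFun := fun f => (⟨fun S => c S * f (e S), memlp_signedFlip e c hc f⟩ : SpinSpace)
      map_add' := fun f g => by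
        ext S; exact mul_add _ _ _
      map_smul' := fun a f => by
        ext S; simp [mul_left_comm] } 1 (fun f => by
      rw [one_mul, lp.norm_eq_tsum_rpow (by simp), lp.norm_eq_tsum_rpow (by simp)]
      refine le_of_eq ?_
      congr 1
      simp only [LinearMap.coe_mk, AddHom.coe_mk, norm_mul, hc, one_mul]
      exact e.tsum_eq (fun S => ‖f S‖ ^ (2 : ENNReal).toReal))

@[simp] theorem signedFlip_apply (e : Equiv.Perm (Finset Bond)) (c : Finset Bond → ℂ)
    (hc : ∀ S, ‖c S‖ = 1) (f : SpinSpace) (S : Finset Bond) :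
    signedFlip e c hc f S = c S * f (e S) := rfl

/-- `σˣ` at the bond `b`. -/
noncomputable def opX (b : Bond) : SpinOps := signedFlip (flip b) (fun _ => 1) (by simp)

/-- `σᶻ` at the bond `b`. -/
noncomputable def opZ (b : Bond) : SpinOps := signedFlip (Equiv.refl _) (spin b) (norm_spin b)

@[simp] theorem opX_apply (b : Bond) (f : SpinSpace) (S : Finset Bond) :
    opX b f S = f (flip b S) := by simp [opX]
@[simp] theorem opZ_apply (b : Bond) (f : SpinSpace) (S : Finset Bond) :
    opZ b f S = spin b S * f S := by simp [opZ]

theorem opX_sq (b : Bond) : opX b * opX b = 1 := by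
  ext f S
  simp [flip]

theorem opZ_sq (b : Bond) : opZ b * opZ b = 1 := by
  ext f S
  simp only [mul_apply_eq_comp, opZ_apply, spin, one_apply_eq_self]
  split <;> simp

theorem star_opX (b : Bond) : star (opX b) = opX b := by
  rw [ContinuousLinearMap.star_eq_adjoint, eq_comm, ContinuousLinearMap.eq_adjoint_iff]
  intro f g
  simp only [lp.inner_eq_tsum, opX_apply]
  rw [← (flip b).tsum_eq]
  simp [flip]

theorem star_opZ (b : Bond) : star (opZ b) = opZ b := by
  rw [ContinuousLinearMap.star_eq_adjoint, eq_comm, ContinuousLinearMap.eq_adjoint_iff]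
  intro f g
  simp only [lp.inner_eq_tsum, opZ_apply]
  refine tsum_congr fun S => ?_
  unfold spin; split <;> simp

theorem commute_opX_opX (b c : Bond) : Commute (opX b) (opX c) := by
  ext f S
  simp [flip, symmDiff_assoc, symmDiff_comm ({b} : Finset Bond)]

theorem commute_opZ_opZ (b c : Bond) : Commute (opZ b) (opZ c) := by
  ext f S
  simp [mul_left_comm]

theorem spin_flip (b c : Bond) (S : Finset Bond) :
    spin c (flip b S) = (if c = b then -1 else 1) * spin c S := by
  by_cases h : c = b <;> by_cases h' : c ∈ S <;> simp [spin, flip, Finset.mem_symmDiff, h, h']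

theorem commute_opX_opZ {b c : Bond} (h : b ≠ c) : Commute (opX b) (opZ c) := by
  ext f S
  simp [spin_flip, h.symm]

/-- The quasi-local algebra: the norm closure of the algebra generated by the Pauli matrices at all
bonds. The matrices `σˣ` and `σᶻ` generate `M₂(ℂ)`, so this is the norm closure of the union of the
tensor products `𝔄(Λ)` of copies of `M₂(ℂ)` over the finite sets `Λ` of bonds. -/
noncomputable def quasiLocal : StarSubalgebra ℂ SpinOps :=
  (StarAlgebra.adjoin ℂ (Set.range opX ∪ Set.range opZ)).topologicalClosure

instance isClosed_quasiLocal : IsClosed (quasiLocal : Set SpinOps) :=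
  StarSubalgebra.isClosed_topologicalClosure _

/-- The quasi-local algebra `𝔄` as a C⋆-algebra. -/
noncomputable abbrev QLA : Type := quasiLocal

instance starOrderedRing_quasiLocal : StarOrderedRing QLA := by
  refine StarOrderedRing.of_nonneg_iff' (fun h z => add_le_add_right h z) fun x => ?_
  constructor
  · intro hx
    have hx' : 0 ≤ (x : SpinOps) := hx
    rw [ContinuousLinearMap.nonneg_iff_isPositive] at hx'
    have h1 : IsSelfAdjoint x := Subtype.ext hx'.isSelfAdjoint
    have h2 : SpectrumRestricts x ContinuousMap.realToNNReal := by
      have h3 := hx'.spectrumRestricts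
      rw [SpectrumRestricts.nnreal_iff] at h3 ⊢
      intro r hr
      refine h3 r ?_
      rw [← spectrum.algebraMap_mem_iff ℂ] at hr ⊢
      exact quasiLocal.mem_spectrum_iff.1 hr
    obtain ⟨s, hs, -, hs'⟩ := CFC.exists_sqrt_of_isSelfAdjoint_of_quasispectrumRestricts h1
      (quasispectrumRestricts_iff_spectrumRestricts.2 h2)
    exact ⟨s, by rw [hs.star_eq, ← hs']⟩
  · rintro ⟨s, rfl⟩
    exact star_mul_self_nonneg (s : SpinOps)

/-- The two elementary types of paths, string operators and excitations. -/
inductive PauliType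
  | X
  | Z

/-- The Pauli matrix `σᵏ` at a bond, as an operator. -/
noncomputable def op : PauliType → Bond → SpinOps
  | .X => opX
  | .Z => opZ

theorem op_mem (k : PauliType) (b : Bond) : op k b ∈ quasiLocal := by
  refine StarSubalgebra.le_topologicalClosure _ (StarAlgebra.subset_adjoin _ _ ?_)
  cases k
  · exact Or.inl ⟨b, rfl⟩
  · exact Or.inr ⟨b, rfl⟩

/-- The Pauli matrix `σᵏ` at a bond, in the quasi-local algebra. -/
noncomputable def sigma (k : PauliType) (b : Bond) : QLA := ⟨op k b, op_mem k b⟩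

theorem sigma_sq (k : PauliType) (b : Bond) : sigma k b * sigma k b = 1 := by
  cases k
  · exact Subtype.ext (opX_sq b)
  · exact Subtype.ext (opZ_sq b)

theorem star_sigma (k : PauliType) (b : Bond) : star (sigma k b) = sigma k b := by
  cases k
  · exact Subtype.ext (star_opX b)
  · exact Subtype.ext (star_opZ b)

theorem commute_sigma (k l : PauliType) {b c : Bond} (h : b ≠ c) :
    Commute (sigma k b) (sigma l c) := by
  cases k <;> cases l <;> refine Subtype.ext ?_
  · exact commute_opX_opX b c
  · exact commute_opX_opZ h
  · exact (commute_opX_opZ h.symm).symm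
  · exact commute_opZ_opZ b c

/-- The string operator of the first `n` bonds of a path. -/
noncomputable def stringOp (k : PauliType) (b : ℕ → Bond) : ℕ → QLA
  | 0 => 1
  | n + 1 => stringOp k b n * sigma k (b n)

theorem stringOp_mem_unitary (k : PauliType) (b : ℕ → Bond) (n : ℕ) :
    stringOp k b n ∈ unitary QLA := by
  induction n with
  | zero => exact one_mem _
  | succ n ih =>
    refine mul_mem ih ?_
    rw [Unitary.mem_iff, star_sigma]
    exact ⟨sigma_sq k _, sigma_sq k _⟩

/-- `Ad Γ(A) = Γ A Γ^*` for the string operator `Γ` of the first `n` bonds. -/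
noncomputable def adString (k : PauliType) (b : ℕ → Bond) (n : ℕ) (A : QLA) : QLA :=
  stringOp k b n * A * star (stringOp k b n)

theorem norm_adString (k : PauliType) (b : ℕ → Bond) (n : ℕ) (A : QLA) :
    ‖adString k b n A‖ = ‖A‖ := by
  unfold adString
  rw [CStarRing.norm_mul_mem_unitary _ (Unitary.star_mem (stringOp_mem_unitary k b n)),
    CStarRing.norm_mem_unitary_mul _ (stringOp_mem_unitary k b n)]

theorem adString_one (k : PauliType) (b : ℕ → Bond) (n : ℕ) : adString k b n 1 = 1 := by
  simp [adString, (Unitary.mem_iff.1 (stringOp_mem_unitary k b n)).2]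

theorem adString_add (k : PauliType) (b : ℕ → Bond) (n : ℕ) (A B : QLA) :
    adString k b n (A + B) = adString k b n A + adString k b n B := by
  simp [adString, mul_add, add_mul]

theorem adString_sub (k : PauliType) (b : ℕ → Bond) (n : ℕ) (A B : QLA) :
    adString k b n (A - B) = adString k b n A - adString k b n B := by
  simp [adString, mul_sub, sub_mul]

theorem adString_smul (k : PauliType) (b : ℕ → Bond) (n : ℕ) (a : ℂ) (A : QLA) :
    adString k b n (a • A) = a • adString k b n A := by
  simp [adString]

theorem adString_star (k : PauliType) (b : ℕ → Bond) (n : ℕ) (A : QLA) :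
    adString k b n (star A) = star (adString k b n A) := by
  simp [adString, mul_assoc]

theorem adString_mul (k : PauliType) (b : ℕ → Bond) (n : ℕ) (A B : QLA) :
    adString k b n (A * B) = adString k b n A * adString k b n B := by
  have h := (Unitary.mem_iff.1 (stringOp_mem_unitary k b n)).1
  simp only [adString]
  calc _ = stringOp k b n * A * 1 * B * star (stringOp k b n) := by simp [mul_assoc]
    _ = _ := by rw [← h]; simp only [mul_assoc]

theorem adString_sigma_succ (k l : PauliType) (b : ℕ → Bond) (n : ℕ) (c : Bond) (h : b n ≠ c) :
    adString k b (n + 1) (sigma l c) = adString k b n (sigma l c) := by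
  simp only [adString, stringOp, star_mul, star_sigma]
  have h1 := (commute_sigma k l h).eq
  have h2 := sigma_sq k (b n)
  calc _ = stringOp k b n * (sigma k (b n) * sigma l c) * sigma k (b n) *
        star (stringOp k b n) := by simp only [mul_assoc]
    _ = stringOp k b n * sigma l c * (sigma k (b n) * sigma k (b n)) *
        star (stringOp k b n) := by rw [h1]; simp only [mul_assoc]
    _ = _ := by rw [h2, mul_one]

theorem eventually_adString (k : PauliType) (b : ℕ → Bond) (hb : Function.Injective b)
    (A : SpinOps) (hA : A ∈ StarAlgebra.adjoin ℂ (Set.range opX ∪ Set.range opZ)) :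
    ∀ hA' : A ∈ quasiLocal, ∃ N, ∀ n ≥ N, adString k b n ⟨A, hA'⟩ = adString k b N ⟨A, hA'⟩ := by
  have key : ∀ l c, ∃ N, ∀ n ≥ N, adString k b n (sigma l c) = adString k b N (sigma l c) := by
    intro l c
    have : ∃ N, ∀ n ≥ N, b n ≠ c := by
      by_cases h : ∃ m, b m = c
      · obtain ⟨m, rfl⟩ := h
        exact ⟨m + 1, fun n hn h => by have := hb h; omega⟩
      · push Not at h
        exact ⟨0, fun n _ => h n⟩
    obtain ⟨N, hN⟩ := this
    refine ⟨N, fun n hn => ?_⟩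
    induction n, hn using Nat.le_induction with
    | base => rfl
    | succ n hn ih => rw [adString_sigma_succ k l b n c (hN n hn), ih]
  have hsub : StarAlgebra.adjoin ℂ (Set.range opX ∪ Set.range opZ) ≤ quasiLocal :=
    StarSubalgebra.le_topologicalClosure _
  induction hA using StarAlgebra.adjoin_induction with
  | mem x hx =>
    intro hA'
    rcases hx with ⟨c, rfl⟩ | ⟨c, rfl⟩
    · exact key .X c
    · exact key .Z c
  | algebraMap r =>
    intro hA'
    refine ⟨0, fun n _ => ?_⟩
    have : (⟨algebraMap ℂ SpinOps r, hA'⟩ : QLA) = r • 1 := by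
      ext1; simp [Algebra.algebraMap_eq_smul_one]
    rw [this, adString_smul, adString_smul, adString_one, adString_one]
  | add x y hx hy ihx ihy =>
    intro hA'
    obtain ⟨N, hN⟩ := ihx (hsub hx)
    obtain ⟨M, hM⟩ := ihy (hsub hy)
    have : (⟨x + y, hA'⟩ : QLA) = ⟨x, hsub hx⟩ + ⟨y, hsub hy⟩ := rfl
    refine ⟨max N M, fun n hn => ?_⟩
    rw [this, adString_add, adString_add, hN n (le_trans (le_max_left _ _) hn),
      hM n (le_trans (le_max_right _ _) hn), hN _ (le_max_left _ _), hM _ (le_max_right _ _)]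
  | mul x y hx hy ihx ihy =>
    intro hA'
    obtain ⟨N, hN⟩ := ihx (hsub hx)
    obtain ⟨M, hM⟩ := ihy (hsub hy)
    have : (⟨x * y, hA'⟩ : QLA) = ⟨x, hsub hx⟩ * ⟨y, hsub hy⟩ := rfl
    refine ⟨max N M, fun n hn => ?_⟩
    rw [this, adString_mul, adString_mul, hN n (le_trans (le_max_left _ _) hn),
      hM n (le_trans (le_max_right _ _) hn), hN _ (le_max_left _ _), hM _ (le_max_right _ _)]
  | star x hx ihx =>
    intro hA'
    obtain ⟨N, hN⟩ := ihx (hsub hx)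
    have : (⟨star x, hA'⟩ : QLA) = star ⟨x, hsub hx⟩ := rfl
    refine ⟨N, fun n hn => ?_⟩
    rw [this, adString_star, adString_star, hN n hn]

theorem exists_tendsto_adString (k : PauliType) (b : ℕ → Bond) (hb : Function.Injective b)
    (A : QLA) : ∃ L, Tendsto (fun n => adString k b n A) atTop (𝓝 L) := by
  refine cauchySeq_tendsto_of_complete (Metric.cauchySeq_iff'.2 fun ε hε => ?_)
  obtain ⟨B, hB, hAB⟩ := Metric.mem_closure_iff.1 A.2 (ε / 2) (half_pos hε)
  have hB' : B ∈ quasiLocal := StarSubalgebra.le_topologicalClosure _ hB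
  obtain ⟨N, hN⟩ := eventually_adString k b hb B hB hB'
  have hd : ∀ n, dist (adString k b n A) (adString k b n ⟨B, hB'⟩) < ε / 2 := fun n => by
    rw [dist_eq_norm, ← adString_sub, norm_adString, ← dist_eq_norm]
    exact hAB
  refine ⟨N, fun n hn => ?_⟩
  calc dist (adString k b n A) (adString k b N A)
      ≤ dist (adString k b n A) (adString k b n ⟨B, hB'⟩)
        + dist (adString k b n ⟨B, hB'⟩) (adString k b N A) := dist_triangle _ _ _
    _ < ε / 2 + ε / 2 := by
        refine add_lt_add (hd n) ?_
        rw [hN n hn, dist_comm]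
        exact hd N
    _ = ε := add_halves ε

/-- `ρᵏ(A)`, the norm limit of `Ad Γ_n(A)`. -/
noncomputable def stringMap (k : PauliType) (b : ℕ → Bond) (A : QLA) : QLA :=
  limUnder atTop (fun n => adString k b n A)

theorem tendsto_stringMap (k : PauliType) (b : ℕ → Bond) (hb : Function.Injective b) (A : QLA) :
    Tendsto (fun n => adString k b n A) atTop (𝓝 (stringMap k b A)) :=
  tendsto_nhds_limUnder (exists_tendsto_adString k b hb A)

/-- `ρᵏ` as a ⋆-endomorphism of the quasi-local algebra. -/
noncomputable def stringEndo (k : PauliType) (b : ℕ → Bond) (hb : Function.Injective b) :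
    QLA →⋆ₐ[ℂ] QLA :=
  have H := tendsto_stringMap k b hb
  have hone : stringMap k b 1 = 1 :=
    tendsto_nhds_unique (H 1) (by simpa only [adString_one] using tendsto_const_nhds)
  have hadd : ∀ A B, stringMap k b (A + B) = stringMap k b A + stringMap k b B := fun A B =>
    tendsto_nhds_unique (H (A + B)) (by simpa only [adString_add] using (H A).add (H B))
  have hsmul : ∀ (r : ℂ) A, stringMap k b (r • A) = r • stringMap k b A := fun r A =>
    tendsto_nhds_unique (H (r • A)) (by simpa only [adString_smul] using (H A).const_smul r)
  { toFun := stringMap k b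
    map_one' := hone
    map_mul' := fun A B =>
      tendsto_nhds_unique (H (A * B)) (by simpa only [adString_mul] using (H A).mul (H B))
    map_zero' := by simpa using hsmul 0 0
    map_add' := hadd
    commutes' := fun r => by
      rw [Algebra.algebraMap_eq_smul_one, hsmul, hone]
    map_star' := fun A =>
      tendsto_nhds_unique (H (star A)) (by simpa only [adString_star] using (H A).star) }

/-- The star operator `A_s`. -/
noncomputable def starOp (s : Vertex) : QLA := ((starBonds s).map (sigma .X)).prod

/-- The plaquette operator `B_p`. -/
noncomputable def plaqOp (p : Vertex) : QLA := ((plaqBonds p).map (sigma .Z)).prod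

/-- The ground state `ω₀`: the state with `ω₀(A_s) = ω₀(B_p) = 1` for all stars and plaquettes. -/
structure VacuumState where
  toFunctional : QLA →ₚ[ℂ] ℂ
  map_one : toFunctional 1 = 1
  map_starOp : ∀ s, toFunctional (starOp s) = 1
  map_plaqOp : ∀ p, toFunctional (plaqOp p) = 1

theorem starOp_apply (s : Vertex) : ∃ e : Equiv.Perm (Finset Bond),
    (∀ f S, (starOp s : SpinOps) f S = f (e S)) ∧
    ∀ p S, ((plaqBonds p).map fun b => spin b (e S)).prod
      = ((plaqBonds p).map fun b => spin b S).prod := by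
  obtain ⟨m, n⟩ := s
  refine ⟨(flip ((m, n), false)).trans <| (flip ((m, n), true)).trans <|
    (flip ((m - 1, n), false)).trans (flip ((m, n - 1), true)), ?_, ?_⟩
  · intro f S
    simp only [starOp, starBonds, List.map_cons, List.map_nil, List.prod_cons, List.prod_nil,
      mul_one, MulMemClass.coe_mul, mul_apply_eq_comp, sigma, op, opX_apply, Equiv.trans_apply]
  · rintro ⟨p, q⟩ S
    simp only [plaqBonds, List.map_cons, List.map_nil, List.prod_cons, List.prod_nil, mul_one,
      Equiv.trans_apply, spin_flip, Prod.mk.injEq, and_false, Bool.false_eq_true,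
      if_false, and_true, one_mul, Bool.true_eq_false]
    have e1 : (p = m ∧ q = n) ↔ (m = p ∧ n = q) := by omega
    have e2 : (p = m - 1 ∧ q = n) ↔ (p + 1 = m ∧ q = n) := by omega
    have e3 : (p = m - 1 ∧ q + 1 = n) ↔ (p + 1 = m ∧ q = n - 1) := by omega
    have e4 : (p = m ∧ q + 1 = n) ↔ (p = m ∧ q = n - 1) := by omega
    simp only [e2, e3, e4]
    split_ifs <;> ring

theorem plaqOp_apply (p : Vertex) (f : SpinSpace) (S : Finset Bond) :
    (plaqOp p : SpinOps) f S = ((plaqBonds p).map fun b => spin b S).prod * f S := by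
  simp only [plaqOp, plaqBonds, List.map_cons, List.map_nil, List.prod_cons, List.prod_nil,
    mul_one, MulMemClass.coe_mul, mul_apply_eq_comp, sigma, op, opZ_apply, mul_assoc]

theorem starOp_sq (s : Vertex) : starOp s * starOp s = 1 := by
  have h : ∀ b c, Commute (sigma .X b) (sigma .X c) := fun b c =>
    Subtype.ext (commute_opX_opX b c)
  have h2 : ∀ L : List Bond, (L.map (sigma .X)).prod * (L.map (sigma .X)).prod = 1 := by
    intro L
    induction L with
    | nil => simp
    | cons b L ih =>
      have hc : Commute (L.map (sigma .X)).prod (sigma .X b) :=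
        Commute.list_prod_left _ _ fun x hx => by
          obtain ⟨c, -, rfl⟩ := List.mem_map.1 hx
          exact h c b
      rw [List.map_cons, List.prod_cons, mul_assoc, ← mul_assoc _ (sigma .X b), hc.eq,
        mul_assoc (sigma .X b), ih, mul_one, sigma_sq]
  exact h2 _

theorem commute_starOp (s t : Vertex) : Commute (starOp s) (starOp t) := by
  refine Commute.list_prod_left _ _ fun x hx => Commute.list_prod_right _ _ fun y hy => ?_
  obtain ⟨b, -, rfl⟩ := List.mem_map.1 hx
  obtain ⟨c, -, rfl⟩ := List.mem_map.1 hy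
  exact Subtype.ext (commute_opX_opX b c)

/-- The vectors `∏ (1 + A_s) e_∅` over the first `n` stars. -/
noncomputable def starVec : ℕ → SpinSpace
  | 0 => lp.single 2 ∅ 1
  | n + 1 => starVec n + (starOp ((Encodable.decode n : Option Vertex).getD 0) : SpinOps) (starVec n)

theorem starOp_starVec (s : Vertex) (n : ℕ) (hn : Encodable.encode s < n) :
    (starOp s : SpinOps) (starVec n) = starVec n := by
  induction n, hn using Nat.le_induction with
  | base =>
    simp only [starVec, Encodable.encodek, Option.getD_some, map_add]
    rw [← mul_apply_eq_comp, ← MulMemClass.coe_mul, starOp_sq, OneMemClass.coe_one,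
      one_apply_eq_self, add_comm]
  | succ n hn ih =>
    simp only [starVec, map_add]
    rw [← mul_apply_eq_comp, ← MulMemClass.coe_mul, (commute_starOp s _).eq, MulMemClass.coe_mul,
      mul_apply_eq_comp, ih]

theorem plaqOp_starVec (p : Vertex) (n : ℕ) : (plaqOp p : SpinOps) (starVec n) = starVec n := by
  ext S
  rw [plaqOp_apply]
  induction n generalizing S with
  | zero =>
    by_cases h : S = ∅
    · subst h; simp [spin, plaqBonds]
    · simp [starVec, lp.single_apply, h]
  | succ n ih =>
    obtain ⟨e, he, he'⟩ := starOp_apply ((Encodable.decode n : Option Vertex).getD 0)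
    simp only [starVec, lp.coeFn_add, Pi.add_apply, he, mul_add, ih]
    rw [← he' p S, ih]

theorem starVec_nonneg (n : ℕ) : (∀ S, 0 ≤ starVec n S) ∧ 1 ≤ starVec n ∅ := by
  induction n with
  | zero =>
    refine ⟨fun S => ?_, by simp [starVec, lp.single_apply]⟩
    by_cases h : S = ∅
    · subst h; simp [starVec, lp.single_apply]
    · simp [starVec, lp.single_apply, h]
  | succ n ih =>
    obtain ⟨e, he, -⟩ := starOp_apply ((Encodable.decode n : Option Vertex).getD 0)
    simp only [starVec, lp.coeFn_add, Pi.add_apply, he]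
    exact ⟨fun S => add_nonneg (ih.1 S) (ih.1 _), le_add_of_le_of_nonneg ih.2 (ih.1 _)⟩

theorem starVec_ne_zero (n : ℕ) : starVec n ≠ 0 := fun h => by
  have := (starVec_nonneg n).2
  rw [h] at this
  norm_num at this

noncomputable def starUnit (n : ℕ) : SpinSpace := ((‖starVec n‖⁻¹ : ℝ) : ℂ) • starVec n

theorem norm_starUnit (n : ℕ) : ‖starUnit n‖ = 1 := by
  have := norm_ne_zero_iff.2 (starVec_ne_zero n)
  simp [starUnit, norm_smul, this]

theorem inner_starUnit (n : ℕ) (A : SpinOps) (hA : A (starVec n) = starVec n) :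
    ⟪starUnit n, A (starUnit n)⟫_ℂ = 1 := by
  have : A (starUnit n) = starUnit n := by simp only [starUnit, map_smul, hA]
  rw [this, inner_self_eq_norm_sq_to_K, norm_starUnit]
  simp

/-- The ground state exists. -/
instance nonempty_vacuumState : Nonempty VacuumState := by
  have hlim : ∀ A : QLA, ∃ L, Tendsto (fun n => ⟪starUnit n, (A : SpinOps) (starUnit n)⟫_ℂ)
      (hyperfilter ℕ) (𝓝 L) := fun A => by
    have hc := isCompact_closedBall (0 : ℂ) ‖(A : SpinOps)‖
    have hmem : ∀ n, ⟪starUnit n, (A : SpinOps) (starUnit n)⟫_ℂ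
        ∈ Metric.closedBall (0 : ℂ) ‖(A : SpinOps)‖ := fun n => by
      rw [mem_closedBall_zero_iff]
      refine (norm_inner_le_norm _ _).trans ?_
      have := (A : SpinOps).le_opNorm (starUnit n)
      rw [norm_starUnit, mul_one] at this
      rwa [norm_starUnit, one_mul]
    obtain ⟨L, -, hL⟩ := hc.ultrafilter_le_nhds
      ((hyperfilter ℕ).map fun n => ⟪starUnit n, (A : SpinOps) (starUnit n)⟫_ℂ)
      (by
        rw [Filter.le_principal_iff]
        exact Filter.mem_map.2 (Filter.univ_mem' hmem))
    exact ⟨L, hL⟩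
  choose L hL using hlim
  have heq : ∀ A : QLA, (∀ᶠ n in atTop, (A : SpinOps) (starVec n) = starVec n) → L A = 1 :=
    fun A hA => by
      refine tendsto_nhds_unique (hL A) (tendsto_const_nhds.congr' ?_)
      have : ∀ᶠ n in (hyperfilter ℕ : Filter ℕ), (A : SpinOps) (starVec n) = starVec n :=
        Nat.hyperfilter_le_atTop hA
      filter_upwards [this] with n hn
      exact (inner_starUnit n _ hn).symm
  refine ⟨{ toFunctional := PositiveLinearMap.mk₀
              { toFun := L
                map_add' := fun A B => tendsto_nhds_unique (hL (A + B)) ?_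
                map_smul' := fun r A => tendsto_nhds_unique (hL (r • A)) ?_ } ?_
            map_one := heq 1 (Eventually.of_forall fun n => rfl)
            map_starOp := fun s => heq _ ?_
            map_plaqOp := fun p => heq _ (Eventually.of_forall (plaqOp_starVec p)) }⟩
  · simpa [inner_add_right] using (hL A).add (hL B)
  · simpa [inner_smul_right] using (hL A).const_mul r
  · intro A hA
    refine ge_of_tendsto' (hL A) fun n => ?_
    have hA' : 0 ≤ (A : SpinOps) := hA
    rw [ContinuousLinearMap.nonneg_iff_isPositive] at hA'
    exact hA'.inner_nonneg_right _
  · filter_upwards [eventually_gt_atTop (Encodable.encode s)] with n hn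
    exact starOp_starVec s n hn

/-- The GNS Hilbert space of the ground state. -/
noncomputable abbrev Hil (ω : VacuumState) : Type := ω.toFunctional.GNS

/-- The bounded operators on the GNS Hilbert space. -/
noncomputable abbrev Ops (ω : VacuumState) : Type := Hil ω →L[ℂ] Hil ω

/-- The GNS representation of the ground state. -/
noncomputable def rep (ω : VacuumState) : QLA →⋆ₐ[ℂ] Ops ω := ω.toFunctional.gnsStarAlgHom

/-- The algebra `𝔄(Λ)` of observables localized in a set `Λ` of bonds: the norm closure of the
algebra generated by the Pauli matrices at the bonds of `Λ`. -/
noncomputable def localAlg (L : Set Bond) : StarSubalgebra ℂ QLA :=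
  (StarAlgebra.adjoin ℂ {A | ∃ k, ∃ b ∈ L, A = sigma k b}).topologicalClosure

/-- The von Neumann algebra `π₀(𝔄(Λ))''`. -/
noncomputable def vnAlg (ω : VacuumState) (L : Set Bond) : StarSubalgebra ℂ (Ops ω) :=
  StarSubalgebra.centralizer ℂ
    (StarSubalgebra.centralizer ℂ (rep ω '' (localAlg L : Set QLA)) : Set (Ops ω))

/-! ### Cones -/

/-- A cone: two half-lines with directions `u` and `w` emanating from a lattice point, the angle
from `u` counter-clockwise to `w` lying strictly between `0` and `π`. -/
structure Cone where
  apex : Vertex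
  u : ℝ × ℝ
  w : ℝ × ℝ
  angle : 0 < u.1 * w.2 - u.2 * w.1

/-- The closed planar area bounded by the two half-lines. -/
def Cone.area (C : Cone) : Set (ℝ × ℝ) :=
  {p | ∃ s t : ℝ, 0 ≤ s ∧ 0 ≤ t ∧
    p = (C.apex.1 + s * C.u.1 + t * C.w.1, C.apex.2 + s * C.u.2 + t * C.w.2)}

/-- The bond as a closed line segment in the plane. -/
def bondSegment (b : Bond) : Set (ℝ × ℝ) :=
  segment ℝ ((b.1.1 : ℝ), (b.1.2 : ℝ))
    (if b.2 then ((b.1.1 : ℝ), (b.1.2 : ℝ) + 1) else ((b.1.1 : ℝ) + 1, (b.1.2 : ℝ)))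

/-- The bonds of a cone: those inside the area, or intersected by one of the two half-lines;
equivalently, those that meet the closed area. -/
def Cone.bonds (C : Cone) : Set Bond := {b | (bondSegment b ∩ C.area).Nonempty}

/-- The translated cone `C + x`. -/
def Cone.translate (C : Cone) (x : Vertex) : Cone := { C with apex := C.apex + x }

/-- Counter-clockwise rotation of the plane by the angle `θ`. -/
noncomputable def rotateVec (θ : ℝ) (v : ℝ × ℝ) : ℝ × ℝ :=
  (Real.cos θ * v.1 - Real.sin θ * v.2, Real.sin θ * v.1 + Real.cos θ * v.2)

/-- The cone rotated counter-clockwise around its apex by the angle `θ`. -/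
noncomputable def Cone.rotate (C : Cone) (θ : ℝ) : Cone where
  apex := C.apex
  u := rotateVec θ C.u
  w := rotateVec θ C.w
  angle := by
    have h := C.angle
    have h2 := Real.sin_sq_add_cos_sq θ
    simp only [rotateVec]
    calc 0 < (C.u.1 * C.w.2 - C.u.2 * C.w.1) * (Real.sin θ ^ 2 + Real.cos θ ^ 2) := by
          rw [h2, mul_one]; exact h
      _ = _ := by ring

/-- `Λ₁ < Λ₂` with respect to the forbidden cone `Λa`: the cones are disjoint, both are contained
in `(Λa + x)ᶜ` for some `x`, and `Λ₁` can be rotated counter-clockwise around its apex until it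
meets `Λa + x`, while being disjoint from `Λ₂` at any intermediate angle. -/
def Precedes (Λa Λ₁ Λ₂ : Cone) : Prop :=
  Disjoint Λ₁.bonds Λ₂.bonds ∧ ∃ x : Vertex,
    Λ₁.bonds ⊆ (Λa.translate x).bondsᶜ ∧ Λ₂.bonds ⊆ (Λa.translate x).bondsᶜ ∧
    ∃ θ : ℝ, 0 < θ ∧ ((Λ₁.rotate θ).bonds ∩ (Λa.translate x).bonds).Nonempty ∧
      ∀ φ : ℝ, 0 ≤ φ → φ < θ → Disjoint (Λ₁.rotate φ).bonds Λ₂.bonds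

/-! ### Paths extending to infinity and their automorphisms -/

/-- The bonds at a site: the star of a lattice point (for paths on the lattice, type `Z`), or the
boundary of a plaquette (for paths on the dual lattice, type `X`). -/
def siteBonds : PauliType → Vertex → List Bond
  | .X => plaqBonds
  | .Z => starBonds

/-- A path of type `X` (on the dual lattice) or `Z` (on the lattice) extending to infinity: a
sequence of sites, any two consecutive ones being distinct and joined by (respectively separated
by) the bond `bond n`. No bond is used twice, so the path leaves every finite region. -/
structure InfPath (k : PauliType) where
  site : ℕ → Vertex
  bond : ℕ → Bond
  bond_injective : Function.Injective bond
  step : ∀ n, site n ≠ site (n + 1) ∧ bond n ∈ siteBonds k (site n) ∧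
    bond n ∈ siteBonds k (site (n + 1))

/-- The path lies in the cone `C`. -/
def InfPath.IsIn {k : PauliType} (γ : InfPath k) (C : Cone) : Prop := ∀ n, γ.bond n ∈ C.bonds

/-- The automorphism `ρᵏ_γ` of a path `γ` extending to infinity. -/
noncomputable def InfPath.auto {k : PauliType} (γ : InfPath k) : QLA →⋆ₐ[ℂ] QLA :=
  stringEndo k γ.bond γ.bond_injective

/-- `ρ` is localized in `L`: it acts trivially on `𝔄(Lᶜ)`. -/
def IsLocalizedIn (ρ : QLA →⋆ₐ[ℂ] QLA) (L : Set Bond) : Prop := ∀ A ∈ localAlg Lᶜ, ρ A = A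

/-- The tensor product `ρ₁ ⊗ ρ₂ = ρ₁ ∘ ρ₂` of endomorphisms. -/
noncomputable def tensorEndo (ρ₁ ρ₂ : QLA →⋆ₐ[ℂ] QLA) : QLA →⋆ₐ[ℂ] QLA := ρ₁.comp ρ₂

/-- `T` intertwines `ρ` and `σ` (with `𝔄` identified with `π₀(𝔄)`). -/
def IsIntertwiner {ω : VacuumState} (T : Ops ω) (ρ σ : QLA →⋆ₐ[ℂ] QLA) : Prop :=
  ∀ A, T * rep ω (ρ A) = rep ω (σ A) * T

/-! ### The auxiliary algebra -/

/-- The auxiliary algebra `𝔄^{Λa}`: the norm closure of the (directed) union over `x` of the von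
Neumann algebras `𝔄((Λa + x)ᶜ)''`. -/
noncomputable def auxAlg (ω : VacuumState) (Λa : Cone) : StarSubalgebra ℂ (Ops ω) :=
  (⨆ x : Vertex, vnAlg ω (Λa.translate x).bondsᶜ).topologicalClosure

/-- The weak operator topology on the auxiliary algebra. -/
@[reducible] noncomputable def auxWeak (ω : VacuumState) (Λa : Cone) : TopologicalSpace (auxAlg ω Λa) :=
  TopologicalSpace.induced
    (fun B : auxAlg ω Λa => (ContinuousLinearMapWOT.ofCLM (B : Ops ω) : Hil ω →WOT[ℂ] Hil ω))
    inferInstance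

/-- `E` is the extension `ρ^{Λa}` of `ρ` to an endomorphism of the auxiliary algebra which is weakly
continuous on every `𝔄((Λa + x)ᶜ)''`. -/
def IsAuxExtension (ω : VacuumState) (Λa : Cone) (ρ : QLA →⋆ₐ[ℂ] QLA)
    (E : auxAlg ω Λa →⋆ₐ[ℂ] auxAlg ω Λa) : Prop :=
  (∀ A, ∃ h : rep ω A ∈ auxAlg ω Λa, (E ⟨rep ω A, h⟩ : Ops ω) = rep ω (ρ A)) ∧
  ∀ x : Vertex, @ContinuousOn _ _ (auxWeak ω Λa) (auxWeak ω Λa) E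
    {B | (B : Ops ω) ∈ vnAlg ω (Λa.translate x).bondsᶜ}

/-! ### Braiding, conjugates and twist -/

/-- `ε` is the braiding `ε_{ρ₁,ρ₂} = (V ⊗ I)^* (I ⊗ V) = V^* ρ₁^{Λa}(V)` of endomorphisms localized
in cones `Λ₁` and `Λ₂` that have a common larger cone. Here `V` is a unitary in the auxiliary algebra
intertwining `ρ₂` and an endomorphism localized in a cone `Λ₂' < Λ₁`. -/
def IsBraiding (ω : VacuumState) (Λa Λ₁ Λ₂ : Cone) (ρ₁ ρ₂ : QLA →⋆ₐ[ℂ] QLA)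
    (ε : auxAlg ω Λa) : Prop :=
  IsLocalizedIn ρ₁ Λ₁.bonds ∧ IsLocalizedIn ρ₂ Λ₂.bonds ∧
  (∃ Λ : Cone, Λ₁.bonds ∪ Λ₂.bonds ⊆ Λ.bonds) ∧
  ∃ (Λ₂' : Cone) (ρ₂' : QLA →⋆ₐ[ℂ] QLA) (V : auxAlg ω Λa) (E₁ : auxAlg ω Λa →⋆ₐ[ℂ] auxAlg ω Λa),
    Precedes Λa Λ₂' Λ₁ ∧ IsLocalizedIn ρ₂' Λ₂'.bonds ∧
    V ∈ unitary (auxAlg ω Λa) ∧ IsIntertwiner (V : Ops ω) ρ₂ ρ₂' ∧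
    IsAuxExtension ω Λa ρ₁ E₁ ∧ ε = star V * E₁ V

/-- `(ρ', R, R')` is a standard (and normalized) conjugate of `ρ`: `R` intertwines the identity and
`ρ' ⊗ ρ`, `R'` intertwines the identity and `ρ ⊗ ρ'`, the conjugate equations `R'^* ρ(R) = I` and
`R^* ρ'(R') = I` hold, `R^* R = R'^* R'`, and `R^* ρ'(T) R = R'^* T R'` for all `T ∈ End(ρ)`. -/
def IsStandardConjugate (ω : VacuumState) (Λa : Cone) (ρ ρ' : QLA →⋆ₐ[ℂ] QLA)
    (R R' : auxAlg ω Λa) : Prop :=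
  IsIntertwiner (R : Ops ω) (StarAlgHom.id ℂ QLA) (tensorEndo ρ' ρ) ∧
  IsIntertwiner (R' : Ops ω) (StarAlgHom.id ℂ QLA) (tensorEndo ρ ρ') ∧
  ∃ E E' : auxAlg ω Λa →⋆ₐ[ℂ] auxAlg ω Λa,
    IsAuxExtension ω Λa ρ E ∧ IsAuxExtension ω Λa ρ' E' ∧
    star R' * E R = 1 ∧ star R * E' R' = 1 ∧ star R * R = star R' * R' ∧
    ∀ T : auxAlg ω Λa, IsIntertwiner (T : Ops ω) ρ ρ → star R * E' T * R = star R' * T * R'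

/-- `Θ` is the twist `(R^* ⊗ id_ρ) ∘ (id_{ρ'} ⊗ ε_{ρ,ρ}) ∘ (R ⊗ id_ρ) = R^* ρ'(ε_{ρ,ρ}) R` of the
endomorphism `ρ` localized in the cone `C`, formed with the conjugate `(ρ', R, R')`; recall that the
tensor product of intertwiners is `S ⊗ T = S σ(T)`, with `σ` the source of `S`. -/
def IsTwist (ω : VacuumState) (Λa C : Cone) (ρ ρ' : QLA →⋆ₐ[ℂ] QLA)
    (R Θ : auxAlg ω Λa) : Prop :=
  ∃ (ε : auxAlg ω Λa) (E' : auxAlg ω Λa →⋆ₐ[ℂ] auxAlg ω Λa),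
    IsBraiding ω Λa C C ρ ρ ε ∧ IsAuxExtension ω Λa ρ' E' ∧ Θ = star R * E' ε * R

/-- `(ρ, I, I)` is a standard conjugate of `ρ`, and with it the twist of `ρ` exists and is the scalar
`c`, whatever choices are made in its construction. -/
def HasTwist (ω : VacuumState) (Λa C : Cone) (ρ : QLA →⋆ₐ[ℂ] QLA) (c : ℂ) : Prop :=
  IsStandardConjugate ω Λa ρ ρ 1 1 ∧
  ∀ Θ : auxAlg ω Λa, IsTwist ω Λa C ρ ρ 1 Θ ↔ Θ = c • (1 : auxAlg ω Λa)

end ToricCode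

/-! The automorphism of a path multiplies every Pauli matrix by a sign. An endomorphism of this kind
is encoded by mod-2 functions `D k` on the bonds (`IsPauliEndo`), `D k` being its string formed with
`σᵏ`, and the twist becomes a parity of crossings.

Transport of strings. A finite closed chain is a sum of elementary loops (`exists_loopSum_eq`), so
its string operator is a product of star or plaquette operators and fixes the vacuum vector
(`rep_pauli_vac`). Let finite chains `F n` have a fixed boundary and converge bond by bond. Their
string operators then agree on the vacuum vector, and they commute with each Pauli matrix up to a
sign that is eventually constant. By cyclicity they converge strongly, to a unitary
(`exists_transporter`). If the limit chain is `D + D'`, this unitary intertwines the endomorphisms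
of `D` and `D'`, and it lies in the von Neumann algebra of any region that contains all `F n`
(`exists_unitary_of_isTransport`). Plane geometry supplies such sequences: a path in a cone moves to
a chosen ray inside the cone (`InfPath.exists_isTransport`), and rays in two cones move into each
other while avoiding a third cone disjoint from both (`Ray.exists_isTransport`).

Extension. Moving the strings of `ρ` into `Λa + x` gives a unitary `W` with `ρ = Ad W` on the
observables outside `Λa + x`. Any two such unitaries act alike on the bicommutant, so the
conjugations fit together to an extension (`exists_isExt`). Conversely, density in the bicommutant
and weak continuity force every extension to be given by them (`IsExt.apply_eq_conj`).

The sign. The reference ray of type `Z` is the ray of type `X` translated by half a diagonal of the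
lattice, and coefficients `a .X`, `a .Z` say which of the two is present. A charge transporter from
`C` to `K` is `V = v u`, with `u` moving the given strings to the rays inside `C` and `v` the strong
limit of string operators along chains `F n` from the rays to rays in `K`. The extension multiplies
`V` by the sign with which `W` passes through the string operators of `F n`
(`exists_charge_transporter`). Its exponent counts crossings of the `X` part of `F n` with the `Z`
ray and of the `Z` part with the `X` ray. Summation by parts shows that this symmetrized number
depends only on bonds at the end points (`pair_shift_add_pair_shift`), and it is odd if both types
are present (`Ray.eventually_pair`). The sign is thus `sgn (a .X * a .Z)`, which is `-1` only for
`Y`.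

Independence and conjugates. Another transporter `V` into `K` differs from `v` by `T = V v*`, which
commutes with the observables outside `K`. As `W` can be chosen in the von Neumann algebra of the
complement of `K`, the extension fixes `T` (`star_mul_ext_eq`). Finally `ρ ∘ ρ = id` because signs
square to one, so `ρ` is its own conjugate with `R = I`, and the twist is the scalar by which the
braiding acts. -/

namespace ToricCode

/-! ### Chains of bonds and products of Pauli matrices -/

/-- The sign `(-1)^a`. -/
noncomputable def sgn (a : ZMod 2) : ℂ := if a = 0 then 1 else -1

@[simp] theorem sgn_zero : sgn 0 = 1 := by simp [sgn]
@[simp] theorem sgn_one : sgn 1 = -1 := by simp [sgn]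

theorem zmod_two_cases (a : ZMod 2) : a = 0 ∨ a = 1 := by revert a; decide

theorem zmod_two_add_self (a : ZMod 2) : a + a = 0 := CharTwo.add_self_eq_zero a

theorem sgn_add (a b : ZMod 2) : sgn (a + b) = sgn a * sgn b := by
  rcases zmod_two_cases a with rfl | rfl <;> rcases zmod_two_cases b with rfl | rfl <;>
    simp [zmod_two_add_self]

theorem sgn_mul_self (a : ZMod 2) : sgn a * sgn a = 1 := by
  rw [← sgn_add, zmod_two_add_self, sgn_zero]

/-- Finite chains of bonds, with coefficients modulo two. -/
abbrev Chain : Type := Bond →₀ ZMod 2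

theorem chain_add_self (x : Chain) : x + x = 0 := by ext b; exact zmod_two_add_self _

/-- The other type. -/
def PauliType.dual : PauliType → PauliType
  | .X => .Z
  | .Z => .X

/-- Whether Pauli matrices of the two types anticommute at a common bond. -/
def cross : PauliType → PauliType → ZMod 2
  | .X, .Z => 1
  | .Z, .X => 1
  | _, _ => 0

theorem cross_self (k : PauliType) : cross k k = 0 := by cases k <;> rfl
theorem cross_comm (k l : PauliType) : cross k l = cross l k := by cases k <;> cases l <;> rfl

theorem opZ_mul_opX (b : Bond) : opZ b * opX b = -(opX b * opZ b) := by
  ext f S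
  have h : (-(opX b * opZ b)) f S = -((opX b * opZ b) f S) := rfl
  rw [h]
  simp [spin_flip]

theorem sigma_mul_sigma (k l : PauliType) (b c : Bond) :
    sigma l b * sigma k c =
      sgn (cross k l * (if b = c then 1 else 0)) • (sigma k c * sigma l b) := by
  by_cases h : b = c
  · subst h
    cases k <;> cases l
    · simp [cross]
    · simp only [cross, if_true, mul_one, sgn_one, neg_smul, one_smul]
      exact Subtype.ext (opZ_mul_opX b)
    · simp only [cross, if_true, mul_one, sgn_one, neg_smul, one_smul]
      refine Subtype.ext ?_
      change opX b * opZ b = -(opZ b * opX b)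
      rw [opZ_mul_opX, neg_neg]
    · simp [cross]
  · simp only [h, if_false, mul_zero, sgn_zero, one_smul]
    exact (commute_sigma l k h).eq

theorem commute_sigma_same (k : PauliType) (b c : Bond) : Commute (sigma k b) (sigma k c) := by
  have := sigma_mul_sigma k k c b
  rw [cross_self, zero_mul, sgn_zero, one_smul] at this
  exact this.symm

/-- The product of the Pauli matrices of type `k` over a chain. -/
noncomputable def pauli (k : PauliType) (x : Chain) : QLA :=
  x.support.noncommProd (sigma k) fun b _ c _ _ => commute_sigma_same k b c

@[simp] theorem pauli_zero (k : PauliType) : pauli k 0 = 1 := by simp [pauli]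

theorem pauli_of_support_eq_insert (k : PauliType) {x y : Chain} {b : Bond}
    (h : y.support = insert b x.support) (hb : b ∉ x.support) :
    pauli k y = sigma k b * pauli k x := by
  unfold pauli
  rw [← Finset.noncommProd_insert_of_notMem _ _ _ (fun b _ c _ _ => commute_sigma_same k b c) hb]
  exact Finset.noncommProd_congr h (fun _ _ => rfl) _

/-- A bond already in the chain cancels mod 2, and correspondingly `σ² = 1`. This makes `pauli k` a
homomorphism from chains to operators. -/
theorem pauli_single_add (k : PauliType) (b : Bond) (x : Chain) :
    pauli k (Finsupp.single b 1 + x) = sigma k b * pauli k x := by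
  by_cases hb : b ∈ x.support
  · have hxb : x b = 1 := (zmod_two_cases _).resolve_left (Finsupp.mem_support_iff.1 hb)
    have h1 : pauli k x = sigma k b * pauli k (Finsupp.single b 1 + x) := by
      refine pauli_of_support_eq_insert k ?_ ?_
      · ext c
        by_cases hc : c = b
        · subst hc; simp [hxb]
        · simp [hc]
      · simp [hxb, zmod_two_add_self]
    rw [h1, ← mul_assoc, sigma_sq, one_mul]
  · refine pauli_of_support_eq_insert k ?_ hb
    ext c
    have hxb : x b = 0 := by simpa using hb
    by_cases hc : c = b
    · subst hc; simp [hxb]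
    · simp [hc]

theorem chain_induction {P : Chain → Prop} (h0 : P 0)
    (h1 : ∀ b x, P x → P (Finsupp.single b 1 + x)) (x : Chain) : P x := by
  induction x using Finsupp.induction with
  | zero => exact h0
  | single_add b a x _ ha ih =>
    rw [(zmod_two_cases a).resolve_left ha]
    exact h1 b x ih

theorem pauli_add (k : PauliType) (x y : Chain) : pauli k (x + y) = pauli k x * pauli k y := by
  induction x using chain_induction with
  | h0 => simp
  | h1 b x ih => rw [add_assoc, pauli_single_add, pauli_single_add, ih, mul_assoc]

theorem pauli_single (k : PauliType) (b : Bond) : pauli k (Finsupp.single b 1) = sigma k b := by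
  simpa using pauli_single_add k b 0

theorem pauli_comm (k : PauliType) (x y : Chain) : pauli k x * pauli k y = pauli k y * pauli k x := by
  rw [← pauli_add, add_comm, pauli_add]

theorem pauli_sq (k : PauliType) (x : Chain) : pauli k x * pauli k x = 1 := by
  rw [← pauli_add, chain_add_self, pauli_zero]

theorem star_pauli (k : PauliType) (x : Chain) : star (pauli k x) = pauli k x := by
  induction x using chain_induction with
  | h0 => simp
  | h1 b x ih =>
    rw [pauli_single_add, star_mul, ih, star_sigma, ← pauli_single, pauli_comm]

theorem pauli_mem_unitary (k : PauliType) (x : Chain) : pauli k x ∈ unitary QLA := by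
  rw [Unitary.mem_iff, star_pauli]
  exact ⟨pauli_sq k x, pauli_sq k x⟩

theorem sigma_mul_pauli (k l : PauliType) (b : Bond) (x : Chain) :
    sigma l b * pauli k x = sgn (cross k l * x b) • (pauli k x * sigma l b) := by
  induction x using chain_induction with
  | h0 => simp
  | h1 c x ih =>
    rw [pauli_single_add, ← mul_assoc, sigma_mul_sigma, smul_mul_assoc, mul_assoc, ih,
      mul_smul_comm, smul_smul, ← sgn_add, ← mul_assoc, ← mul_add, Finsupp.add_apply,
      Finsupp.single_apply]
    simp only [eq_comm]

theorem pauli_mul_sigma (k l : PauliType) (b : Bond) (x : Chain) :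
    pauli k x * sigma l b = sgn (cross k l * x b) • (sigma l b * pauli k x) := by
  rw [sigma_mul_pauli, smul_smul, sgn_mul_self, one_smul]

theorem sigma_mem_localAlg (k : PauliType) {b : Bond} {L : Set Bond} (hb : b ∈ L) :
    sigma k b ∈ localAlg L :=
  StarSubalgebra.le_topologicalClosure _ (StarAlgebra.subset_adjoin _ _ ⟨k, b, hb, rfl⟩)

theorem pauli_mem_localAlg (k : PauliType) {x : Chain} {L : Set Bond} (hx : ↑x.support ⊆ L) :
    pauli k x ∈ localAlg L :=
  Submonoid.noncommProd_mem (localAlg L).toSubalgebra.toSubmonoid _ _ _ fun _ hb =>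
    sigma_mem_localAlg k (hx hb)

/-- Induction on the elements of a local algebra. -/
theorem localAlg_induction {L : Set Bond} {P : QLA → Prop} (hclosed : IsClosed {A | P A})
    (hsigma : ∀ k, ∀ b ∈ L, P (sigma k b)) (hone : P 1) (hsmul : ∀ (r : ℂ) A, P A → P (r • A))
    (hadd : ∀ A B, P A → P B → P (A + B)) (hmul : ∀ A B, P A → P B → P (A * B))
    {A : QLA} (hA : A ∈ localAlg L) : P A := by
  have h : ∀ B ∈ StarAlgebra.adjoin ℂ {A : QLA | ∃ k, ∃ b ∈ L, A = sigma k b}, P B := by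
    intro B hB
    -- The generators are self-adjoint, so the star closure is an ordinary `Algebra.adjoin` and the
    -- induction needs no case for the star.
    have hs : star {A : QLA | ∃ k, ∃ b ∈ L, A = sigma k b} = {A | ∃ k, ∃ b ∈ L, A = sigma k b} := by
      ext A
      constructor
      · rintro ⟨k, b, hb, h⟩
        exact ⟨k, b, hb, by rw [← star_star A, h, star_sigma]⟩
      · rintro ⟨k, b, hb, rfl⟩
        exact ⟨k, b, hb, star_sigma k b⟩
    rw [← StarSubalgebra.mem_toSubalgebra, StarAlgebra.adjoin_toSubalgebra, hs,
      Set.union_self] at hB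
    induction hB using Algebra.adjoin_induction with
    | mem x hx =>
      obtain ⟨k, b, hb, rfl⟩ := hx
      exact hsigma k b hb
    | algebraMap r =>
      rw [Algebra.algebraMap_eq_smul_one]
      exact hsmul _ _ hone
    | add x y _ _ hx hy => exact hadd _ _ hx hy
    | mul x y _ _ hx hy => exact hmul _ _ hx hy
  have hA' : A ∈ closure (StarAlgebra.adjoin ℂ {A : QLA | ∃ k, ∃ b ∈ L, A = sigma k b} : Set QLA) :=
    hA
  exact closure_minimal h hclosed hA'

theorem localAlg_mono {L L' : Set Bond} (h : L ⊆ L') : localAlg L ≤ localAlg L' := by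
  refine StarSubalgebra.topologicalClosure_mono (StarAlgebra.adjoin_mono ?_)
  rintro A ⟨k, b, hb, rfl⟩
  exact ⟨k, b, h hb, rfl⟩

/-- The polynomials in the Pauli matrices are dense in the quasi-local algebra. -/
theorem dense_adjoin_sigma :
    Dense (StarAlgebra.adjoin ℂ {A : QLA | ∃ k b, A = sigma k b} : Set QLA) := by
  intro A
  have h2 : ∀ B ∈ StarAlgebra.adjoin ℂ (Set.range opX ∪ Set.range opZ),
      ∃ B' ∈ StarAlgebra.adjoin ℂ {A : QLA | ∃ k b, A = sigma k b}, (B' : SpinOps) = B := by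
    intro B hB
    have : StarAlgebra.adjoin ℂ (Set.range opX ∪ Set.range opZ) ≤
        (StarAlgebra.adjoin ℂ {A : QLA | ∃ k b, A = sigma k b}).map quasiLocal.subtype := by
      refine StarAlgebra.adjoin_le ?_
      rintro _ (⟨b, rfl⟩ | ⟨b, rfl⟩)
      · exact ⟨sigma .X b, StarAlgebra.subset_adjoin _ _ ⟨_, _, rfl⟩, rfl⟩
      · exact ⟨sigma .Z b, StarAlgebra.subset_adjoin _ _ ⟨_, _, rfl⟩, rfl⟩
    exact this hB
  rw [Metric.mem_closure_iff]
  intro ε hε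
  obtain ⟨B, hB, hAB⟩ := Metric.mem_closure_iff.1 A.2 ε hε
  obtain ⟨B', hB', rfl⟩ := h2 B hB
  exact ⟨B', hB', hAB⟩

theorem localAlg_univ : localAlg Set.univ = ⊤ := by
  refine eq_top_iff.2 fun A _ => ?_
  have := dense_adjoin_sigma A
  have h : {A : QLA | ∃ k, ∃ b ∈ (Set.univ : Set Bond), A = sigma k b} =
      {A : QLA | ∃ k b, A = sigma k b} := by simp
  change A ∈ closure _
  rwa [h]

theorem mem_localAlg_univ (A : QLA) : A ∈ localAlg Set.univ := by
  rw [localAlg_univ]; exact StarSubalgebra.mem_top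

/-- Used to place an approximant inside one member of an exhausting sequence of regions. -/
theorem exists_finset_near (A : QLA) {ε : ℝ} (hε : 0 < ε) :
    ∃ (F : Finset Bond) (B : QLA), B ∈ localAlg (F : Set Bond) ∧ ‖A - B‖ < ε := by
  classical
  obtain ⟨B, hB, hAB⟩ := Metric.mem_closure_iff.1 (dense_adjoin_sigma A) ε hε
  rw [dist_eq_norm] at hAB
  suffices h : ∃ F : Finset Bond, B ∈ localAlg (F : Set Bond) by
    obtain ⟨F, hF⟩ := h
    exact ⟨F, B, hF, hAB⟩
  clear hAB
  have hB' : B ∈ StarAlgebra.adjoin ℂ {A : QLA | ∃ k b, A = sigma k b} := hB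
  clear hB
  induction hB' using StarAlgebra.adjoin_induction with
  | mem x hx =>
    obtain ⟨k, b, rfl⟩ := hx
    exact ⟨{b}, sigma_mem_localAlg k (by simp)⟩
  | algebraMap r => exact ⟨∅, algebraMap_mem _ r⟩
  | add x y _ _ hx hy =>
    obtain ⟨F, hF⟩ := hx
    obtain ⟨G, hG⟩ := hy
    exact ⟨F ∪ G, add_mem (localAlg_mono (by simp) hF) (localAlg_mono (by simp) hG)⟩
  | mul x y _ _ hx hy =>
    obtain ⟨F, hF⟩ := hx
    obtain ⟨G, hG⟩ := hy
    exact ⟨F ∪ G, mul_mem (localAlg_mono (by simp) hF) (localAlg_mono (by simp) hG)⟩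
  | star x _ hx =>
    obtain ⟨F, hF⟩ := hx
    exact ⟨F, star_mem hF⟩

/-! ### Endomorphisms that multiply the Pauli matrices by signs -/

/-- `ρ` multiplies every Pauli matrix by a sign: it is implemented formally by the product of the
Pauli matrices of both types `k` over the (possibly infinite) chains `D k`. -/
def IsPauliEndo (ρ : QLA →⋆ₐ[ℂ] QLA) (D : PauliType → Bond → ZMod 2) : Prop :=
  ∀ l b, ρ (sigma l b) = sgn (D l.dual b) • sigma l b

theorem continuous_endo (ρ : QLA →⋆ₐ[ℂ] QLA) : Continuous ρ :=
  (NonUnitalStarAlgHom.norm_apply_le ρ |> fun h =>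
    AddMonoidHomClass.continuous_of_bound ρ 1 (by simpa using h))

theorem IsPauliEndo.apply_mem {ρ : QLA →⋆ₐ[ℂ] QLA} {D : PauliType → Bond → ZMod 2}
    (h : IsPauliEndo ρ D) {L : Set Bond} {A : QLA} (hA : A ∈ localAlg L) : ρ A ∈ localAlg L := by
  have hc : IsClosed (localAlg L : Set QLA) := StarSubalgebra.isClosed_topologicalClosure _
  refine localAlg_induction (P := fun A => ρ A ∈ localAlg L)
    (hc.preimage (continuous_endo ρ)) ?_ ?_ ?_ ?_ ?_ hA
  · intro k b hb
    rw [h]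
    exact SMulMemClass.smul_mem _ (sigma_mem_localAlg k hb)
  · rw [map_one]; exact one_mem _
  · intro r A hA; rw [map_smul]; exact SMulMemClass.smul_mem _ hA
  · intro A B hA hB; rw [map_add]; exact add_mem hA hB
  · intro A B hA hB; rw [map_mul]; exact mul_mem hA hB

theorem endo_eqOn_localAlg {ρ σ : QLA →⋆ₐ[ℂ] QLA} {L : Set Bond}
    (h : ∀ l, ∀ b ∈ L, ρ (sigma l b) = σ (sigma l b)) {A : QLA} (hA : A ∈ localAlg L) :
    ρ A = σ A := by
  refine localAlg_induction (P := fun A => ρ A = σ A)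
    (isClosed_eq (continuous_endo ρ) (continuous_endo σ)) h ?_ ?_ ?_ ?_ hA
  · simp
  · intro r A hA; simp [hA]
  · intro A B hA hB; simp [hA, hB]
  · intro A B hA hB; simp [hA, hB]

theorem endo_ext {ρ σ : QLA →⋆ₐ[ℂ] QLA} (h : ∀ l b, ρ (sigma l b) = σ (sigma l b)) (A : QLA) :
    ρ A = σ A :=
  endo_eqOn_localAlg (L := Set.univ) (fun l b _ => h l b) (mem_localAlg_univ A)

theorem IsPauliEndo.isLocalizedIn {ρ : QLA →⋆ₐ[ℂ] QLA} {D : PauliType → Bond → ZMod 2}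
    (h : IsPauliEndo ρ D) {L : Set Bond} (hD : ∀ k, ∀ b ∉ L, D k b = 0) : IsLocalizedIn ρ L := by
  intro A hA
  exact endo_eqOn_localAlg (σ := StarAlgHom.id ℂ QLA) (fun l b hb => by
    rw [h, hD _ b hb]; simp) hA

theorem IsPauliEndo.tensorEndo {ρ σ : QLA →⋆ₐ[ℂ] QLA} {D D' : PauliType → Bond → ZMod 2}
    (h : IsPauliEndo ρ D) (h' : IsPauliEndo σ D') :
    IsPauliEndo (tensorEndo ρ σ) (fun k b => D k b + D' k b) := by
  intro l b
  simp only [ToricCode.tensorEndo, StarAlgHom.comp_apply, h' l b, map_smul, h l b, smul_smul, sgn_add]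
  rw [mul_comm]

/-- Signs square to one. This is why `ρ` serves as its own conjugate with `R = I`. -/
theorem IsPauliEndo.apply_apply {ρ : QLA →⋆ₐ[ℂ] QLA} {D : PauliType → Bond → ZMod 2}
    (h : IsPauliEndo ρ D) (A : QLA) : ρ (ρ A) = A := by
  refine endo_ext (ρ := ρ.comp ρ) (σ := StarAlgHom.id ℂ QLA) (fun l b => ?_) A
  simp [h l b, smul_smul, sgn_mul_self]

open Classical in
/-- The indicator function modulo two. -/
noncomputable def ind (S : Set Bond) (b : Bond) : ZMod 2 := if b ∈ S then 1 else 0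

/-- By injectivity a bond is used at most once, so its sign changes at most at one step. -/
theorem adString_sigma (k l : PauliType) (b : ℕ → Bond) (hb : Function.Injective b) (n : ℕ)
    (c : Bond) : adString k b n (sigma l c) =
      sgn (cross k l * ind (b '' Set.Iio n) c) • sigma l c := by
  induction n with
  | zero => simp [adString, stringOp, ind]
  | succ n ih =>
    by_cases h : b n = c
    · subst h
      have h0 : ind (b '' Set.Iio n) (b n) = 0 := by
        simp only [ind, ite_eq_right_iff]
        rintro ⟨m, hm, hmn⟩
        exact absurd (hb hmn) (ne_of_lt hm)
      have h1 : ind (b '' Set.Iio (n + 1)) (b n) = 1 := by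
        simp only [ind, ite_eq_left_iff]
        exact fun h => absurd ⟨n, by simp, rfl⟩ h
      rw [h0, mul_zero, sgn_zero, one_smul] at ih
      rw [h1]
      have h2 := sigma_mul_sigma l k (b n) (b n)
      rw [if_pos rfl] at h2
      simp only [adString, stringOp, star_mul, star_sigma] at ih ⊢
      calc _ = stringOp k b n * (sigma k (b n) * sigma l (b n)) * sigma k (b n) *
            star (stringOp k b n) := by simp only [mul_assoc]
        _ = sgn (cross l k * 1) • (stringOp k b n * sigma l (b n) *
            (sigma k (b n) * sigma k (b n)) * star (stringOp k b n)) := by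
            rw [h2]; simp only [mul_assoc, mul_smul_comm, smul_mul_assoc]
        _ = _ := by simp only [sigma_sq, mul_one, ih, cross_comm l k]
    · rw [adString_sigma_succ k l b n c h, ih]
      congr 3
      simp only [ind]
      congr 1
      simp only [Set.mem_image, Set.mem_Iio, eq_iff_iff]
      constructor
      · rintro ⟨m, hm, rfl⟩; exact ⟨m, by omega, rfl⟩
      · rintro ⟨m, hm, rfl⟩
        refine ⟨m, ?_, rfl⟩
        rcases Nat.lt_succ_iff_lt_or_eq.1 hm with h' | rfl
        · exact h'
        · exact absurd rfl h

theorem stringEndo_sigma (k l : PauliType) (b : ℕ → Bond) (hb : Function.Injective b) (c : Bond) :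
    stringEndo k b hb (sigma l c) = sgn (cross k l * ind (Set.range b) c) • sigma l c := by
  refine tendsto_nhds_unique (tendsto_stringMap k b hb (sigma l c)) ?_
  refine tendsto_const_nhds.congr' ?_
  have : ∀ᶠ n in atTop, ind (b '' Set.Iio n) c = ind (Set.range b) c := by
    by_cases h : c ∈ Set.range b
    · obtain ⟨m, rfl⟩ := h
      filter_upwards [eventually_gt_atTop m] with n hn
      have h1 : b m ∈ b '' Set.Iio n := ⟨m, hn, rfl⟩
      simp [ind, h1]
    · refine Eventually.of_forall fun n => ?_
      have h1 : c ∉ b '' Set.Iio n := fun h' => h (Set.image_subset_range _ _ h')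
      simp [ind, h, h1]
  filter_upwards [this] with n hn
  rw [adString_sigma k l b hb, hn]

open Classical in
/-- The family of chains with only one nonzero member, of type `k`. -/
noncomputable def only (k : PauliType) (x : Bond → ZMod 2) (l : PauliType) (b : Bond) : ZMod 2 :=
  cross k l.dual * x b

theorem dual_dual (k : PauliType) : k.dual.dual = k := by cases k <;> rfl

theorem isPauliEndo_stringEndo (k : PauliType) (b : ℕ → Bond) (hb : Function.Injective b) :
    IsPauliEndo (stringEndo k b hb) (only k (ind (Set.range b))) := by
  intro l c
  rw [stringEndo_sigma, only, dual_dual]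

/-- Conjugation by a product of Pauli matrices over a finite chain. -/
noncomputable def adPauli (k : PauliType) (x : Chain) : QLA →⋆ₐ[ℂ] QLA :=
  (Unitary.conjStarAlgAut ℂ QLA ⟨pauli k x, pauli_mem_unitary k x⟩ : QLA →⋆ₐ[ℂ] QLA)

theorem isPauliEndo_adPauli (k : PauliType) (x : Chain) :
    IsPauliEndo (adPauli k x) (only k x) := by
  intro l c
  have : adPauli k x (sigma l c) = pauli k x * sigma l c * star (pauli k x) := rfl
  rw [this, star_pauli, pauli_mul_sigma, smul_mul_assoc, mul_assoc, pauli_sq, mul_one, only,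
    dual_dual]

/-- A finite string acts by conjugation. The support of an infinite one is enumerated in any order:
`stringEndo` needs only an injective sequence of bonds, not a path. -/
theorem exists_isPauliEndo_only (k : PauliType) (x : Bond → ZMod 2) :
    ∃ ρ, IsPauliEndo ρ (only k x) := by
  classical
  by_cases hfin : (Function.support x).Finite
  · exact ⟨_, isPauliEndo_adPauli k (Finsupp.ofSupportFinite x hfin)⟩
  · have : Infinite (Function.support x) := Set.infinite_coe_iff.2 hfin
    obtain ⟨e⟩ := nonempty_denumerable (Function.support x)
    let b : ℕ → Bond := fun n => ((Denumerable.eqv (Function.support x)).symm n : Bond)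
    have hb : Function.Injective b :=
      Subtype.val_injective.comp (Denumerable.eqv (Function.support x)).symm.injective
    have hr : ind (Set.range b) = x := by
      have : Set.range b = Function.support x := by
        simp only [b]
        rw [← Function.comp_def, Set.range_comp, Equiv.range_eq_univ, Set.image_univ,
          Subtype.range_coe]
      ext1 c
      simp only [ind, this, Function.mem_support]
      rcases zmod_two_cases (x c) with h | h <;> simp [h]
    exact ⟨_, hr ▸ isPauliEndo_stringEndo k b hb⟩

/-- Provides the endomorphisms of the auxiliary strings to which a given string is transported; the
two types are composed. -/
theorem exists_isPauliEndo (D : PauliType → Bond → ZMod 2) : ∃ ρ, IsPauliEndo ρ D := by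
  obtain ⟨ρ, hρ⟩ := exists_isPauliEndo_only .X (D .X)
  obtain ⟨σ, hσ⟩ := exists_isPauliEndo_only .Z (D .Z)
  refine ⟨_, fun l b => (hρ.tensorEndo hσ l b).trans ?_⟩
  cases l <;> simp [only, cross, PauliType.dual]

end ToricCode

namespace ToricCode

/-! ### Closed chains act trivially on the vacuum -/

/-- The boundary modulo two of a chain of type `k`, as a function of the sites. -/
def bdry (k : PauliType) (x : Bond → ZMod 2) (p : Vertex) : ZMod 2 := ((siteBonds k p).map x).sum

theorem bdry_X (x : Bond → ZMod 2) (p : Vertex) :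
    bdry .X x p = x ((p.1, p.2), false) + x ((p.1, p.2), true) + x ((p.1, p.2 + 1), false)
      + x ((p.1 + 1, p.2), true) := by
  simp [bdry, siteBonds, plaqBonds, add_assoc]

theorem bdry_Z (x : Bond → ZMod 2) (p : Vertex) :
    bdry .Z x p = x ((p.1, p.2), false) + x ((p.1, p.2), true) + x ((p.1 - 1, p.2), false)
      + x ((p.1, p.2 - 1), true) := by
  simp [bdry, siteBonds, starBonds, add_assoc]

theorem bdry_add (k : PauliType) (x y : Bond → ZMod 2) (p : Vertex) :
    bdry k (x + y) p = bdry k x p + bdry k y p := by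
  cases k <;> simp only [bdry_X, bdry_Z, Pi.add_apply] <;> ring

/-- A closed one-cochain with finite support on the square lattice is the coboundary of a function
with finite support. -/
theorem exists_potential (h v : Vertex → ZMod 2) (hh : h.support.Finite) (hv : v.support.Finite)
    (hc : ∀ i j, h (i, j) + v (i, j) + h (i, j + 1) + v (i + 1, j) = 0) :
    ∃ φ : Vertex →₀ ZMod 2, (∀ i j, h (i, j) = φ (i, j) + φ (i + 1, j)) ∧
      ∀ i j, v (i, j) = φ (i, j) + φ (i, j + 1) := by
  have two : (2 : ZMod 2) = 0 := rfl
  obtain ⟨N, hN⟩ : ∃ N : ℕ, ∀ p : Vertex, (N : ℤ) ≤ |p.1| ∨ (N : ℤ) ≤ |p.2| →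
      h p = 0 ∧ v p = 0 := by
    obtain ⟨N, hN⟩ := ((hh.union hv).image fun p : Vertex => (|p.1| + |p.2|).toNat).bddAbove
    refine ⟨N + 1, fun p hp => ?_⟩
    by_contra hne
    have hmem : p ∈ h.support ∪ v.support := by
      by_contra hcon
      simp only [Set.mem_union, Function.mem_support, not_or, not_not] at hcon
      exact hne hcon
    have : (|p.1| + |p.2|).toNat ≤ N := hN ⟨p, hmem, rfl⟩
    have h1 := abs_nonneg p.1
    have h2 := abs_nonneg p.2
    omega
  have hz : ∀ i j, (N : ℤ) ≤ |i| ∨ (N : ℤ) ≤ |j| → h (i, j) = 0 ∧ v (i, j) = 0 :=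
    fun i j hij => hN (i, j) hij
  -- The potential sums `h` along the horizontal half-line to the right of the point; everything
  -- vanishes from the column `N` on.
  let φ : Vertex → ZMod 2 := fun p => ∑ k ∈ Finset.Ico p.1 N, h (k, p.2)
  have hφ1 : ∀ i j, h (i, j) = φ (i, j) + φ (i + 1, j) := by
    intro i j
    simp only [φ]
    by_cases hi : i < N
    · have h1 : Finset.Ico i (N : ℤ) = insert i (Finset.Ico (i + 1) (N : ℤ)) := by
        ext t; simp only [Finset.mem_Ico, Finset.mem_insert]; omega
      rw [h1, Finset.sum_insert (by simp), add_assoc, zmod_two_add_self, add_zero]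
    · rw [Finset.Ico_eq_empty (by omega), Finset.Ico_eq_empty (by omega)]
      simpa using (hz i j (Or.inl (by have := le_abs_self i; omega))).1
  have hφ2 : ∀ i j, v (i, j) = φ (i, j) + φ (i, j + 1) := by
    intro i j
    by_cases hi : i < N
    -- Adding up the closedness relation over a horizontal row of squares telescopes in `v`; the row
    -- is then extended until `v` vanishes.
    · have key : ∀ n : ℕ, v (i, j) + v (i + n, j) =
          ∑ k ∈ Finset.Ico i (i + n), (h (k, j) + h (k, j + 1)) := by
        intro n
        induction n with
        | zero => simp [zmod_two_add_self]
        | succ n ih =>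
          have h1 : Finset.Ico i (i + ((n + 1 : ℕ) : ℤ)) = insert (i + (n : ℤ)) (Finset.Ico i (i + n)) := by
            ext t; simp only [Finset.mem_Ico, Finset.mem_insert]; push_cast; omega
          rw [h1, Finset.sum_insert (by simp), ← ih]
          have h2 := hc (i + n) j
          have h3 : i + ((n + 1 : ℕ) : ℤ) = i + n + 1 := by push_cast; ring
          rw [h3]
          linear_combination -h2 + v (i + n + 1, j) * two
      have h1 := key (N - i).toNat
      have h2 : i + (((N : ℤ) - i).toNat : ℤ) = N := by omega
      rw [h2, (hz N j (Or.inl (le_abs_self _))).2, add_zero, Finset.sum_add_distrib] at h1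
      exact h1
    · simp only [φ]
      rw [Finset.Ico_eq_empty (by omega)]
      simpa using (hz i j (Or.inl (by have := le_abs_self i; omega))).2
  have hφ3 : ∀ i j, (N : ℤ) ≤ |j| → φ (i, j) = 0 := fun i j hj =>
    Finset.sum_eq_zero fun k _ => (hz k j (Or.inr hj)).1
  have hφ4 : ∀ i j, (N : ℤ) ≤ |i| → φ (i, j) = 0 := by
    intro i j hi
    rcases le_or_gt (N : ℤ) i with hi' | hi'
    · simp only [φ]
      rw [Finset.Ico_eq_empty (by omega), Finset.sum_empty]
    -- Far to the left `v` vanishes, so `φ` is constant on the column and equals its value at a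
    -- great height, which is zero. Closedness enters here through `hφ2`, and gives finite support.
    · have key : ∀ n : ℕ, φ (i, j) = φ (i, j + n) := by
        intro n
        induction n with
        | zero => simp
        | succ n ih =>
          have h1 := hφ2 i (j + n)
          rw [(hz i (j + n) (Or.inl hi)).2] at h1
          have h3 : j + ((n + 1 : ℕ) : ℤ) = j + n + 1 := by push_cast; ring
          rw [ih, h3]
          linear_combination -h1 - φ (i, j + n + 1) * two
      rw [key (N + j.natAbs)]
      refine hφ3 _ _ ?_
      have := le_abs_self (j + ((N + j.natAbs : ℕ) : ℤ))
      omega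
  have hfin : φ.support.Finite := by
    refine ((Set.finite_Icc (-(N : ℤ)) N).prod (Set.finite_Icc (-(N : ℤ)) N)).subset ?_
    rintro ⟨i, j⟩ hij
    simp only [Set.mem_prod, Set.mem_Icc, ← abs_le]
    refine ⟨?_, ?_⟩
    · by_contra hcon; exact hij (hφ4 i j (by omega))
    · by_contra hcon; exact hij (hφ3 i j (by omega))
  exact ⟨Finsupp.ofSupportFinite φ hfin, hφ1, hφ2⟩

/-- The chain of the star (type `X`) or plaquette (type `Z`) at a point. -/
noncomputable def loopChain (k : PauliType) (s : Vertex) : Chain :=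
  ((siteBonds k.dual s).map fun b => Finsupp.single b (1 : ZMod 2)).sum

/-- The sum of the elementary loops with given coefficients. -/
noncomputable def loopSum (k : PauliType) : (Vertex →₀ ZMod 2) →+ Chain :=
  Finsupp.liftAddHom fun s =>
    (LinearMap.toSpanSingleton (ZMod 2) Chain (loopChain k s)).toAddMonoidHom

theorem loopSum_single (k : PauliType) (s : Vertex) :
    loopSum k (Finsupp.single s 1) = loopChain k s := by
  simp [loopSum]

/-- The elementary loops of type `X` are the stars, and a bond belongs to the stars of exactly its
two end points. -/
theorem loopSum_apply_X (φ : Vertex →₀ ZMod 2) (i j : ℤ) :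
    loopSum .X φ ((i, j), false) = φ (i, j) + φ (i + 1, j) ∧
    loopSum .X φ ((i, j), true) = φ (i, j) + φ (i, j + 1) := by
  induction φ using Finsupp.induction with
  | zero => simp
  | single_add s a φ _ ha ih =>
    rw [(zmod_two_cases a).resolve_left ha, map_add, loopSum_single]
    simp only [Finsupp.add_apply, ih.1, ih.2, loopChain, PauliType.dual, siteBonds, starBonds,
      List.map_cons, List.map_nil, List.sum_cons, List.sum_nil, add_zero, Finsupp.single_apply,
      and_true, Bool.false_eq_true, Bool.true_eq_false, and_false, if_false,
      zero_add, Prod.ext_iff]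
    have e1 : (s.1 - 1 = i) ↔ (s.1 = i + 1) := by omega
    have e2 : (s.2 - 1 = j) ↔ (s.2 = j + 1) := by omega
    simp only [e1, e2]
    constructor <;> ring

/-- The elementary loops of type `Z` are the plaquettes, and a bond belongs to exactly the two
plaquettes on its sides. -/
theorem loopSum_apply_Z (φ : Vertex →₀ ZMod 2) (i j : ℤ) :
    loopSum .Z φ ((i, j), false) = φ (i, j) + φ (i, j - 1) ∧
    loopSum .Z φ ((i, j), true) = φ (i, j) + φ (i - 1, j) := by
  induction φ using Finsupp.induction with
  | zero => simp
  | single_add s a φ _ ha ih =>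
    rw [(zmod_two_cases a).resolve_left ha, map_add, loopSum_single]
    simp only [Finsupp.add_apply, ih.1, ih.2, loopChain, PauliType.dual, siteBonds, plaqBonds,
      List.map_cons, List.map_nil, List.sum_cons, List.sum_nil, add_zero, Finsupp.single_apply,
      and_true, Bool.false_eq_true, Bool.true_eq_false, and_false, if_false,
      zero_add, Prod.ext_iff]
    have e1 : (s.1 + 1 = i) ↔ (s.1 = i - 1) := by omega
    have e2 : (s.2 + 1 = j) ↔ (s.2 = j - 1) := by omega
    simp only [e1, e2]
    constructor <;> ring

/-- A finite closed chain is a sum of elementary loops. -/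
theorem exists_loopSum_eq (k : PauliType) (x : Chain) (hx : ∀ p, bdry k x p = 0) :
    ∃ φ, loopSum k φ = x := by
  have hfin : ∀ f : Vertex → Bond, Function.Injective f → (fun p => x (f p)).support.Finite :=
    fun f hf => (x.hasFiniteSupport.preimage hf.injOn)
  cases k with
  | X =>
    obtain ⟨φ, h1, h2⟩ := exists_potential (fun p => x (p, false)) (fun p => x (p, true))
      (hfin (fun p => (p, false)) fun p q h => (Prod.ext_iff.1 h).1)
      (hfin (fun p => (p, true)) fun p q h => (Prod.ext_iff.1 h).1)
      (fun i j => by have := hx (i, j); rwa [bdry_X] at this)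
    refine ⟨φ, ?_⟩
    ext ⟨⟨i, j⟩, b⟩
    cases b
    · rw [(loopSum_apply_X φ i j).1, ← h1]
    · rw [(loopSum_apply_X φ i j).2, ← h2]
  | Z =>
    -- Passing to the dual lattice turns each bond by a right angle, so that closedness at a star
    -- reads as closedness around a square.
    obtain ⟨φ, h1, h2⟩ := exists_potential (fun p => x ((p.1, p.2 - 1), true))
      (fun p => x ((p.1 - 1, p.2), false))
      (hfin (fun p => ((p.1, p.2 - 1), true)) fun p q h => by
        simp only [Prod.mk.injEq, and_true] at h; exact Prod.ext h.1 (by omega))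
      (hfin (fun p => ((p.1 - 1, p.2), false)) fun p q h => by
        simp only [Prod.mk.injEq, and_true] at h; exact Prod.ext (by omega) h.2)
      (fun i j => by
        have := hx (i, j)
        rw [bdry_Z] at this
        simp only [add_sub_cancel_right]
        linear_combination this)
    -- The potential found labels a plaquette by its upper right corner, the chains by its lower
    -- left one.
    let ψ : Vertex →₀ ZMod 2 :=
      φ.comapDomain (fun p : Vertex => (p.1 + 1, p.2 + 1)) (fun p _ q _ h => by
        simp only [Prod.mk.injEq] at h; exact Prod.ext (by omega) (by omega))
    have hψ : ∀ i j, ψ (i, j) = φ (i + 1, j + 1) := fun i j => rfl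
    refine ⟨ψ, ?_⟩
    ext ⟨⟨i, j⟩, b⟩
    cases b
    · have := h2 (i + 1) j
      simp only [add_sub_cancel_right] at this
      rw [(loopSum_apply_Z ψ i j).1, this, hψ, hψ, sub_add_cancel, add_comm]
    · have := h1 i (j + 1)
      simp only [add_sub_cancel_right] at this
      rw [(loopSum_apply_Z ψ i j).2, this, hψ, hψ, sub_add_cancel, add_comm]

theorem pauli_list_sum (k : PauliType) (l : List Bond) :
    pauli k (l.map fun b => Finsupp.single b (1 : ZMod 2)).sum = (l.map (sigma k)).prod := by
  induction l with
  | nil => simp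
  | cons b l ih => rw [List.map_cons, List.sum_cons, pauli_single_add, ih, List.map_cons,
      List.prod_cons]

/-! ### The GNS vector and its invariance under closed strings. -/

variable (ω : VacuumState)

/-- The vacuum vector. -/
noncomputable def vac : Hil ω := ((ω.toFunctional.toPreGNS 1 : ω.toFunctional.PreGNS) : Hil ω)

theorem rep_coe (A B : QLA) : rep ω A ((ω.toFunctional.toPreGNS B : ω.toFunctional.PreGNS) : Hil ω) =
    ((ω.toFunctional.toPreGNS (A * B) : ω.toFunctional.PreGNS) : Hil ω) :=
  PositiveLinearMap.gnsNonUnitalStarAlgHom_apply_coe _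

theorem rep_vac (A : QLA) :
    rep ω A (vac ω) = ((ω.toFunctional.toPreGNS A : ω.toFunctional.PreGNS) : Hil ω) := by
  rw [vac, rep_coe, mul_one]

theorem denseRange_rep_vac : DenseRange fun A : QLA => rep ω A (vac ω) := by
  have h : (fun A : QLA => rep ω A (vac ω)) =
      (fun a : ω.toFunctional.PreGNS => (a : Hil ω)) ∘ ω.toFunctional.toPreGNS := by
    ext1 A; exact rep_vac ω A
  rw [h]
  refine UniformSpace.Completion.denseRange_coe.comp
    ω.toFunctional.toPreGNS.surjective.denseRange (UniformSpace.Completion.continuous_coe _)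

theorem inner_rep_vac (A B : QLA) :
    ⟪rep ω A (vac ω), rep ω B (vac ω)⟫_ℂ = ω.toFunctional (star A * B) := by
  rw [rep_vac, rep_vac, UniformSpace.Completion.inner_coe]
  rfl

/-- With `Ω` the vacuum vector, `‖A Ω - Ω‖² = ω(A* A) - ω(A*) - ω(A) + 1 = 0`. -/
theorem rep_vac_eq_of_map_eq_one {A : QLA} (hA : star A * A = 1) (h : ω.toFunctional A = 1) :
    rep ω A (vac ω) = vac ω := by
  have h2 : ω.toFunctional (star A) = 1 := by rw [map_star, h, star_one]
  have e1 := inner_rep_vac ω A A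
  have e2 := inner_rep_vac ω A 1
  have e3 := inner_rep_vac ω 1 A
  have e4 := inner_rep_vac ω 1 1
  rw [map_one, one_apply_eq_self] at e2 e3 e4
  rw [hA, ω.map_one] at e1
  rw [mul_one, h2] at e2
  rw [star_one, one_mul, h] at e3
  rw [star_one, one_mul, ω.map_one] at e4
  rw [← sub_eq_zero, ← inner_self_eq_zero (𝕜 := ℂ), inner_sub_left, inner_sub_right,
    inner_sub_right, e1, e2, e3, e4]
  simp

/-- The chain is a sum of elementary loops, so the operator is a product of star or plaquette
operators, each of which fixes the vacuum vector. -/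
theorem rep_pauli_vac (k : PauliType) (x : Chain) (hx : ∀ p, bdry k x p = 0) :
    rep ω (pauli k x) (vac ω) = vac ω := by
  obtain ⟨φ, rfl⟩ := exists_loopSum_eq k x hx
  clear hx
  induction φ using Finsupp.induction with
  | zero => simp
  | single_add s a φ _ ha ih =>
    rw [(zmod_two_cases a).resolve_left ha, map_add, loopSum_single, pauli_add, map_mul,
      mul_apply_eq_comp, ih]
    refine rep_vac_eq_of_map_eq_one ω ?_ ?_
    · rw [star_pauli, pauli_sq]
    · rw [loopChain, pauli_list_sum]
      cases k
      · exact ω.map_starOp s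
      · exact ω.map_plaqOp s

end ToricCode

namespace ToricCode

/-! ### Strong limits of string operators -/

section Strong

variable {H : Type*} [NormedAddCommGroup H] [InnerProductSpace ℂ H]

/-- Convergence of a sequence of operators in the strong operator topology. -/
def StrongLim (u : ℕ → H →L[ℂ] H) (U : H →L[ℂ] H) : Prop :=
  ∀ ξ, Tendsto (fun n => u n ξ) atTop (𝓝 (U ξ))

theorem StrongLim.unique {u : ℕ → H →L[ℂ] H} {U V : H →L[ℂ] H} (hU : StrongLim u U)
    (hV : StrongLim u V) : U = V :=
  ContinuousLinearMap.ext fun ξ => tendsto_nhds_unique (hU ξ) (hV ξ)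

theorem StrongLim.mul [CompleteSpace H] {u v : ℕ → H →L[ℂ] H} {U V : H →L[ℂ] H} (hu : StrongLim u U)
    (hv : StrongLim v V) (hn : ∀ n, u n ∈ unitary (H →L[ℂ] H)) :
    StrongLim (fun n => u n * v n) (U * V) := by
  intro ξ
  have h1 := hu (V ξ)
  have h2 : Tendsto (fun n => u n (v n ξ - V ξ)) atTop (𝓝 0) := by
    rw [tendsto_zero_iff_norm_tendsto_zero]
    have h3 : Tendsto (fun n => v n ξ - V ξ) atTop (𝓝 0) := by
      simpa using (hv ξ).sub_const (V ξ)
    simpa only [ContinuousLinearMap.norm_map_of_mem_unitary (hn _)] using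
      tendsto_zero_iff_norm_tendsto_zero.1 h3
  have h4 := h2.add h1
  simp only [map_sub, sub_add_cancel, zero_add] at h4
  exact h4

theorem StrongLim.mul_left {u : ℕ → H →L[ℂ] H} {U : H →L[ℂ] H} (hu : StrongLim u U)
    (T : H →L[ℂ] H) : StrongLim (fun n => T * u n) (T * U) := fun ξ =>
  (T.continuous.tendsto _).comp (hu ξ)

theorem StrongLim.mul_right {u : ℕ → H →L[ℂ] H} {U : H →L[ℂ] H} (hu : StrongLim u U)
    (T : H →L[ℂ] H) : StrongLim (fun n => u n * T) (U * T) := fun ξ => hu (T ξ)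

theorem StrongLim.const_smul {u : ℕ → H →L[ℂ] H} {U : H →L[ℂ] H} (hu : StrongLim u U)
    (c : ℂ) : StrongLim (fun n => c • u n) (c • U) := fun ξ => (hu ξ).const_smul c

theorem StrongLim.congr' {u v : ℕ → H →L[ℂ] H} {U : H →L[ℂ] H} (hu : StrongLim u U)
    (h : ∀ᶠ n in atTop, u n = v n) : StrongLim v U := fun ξ =>
  (hu ξ).congr' (h.mono fun n hn => by rw [hn])

/-- An `ε/3` argument, uniform in `n` because the operators are isometric. It reduces strong
convergence to a dense set of vectors. -/
theorem isClosed_cauchySeq [CompleteSpace H] {u : ℕ → H →L[ℂ] H} (hn : ∀ n, u n ∈ unitary (H →L[ℂ] H)) :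
    IsClosed {ξ | CauchySeq fun n => u n ξ} := by
  refine isClosed_of_closure_subset fun ξ hξ => ?_
  refine Metric.cauchySeq_iff'.2 fun ε hε => ?_
  obtain ⟨η, hη, hd⟩ := Metric.mem_closure_iff.1 hξ (ε / 3) (by positivity)
  obtain ⟨N, hN⟩ := Metric.cauchySeq_iff'.1 hη (ε / 3) (by positivity)
  have h1 : ∀ n, dist (u n ξ) (u n η) < ε / 3 := fun n => by
    rw [dist_eq_norm, ← map_sub, ContinuousLinearMap.norm_map_of_mem_unitary (hn n), ← dist_eq_norm]
    exact hd
  refine ⟨N, fun n hnN => ?_⟩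
  have h2 := hN n hnN
  have h3 := h1 n
  have h4 := h1 N
  rw [dist_comm] at h4
  have h5 := dist_triangle4 (u n ξ) (u n η) (u N η) (u N ξ)
  linarith

theorem cauchySeq_apply_of_twisted [CompleteSpace H] {u : ℕ → H →L[ℂ] H} {T : H →L[ℂ] H} {c : ℂ}
    (h : ∀ᶠ n in atTop, u n * T = c • (T * u n)) {ξ : H} (hξ : CauchySeq fun n => u n ξ) :
    CauchySeq fun n => u n (T ξ) := by
  obtain ⟨η, hη⟩ := cauchySeq_tendsto_of_complete hξ
  have h1 : Tendsto (fun n => c • T (u n ξ)) atTop (𝓝 (c • T η)) :=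
    ((T.continuous.tendsto _).comp hη).const_smul _
  refine (h1.congr' ?_).cauchySeq
  filter_upwards [h] with n hn
  exact (congrArg (fun T : H →L[ℂ] H => T ξ) hn).symm

theorem cauchySeq_smul_apply {u : ℕ → H →L[ℂ] H} {T : H →L[ℂ] H} (r : ℂ) {ξ : H}
    (hξ : CauchySeq fun n => u n (T ξ)) : CauchySeq fun n => u n ((r • T) ξ) := by
  have := (uniformContinuous_const_smul r).comp_cauchySeq hξ
  simpa [Function.comp_def] using this

theorem cauchySeq_add_apply {u : ℕ → H →L[ℂ] H} {S T : H →L[ℂ] H} {ξ : H}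
    (hS : CauchySeq fun n => u n (S ξ)) (hT : CauchySeq fun n => u n (T ξ)) :
    CauchySeq fun n => u n ((S + T) ξ) := by
  have := hS.add hT
  simpa [Pi.add_def] using this

theorem exists_strongLim [CompleteSpace H] {u : ℕ → H →L[ℂ] H} (h : ∀ ξ, CauchySeq fun n => u n ξ) :
    ∃ U, StrongLim u U := by
  choose f hf using fun ξ => cauchySeq_tendsto_of_complete (h ξ)
  exact ⟨continuousLinearMapOfTendsto u (tendsto_pi_nhds.2 hf), hf⟩

/-- A strong limit of unitaries is in general only an isometry. Here the operators are self-adjoint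
involutions, and both properties survive the limit. -/
theorem StrongLim.mem_unitary [CompleteSpace H] {u : ℕ → H →L[ℂ] H} {V : H →L[ℂ] H}
    (hV : StrongLim u V) (hstar : ∀ n, star (u n) = u n) (hsq : ∀ n, u n * u n = 1) :
    V ∈ unitary (H →L[ℂ] H) := by
  have hVV : V * V = 1 := by
    refine (hV.mul hV fun n => ?_).unique fun ξ => ?_
    · rw [Unitary.mem_iff, hstar]; exact ⟨hsq n, hsq n⟩
    · simp [hsq]
  have hstar : star V = V := by
    rw [ContinuousLinearMap.star_eq_adjoint, eq_comm, ContinuousLinearMap.eq_adjoint_iff]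
    intro ξ η
    refine tendsto_nhds_unique ((hV ξ).inner tendsto_const_nhds)
      ((tendsto_const_nhds.inner (hV η)).congr fun n => ?_)
    nth_rw 1 [← hstar n]
    rw [ContinuousLinearMap.star_eq_adjoint, ContinuousLinearMap.adjoint_inner_right]
  rw [Unitary.mem_iff, hstar]
  exact ⟨hVV, hVV⟩

end Strong

/-! ### Charge transporters as strong limits of string operators. -/

section Representation

variable {H : Type*} [NormedAddCommGroup H] [InnerProductSpace ℂ H] [CompleteSpace H]
  (π : QLA →⋆ₐ[ℂ] (H →L[ℂ] H))

/-- `Ω` is a cyclic vector for `π` which is invariant under closed string operators. -/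
structure IsVacuum (Ω : H) : Prop where
  denseRange : DenseRange fun A : QLA => π A Ω
  pauli_apply : ∀ k x, (∀ p, bdry k (x : Chain) p = 0) → π (pauli k x) Ω = Ω

/-- The von Neumann algebra `π(𝔄(Λ))''`. -/
noncomputable def vn (L : Set Bond) : StarSubalgebra ℂ (H →L[ℂ] H) :=
  StarSubalgebra.centralizer ℂ
    (StarSubalgebra.centralizer ℂ (π '' (localAlg L : Set QLA)) : Set (H →L[ℂ] H))

theorem norm_rep_le (A : QLA) : ‖π A‖ ≤ ‖A‖ := NonUnitalStarAlgHom.norm_apply_le π A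

theorem continuous_rep : Continuous π :=
  AddMonoidHomClass.continuous_of_bound π 1 (by simpa using norm_rep_le π)

theorem rep_mem_unitary {A : QLA} (h : A ∈ unitary QLA) : π A ∈ unitary (H →L[ℂ] H) :=
  Unitary.map_mem π h

/-- The transporter of a sequence of string operators with fixed endpoints and converging chains. -/
theorem exists_transporter {Ω : H} (hΩ : IsVacuum π Ω) (k : PauliType) (F : ℕ → Chain) (x : Bond → ZMod 2)
    (hF : ∀ n p, bdry k (F n) p = bdry k (F 0) p) (hx : ∀ b, ∀ᶠ n in atTop, F n b = x b) :
    ∃ V : H →L[ℂ] H, V ∈ unitary (H →L[ℂ] H) ∧ StrongLim (fun n => π (pauli k (F n))) V ∧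
      ∀ l b, V * π (sigma l b) = sgn (cross k l * x b) • (π (sigma l b) * V) := by
  set u : ℕ → H →L[ℂ] H := fun n => π (pauli k (F n)) with hu
  have huu : ∀ n, u n ∈ unitary (H →L[ℂ] H) := fun n => rep_mem_unitary π (pauli_mem_unitary k _)
  have hsigma : ∀ l b, ∀ᶠ n in atTop,
      u n * π (sigma l b) = sgn (cross k l * x b) • (π (sigma l b) * u n) := by
    intro l b
    filter_upwards [hx b] with n hn
    simp only [hu]
    rw [← map_mul π, pauli_mul_sigma, hn, map_smul π, map_mul π]
  -- The vectors on which the sequence converges form a space invariant under all observables,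
  -- because the sequence commutes with each Pauli matrix up to an eventually constant sign.
  have hA : ∀ A : QLA, ∀ ξ, (CauchySeq fun n => u n ξ) → CauchySeq fun n => u n (π A ξ) := by
    intro A
    refine localAlg_induction (L := Set.univ)
      (P := fun A => ∀ ξ, (CauchySeq fun n => u n ξ) → CauchySeq fun n => u n (π A ξ))
      ?_ ?_ ?_ ?_ ?_ ?_ (mem_localAlg_univ A)
    · simp only [Set.ofPred_forall]
      refine isClosed_iInter fun ξ => isClosed_iInter fun _ => ?_
      exact (isClosed_cauchySeq huu).preimage
        (((ContinuousLinearMap.apply ℂ H ξ).continuous).comp (continuous_rep π))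
    · exact fun l b _ ξ hξ => cauchySeq_apply_of_twisted (hsigma l b) hξ
    · intro ξ hξ
      rw [map_one π]
      exact hξ
    · intro r A hA ξ hξ
      rw [map_smul π]
      exact cauchySeq_smul_apply r (hA ξ hξ)
    · intro A B hA hB ξ hξ
      rw [map_add π]
      exact cauchySeq_add_apply (hA ξ hξ) (hB ξ hξ)
    · intro A B hA hB ξ hξ
      rw [map_mul π]
      exact hA _ (hB ξ hξ)
  have hvac : CauchySeq fun n => u n (Ω) := by
    have h1 : ∀ n, u n (Ω) = u 0 (Ω) := by
      intro n
      -- The chain `F 0 + F n` is closed since the boundaries agree, and its string operator fixes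
      -- `Ω`: on `Ω` the sequence is constant.
      have h2 : F n = F 0 + (F 0 + F n) := by rw [← add_assoc, chain_add_self, zero_add]
      simp only [hu]
      rw [h2, pauli_add, map_mul π, mul_apply_eq_comp, hΩ.pauli_apply]
      intro p
      have h3 := bdry_add k (F 0) (F n) p
      rw [hF n p, zmod_two_add_self] at h3
      exact h3
    simp only [h1]
    exact cauchySeq_const _
  have hall : ∀ ξ, CauchySeq fun n => u n ξ := by
    intro ξ
    refine (hΩ.denseRange).induction_on (p := fun ξ => CauchySeq fun n => u n ξ) ξ
      (isClosed_cauchySeq huu) fun A => hA A _ hvac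
  obtain ⟨V, hV⟩ := exists_strongLim hall
  have hstar : ∀ n, star (u n) = u n := fun n => by
    simp only [hu]
    rw [← map_star π, star_pauli]
  have hsq : ∀ n, u n * u n = 1 := fun n => by
    simp only [hu]
    rw [← map_mul π, pauli_sq, map_one π]
  refine ⟨V, hV.mem_unitary hstar hsq, hV, fun l b => ?_⟩
  exact (hV.mul_right _).unique
    (((hV.mul_left (π (sigma l b))).const_smul _).congr' ((hsigma l b).mono fun n hn => hn.symm))

theorem mem_centralizer_rep_iff (L : Set Bond) (T : H →L[ℂ] H) :
    T ∈ StarSubalgebra.centralizer ℂ (π '' (localAlg L : Set QLA)) ↔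
      ∀ A ∈ localAlg L, T * π A = π A * T := by
  rw [StarSubalgebra.mem_centralizer_iff]
  constructor
  · intro h A hA
    exact ((h _ ⟨A, hA, rfl⟩).1).symm
  · rintro h _ ⟨A, hA, rfl⟩
    refine ⟨(h A hA).symm, ?_⟩
    rw [← map_star π]
    exact (h _ (star_mem hA)).symm

theorem mem_vn_iff (L : Set Bond) (B : H →L[ℂ] H) :
    B ∈ vn π L ↔ ∀ T : H →L[ℂ] H, (∀ A ∈ localAlg L, T * π A = π A * T) → T * B = B * T := by
  rw [vn, StarSubalgebra.mem_centralizer_iff]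
  constructor
  · intro h T hT
    exact (h T ((mem_centralizer_rep_iff π L T).2 hT)).1
  · intro h T hT
    exact ⟨h T ((mem_centralizer_rep_iff π L T).1 hT),
      h _ ((mem_centralizer_rep_iff π L _).1 (star_mem hT))⟩

theorem rep_mem_vn {L : Set Bond} {A : QLA} (hA : A ∈ localAlg L) : π A ∈ vn π L :=
  (mem_vn_iff π L _).2 fun _ hT => hT A hA

theorem vn_mono {L L' : Set Bond} (h : L ⊆ L') : vn π L ≤ vn π L' := by
  intro B hB
  rw [mem_vn_iff] at hB ⊢
  exact fun T hT => hB T fun A hA => hT A (localAlg_mono h hA)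

theorem StrongLim.mem_vn {π : QLA →⋆ₐ[ℂ] (H →L[ℂ] H)} {L : Set Bond} {u : ℕ → H →L[ℂ] H} {U : H →L[ℂ] H}
    (h : StrongLim u U) (hu : ∀ n, u n ∈ vn π L) : U ∈ vn π L := by
  rw [mem_vn_iff]
  intro T hT
  refine (h.mul_left T).unique ?_
  refine (h.mul_right T).congr' (Eventually.of_forall fun n => ?_)
  exact ((mem_vn_iff π L _).1 (hu n) T hT).symm

theorem intertwine_of_forall_sigma {V : H →L[ℂ] H} {ρ σ : QLA →⋆ₐ[ℂ] QLA} {L : Set Bond}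
    (h : ∀ k, ∀ b ∈ L, V * π (ρ (sigma k b)) = π (σ (sigma k b)) * V) {A : QLA}
    (hA : A ∈ localAlg L) : V * π (ρ A) = π (σ A) * V := by
  refine localAlg_induction (P := fun A => V * π (ρ A) = π (σ A) * V) ?_ h ?_ ?_ ?_ ?_ hA
  · exact isClosed_eq (continuous_const.mul ((continuous_rep π).comp (continuous_endo ρ)))
      (((continuous_rep π).comp (continuous_endo σ)).mul continuous_const)
  · rw [map_one ρ, map_one σ, map_one π, one_mul, mul_one]
  · intro r A hA; rw [map_smul ρ, map_smul σ, map_smul π, map_smul π, mul_smul_comm, smul_mul_assoc, hA]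
  · intro A B hA hB; rw [map_add ρ, map_add σ, map_add π, map_add π, mul_add, add_mul, hA, hB]
  · intro A B hA hB
    rw [map_mul ρ, map_mul σ, map_mul π, map_mul π, ← mul_assoc, hA, mul_assoc, hB, ← mul_assoc]

/-- `F` is a sequence of finite chains in `L`, with fixed boundary, converging to `x + y`: the strings
`x` and `y` can be transported into each other within `L`. -/
structure IsTransport (k : PauliType) (L : Set Bond) (x y : Bond → ZMod 2) (F : ℕ → Chain) : Prop where
  mem : ∀ n b, b ∉ L → F n b = 0
  bdry_eq : ∀ n p, bdry k (F n) p = bdry k (F 0) p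
  lim : ∀ b, ∀ᶠ n in atTop, F n b = x b + y b

/-- The sign bookkeeping of a transport: passing a Pauli matrix through the string operators of `D +
D'` turns the sign of `D` into that of `D'`. -/
theorem cross_cancel (D D' : PauliType → Bond → ZMod 2) (l : PauliType) (b : Bond) :
    D l.dual b + (cross .Z l * (D .Z b + D' .Z b) + cross .X l * (D .X b + D' .X b))
      = D' l.dual b := by
  have h := zmod_two_add_self (D l.dual b)
  cases l <;> simp only [cross, PauliType.dual, zero_mul, one_mul, add_zero, zero_add] at h ⊢ <;>
    linear_combination h

/-- The unitary transporting a pair of strings to another one within `L`, as a strong limit of string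
operators. -/
theorem exists_unitary_of_isTransport {Ω : H} (hΩ : IsVacuum π Ω) {L : Set Bond} {D D' : PauliType → Bond → ZMod 2}
    {F : PauliType → ℕ → Chain} (hF : ∀ k, IsTransport k L (D k) (D' k) (F k)) :
    ∃ V : H →L[ℂ] H, V ∈ unitary (H →L[ℂ] H) ∧ V ∈ vn π L ∧
      StrongLim (fun n => π (pauli .X (F .X n) * pauli .Z (F .Z n))) V ∧
      ∀ ρ σ, IsPauliEndo ρ D → IsPauliEndo σ D' → ∀ A, V * π (ρ A) = π (σ A) * V := by
  have hV := fun k => exists_transporter π hΩ k (F k) _ (hF k).bdry_eq (hF k).lim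
  choose V hVu hVl hVs using hV
  have hvn : ∀ k, V k ∈ vn π L := fun k => (hVl k).mem_vn fun n =>
    rep_mem_vn π (pauli_mem_localAlg k fun b hb => by
      by_contra h
      exact Finsupp.mem_support_iff.1 hb ((hF k).mem n b h))
  refine ⟨V .X * V .Z, mul_mem (hVu _) (hVu _), mul_mem (hvn _) (hvn _), ?_, ?_⟩
  · simp only [map_mul π]
    exact (hVl .X).mul (hVl .Z) fun n => rep_mem_unitary π (pauli_mem_unitary _ _)
  · intro ρ σ hρ hσ A
    refine intertwine_of_forall_sigma π (L := Set.univ) (fun l b _ => ?_)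
      (mem_localAlg_univ A)
    rw [hρ, hσ, map_smul π, map_smul π, mul_smul_comm, smul_mul_assoc, mul_assoc, hVs .Z,
      mul_smul_comm, ← mul_assoc, hVs .X, smul_mul_assoc, smul_smul, smul_smul, mul_assoc,
      ← sgn_add, ← sgn_add]
    rw [cross_cancel, mul_assoc]

end Representation

theorem IsTransport.mono {k : PauliType} {L L' : Set Bond} {x y : Bond → ZMod 2} {F : ℕ → Chain}
    (h : IsTransport k L x y F) (hL : L ⊆ L') : IsTransport k L' x y F :=
  ⟨fun n b hb => h.mem n b fun h' => hb (hL h'), h.bdry_eq, h.lim⟩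

theorem isTransport_zero (k : PauliType) (L : Set Bond) :
    IsTransport k L 0 0 (fun _ => 0) :=
  ⟨fun _ _ _ => rfl, fun _ _ => rfl, fun _ => Eventually.of_forall fun _ => by simp⟩

theorem isVacuum_vac (ω : VacuumState) : IsVacuum (rep ω) (vac ω) :=
  ⟨denseRange_rep_vac ω, rep_pauli_vac ω⟩

end ToricCode

namespace ToricCode

/-! ### The density part of the bicommutant theorem -/

section Bicommutant

variable {H : Type*} [NormedAddCommGroup H] [InnerProductSpace ℂ H]
  {ι : Type*} [Fintype ι]

/-- The diagonal action of an operator on a finite power of a Hilbert space. -/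
noncomputable def amp (ι : Type*) [Fintype ι] (T : H →L[ℂ] H) :
    PiLp 2 (fun _ : ι => H) →L[ℂ] PiLp 2 (fun _ : ι => H) :=
  (PiLp.continuousLinearEquiv 2 ℂ (fun _ : ι => H)).symm.toContinuousLinearMap ∘L
    (ContinuousLinearMap.pi fun i => T ∘L PiLp.proj 2 (fun _ : ι => H) i)

@[simp] theorem amp_apply (T : H →L[ℂ] H) (v : PiLp 2 (fun _ : ι => H)) (i : ι) :
    amp ι T v i = T (v i) := rfl

theorem inner_amp [CompleteSpace H] (T : H →L[ℂ] H) (v w : PiLp 2 (fun _ : ι => H)) :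
    ⟪v, amp ι T w⟫_ℂ = ⟪amp ι (star T) v, w⟫_ℂ := by
  simp only [PiLp.inner_apply, amp_apply, ContinuousLinearMap.star_eq_adjoint,
    ContinuousLinearMap.adjoint_inner_left]

/-- Von Neumann's amplification argument. In the power of `H` let `K` be the closure of the orbit of
the tuple `ξ` under `M`. It is invariant under the star algebra `M`, so the projection onto `K`
commutes with the diagonal action of `M`. Its matrix entries then commute with `M`, hence with `B`.
So `B` preserves `K`, which contains `ξ` because `M` has a unit. -/
theorem exists_near_of_mem_bicommutant [CompleteSpace H] (M : StarSubalgebra ℂ (H →L[ℂ] H))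
    {B : H →L[ℂ] H} (hB : ∀ T : H →L[ℂ] H, (∀ A ∈ M, T * A = A * T) → T * B = B * T)
    (ξ : ι → H) {ε : ℝ} (hε : 0 < ε) : ∃ A ∈ M, ∀ i, ‖A (ξ i) - B (ξ i)‖ < ε := by
  classical
  let x : PiLp 2 (fun _ : ι => H) := WithLp.toLp 2 ξ
  let S : Submodule ℂ (PiLp 2 (fun _ : ι => H)) :=
    { carrier := {v | ∃ A ∈ M, v = amp ι A x}
      add_mem' := by
        rintro _ _ ⟨A, hA, rfl⟩ ⟨A', hA', rfl⟩
        exact ⟨A + A', add_mem hA hA', by ext i; simp⟩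
      zero_mem' := ⟨0, zero_mem M, by ext i; simp⟩
      smul_mem' := by
        rintro c _ ⟨A, hA, rfl⟩
        exact ⟨c • A, SMulMemClass.smul_mem c hA, by ext i; simp⟩ }
  let K := S.topologicalClosure
  have hKc : CompleteSpace K := S.isClosed_topologicalClosure.completeSpace_coe
  have hinv : ∀ A ∈ M, ∀ v ∈ K, amp ι A v ∈ K := by
    intro A hA v hv
    refine closure_minimal (s := (S : Set (PiLp 2 (fun _ : ι => H))))
      (t := {v | amp ι A v ∈ K}) ?_ (S.isClosed_topologicalClosure.preimage (amp ι A).continuous) hv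
    rintro _ ⟨A', hA', rfl⟩
    exact S.le_topologicalClosure ⟨A * A', mul_mem hA hA', by ext i; simp⟩
  have hcomm : ∀ A ∈ M, ∀ v, K.starProjection (amp ι A v) = amp ι A (K.starProjection v) := by
    intro A hA v
    refine Submodule.eq_starProjection_of_mem_of_inner_eq_zero
      (hinv A hA _ (K.starProjection_apply_mem v)) fun w hw => ?_
    rw [← map_sub, ← inner_conj_symm, inner_amp, inner_conj_symm]
    exact (Submodule.mem_orthogonal' _ _).1 (K.sub_starProjection_mem_orthogonal v) _
      (hinv _ (star_mem hA) w hw)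
  let inj : ι → H →L[ℂ] PiLp 2 (fun _ : ι => H) := fun j =>
    (PiLp.continuousLinearEquiv 2 ℂ (fun _ : ι => H)).symm.toContinuousLinearMap ∘L
      ContinuousLinearMap.single ℂ (fun _ : ι => H) j
  have hinj : ∀ (T : H →L[ℂ] H) j η, amp ι T (inj j η) = inj j (T η) := by
    intro T j η
    ext i
    by_cases h : i = j
    · subst h; simp [inj]
    · simp [inj, h]
  have hsum : ∀ v : PiLp 2 (fun _ : ι => H), v = ∑ j, inj j (v j) := by
    intro v
    ext i
    simp [inj, Finset.sum_apply, Pi.single_apply]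
  have hBcomm : ∀ v, K.starProjection (amp ι B v) = amp ι B (K.starProjection v) := by
    intro v
    -- The hypothesis on `B` is applied to the matrix entries of the projection, which are operators
    -- on `H` itself.
    have h1 : ∀ i j, (PiLp.proj 2 (fun _ : ι => H) i ∘L K.starProjection ∘L inj j) * B =
        B * (PiLp.proj 2 (fun _ : ι => H) i ∘L K.starProjection ∘L inj j) := by
      intro i j
      refine hB _ fun A hA => ?_
      ext η
      have h2 := congrArg (fun w : PiLp 2 (fun _ : ι => H) => w i) (hcomm A hA (inj j η))
      simpa [hinj] using h2
    nth_rw 1 [hsum v]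
    nth_rw 2 [hsum v]
    simp only [map_sum, hinj]
    refine Finset.sum_congr rfl fun j _ => ?_
    ext i
    exact congrArg (fun T : H →L[ℂ] H => T (v j)) (h1 i j)
  have hx : x ∈ K := S.le_topologicalClosure ⟨1, one_mem M, by ext i; simp⟩
  have hBx : amp ι B x ∈ K := by
    have := hBcomm x
    rw [Submodule.starProjection_eq_self_iff.2 hx] at this
    rw [← this]
    exact K.starProjection_apply_mem _
  obtain ⟨_, ⟨A, hA, rfl⟩, hd⟩ := Metric.mem_closure_iff.1 hBx ε hε
  refine ⟨A, hA, fun i => ?_⟩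
  rw [dist_eq_norm, norm_sub_rev] at hd
  exact (PiLp.norm_apply_le _ i).trans_lt hd

/-- The density part of the bicommutant theorem. -/
theorem exists_net_of_mem_bicommutant [CompleteSpace H] (M : StarSubalgebra ℂ (H →L[ℂ] H))
    {B : H →L[ℂ] H} (hB : ∀ T : H →L[ℂ] H, (∀ A ∈ M, T * A = A * T) → T * B = B * T) :
    ∃ A : Finset H × ℕ → H →L[ℂ] H, (∀ i, A i ∈ M) ∧
      ∀ ξ, Tendsto (fun i => A i ξ) atTop (𝓝 (B ξ)) := by
  -- The net is indexed by a finite set of vectors together with a precision `1 / (n + 1)`.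
  have h : ∀ i : Finset H × ℕ, ∃ A ∈ M, ∀ ξ ∈ i.1, ‖A ξ - B ξ‖ < 1 / ((i.2 : ℝ) + 1) := by
    rintro ⟨s, n⟩
    obtain ⟨A, hA, h⟩ := exists_near_of_mem_bicommutant M hB (fun ξ : s => (ξ : H))
      (ε := 1 / ((n : ℝ) + 1)) (by positivity)
    exact ⟨A, hA, fun ξ hξ => h ⟨ξ, hξ⟩⟩
  choose A hA hd using h
  refine ⟨A, hA, fun ξ => ?_⟩
  rw [tendsto_iff_norm_sub_tendsto_zero]
  have h1 : Tendsto (fun i : Finset H × ℕ => 1 / ((i.2 : ℝ) + 1)) atTop (𝓝 0) := by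
    rw [← prod_atTop_atTop_eq]
    exact tendsto_one_div_add_atTop_nhds_zero_nat.comp tendsto_snd
  refine tendsto_of_tendsto_of_tendsto_of_le_of_le' tendsto_const_nhds h1
    (Eventually.of_forall fun i => norm_nonneg _) ?_
  filter_upwards [eventually_ge_atTop (({ξ}, 0) : Finset H × ℕ)] with i hi
  exact (hd i ξ (hi.1 (Finset.mem_singleton_self ξ))).le

end Bicommutant

end ToricCode

namespace ToricCode

/-! ### The auxiliary algebra and extensions of endomorphisms -/

section Auxiliary

variable {H : Type*} [NormedAddCommGroup H] [InnerProductSpace ℂ H] [CompleteSpace H]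
  (π : QLA →⋆ₐ[ℂ] (H →L[ℂ] H)) (M : Vertex → Set Bond)

/-- The norm closure of the union of the von Neumann algebras of the regions `M x`. -/
noncomputable def aux : StarSubalgebra ℂ (H →L[ℂ] H) := (⨆ x, vn π (M x)).topologicalClosure

instance isClosed_aux : IsClosed (aux π M : Set (H →L[ℂ] H)) :=
  StarSubalgebra.isClosed_topologicalClosure _

/-- The weak operator topology on the auxiliary algebra. -/
@[reducible] noncomputable def auxTop : TopologicalSpace (aux π M) :=
  TopologicalSpace.induced
    (fun B : aux π M => (ContinuousLinearMapWOT.ofCLM (B : H →L[ℂ] H) : H →WOT[ℂ] H)) inferInstance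

/-- `E` extends `ρ` to the auxiliary algebra, weakly continuously on the algebra of every region. -/
def IsExt (ρ : QLA →⋆ₐ[ℂ] QLA) (E : aux π M →⋆ₐ[ℂ] aux π M) : Prop :=
  (∀ A, ∃ h : π A ∈ aux π M, (E ⟨π A, h⟩ : H →L[ℂ] H) = π (ρ A)) ∧
  ∀ x : Vertex, @ContinuousOn _ _ (auxTop π M) (auxTop π M) E {B | (B : H →L[ℂ] H) ∈ vn π (M x)}

/-- The sequence of regions `M (d n)` increases, is cofinal and exhausts the lattice. -/
structure IsExhausting (M : Vertex → Set Bond) (d : ℕ → Vertex) : Prop where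
  mono : Monotone fun n => M (d n)
  cofinal : ∀ x, ∃ n, M x ⊆ M (d n)
  mem : ∀ b, ∃ n, b ∈ M (d n)

/-- `W` implements `ρ` on the observables of a region. -/
def Implements (W : H →L[ℂ] H) (ρ : QLA →⋆ₐ[ℂ] QLA) (L : Set Bond) : Prop :=
  ∀ A ∈ localAlg L, W * π A = π (ρ A) * W

variable {π M}

theorem vn_le_aux (x : Vertex) : vn π (M x) ≤ aux π M :=
  (le_iSup (fun x => vn π (M x)) x).trans (StarSubalgebra.le_topologicalClosure _)

/-- Along an exhausting sequence the von Neumann algebras increase, so their union is already a star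
algebra and contains the supremum. -/
theorem exists_near_of_mem_aux {d : ℕ → Vertex} (hd : IsExhausting M d) {B : H →L[ℂ] H}
    (hB : B ∈ aux π M) {ε : ℝ} (hε : 0 < ε) : ∃ n, ∃ B' ∈ vn π (M (d n)), ‖B - B'‖ < ε := by
  have hmono : ∀ {m n}, m ≤ n → vn π (M (d m)) ≤ vn π (M (d n)) := fun h =>
    vn_mono π (hd.mono h)
  let U : StarSubalgebra ℂ (H →L[ℂ] H) :=
    { carrier := {B | ∃ n, B ∈ vn π (M (d n))}
      mul_mem' := by
        rintro A B ⟨m, hA⟩ ⟨n, hB⟩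
        exact ⟨max m n, mul_mem (hmono (le_max_left _ _) hA) (hmono (le_max_right _ _) hB)⟩
      add_mem' := by
        rintro A B ⟨m, hA⟩ ⟨n, hB⟩
        exact ⟨max m n, add_mem (hmono (le_max_left _ _) hA) (hmono (le_max_right _ _) hB)⟩
      algebraMap_mem' := fun r => ⟨0, algebraMap_mem _ r⟩
      star_mem' := by
        rintro A ⟨m, hA⟩
        exact ⟨m, star_mem hA⟩ }
  have hU : (⨆ x, vn π (M x)) ≤ U := iSup_le fun x B hB => by
    obtain ⟨n, hn⟩ := hd.cofinal x
    exact ⟨n, vn_mono π hn hB⟩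
  obtain ⟨B', hB', h⟩ := Metric.mem_closure_iff.1 (closure_mono (SetLike.coe_subset_coe.2 hU) hB) ε hε
  obtain ⟨n, hn⟩ := hB'
  exact ⟨n, B', hn, by rwa [dist_eq_norm] at h⟩

theorem IsExhausting.finset_subset {d : ℕ → Vertex} (hd : IsExhausting M d) (F : Finset Bond) :
    ∃ n, (F : Set Bond) ⊆ M (d n) := by
  classical
  induction F using Finset.induction_on with
  | empty => exact ⟨0, by simp⟩
  | insert b F _ ih =>
    obtain ⟨m, hm⟩ := ih
    obtain ⟨n, hn⟩ := hd.mem b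
    refine ⟨max m n, ?_⟩
    rw [Finset.coe_insert]
    exact Set.insert_subset (hd.mono (le_max_right _ _) hn)
      (hm.trans (hd.mono (le_max_left _ _)))

theorem rep_mem_aux {d : ℕ → Vertex} (hd : IsExhausting M d) (A : QLA) : π A ∈ aux π M := by
  have hc : IsClosed (aux π M : Set (H →L[ℂ] H)) := isClosed_aux π M
  rw [← SetLike.mem_coe, ← hc.closure_eq, Metric.mem_closure_iff]
  intro ε hε
  obtain ⟨F, B, hB, h⟩ := exists_finset_near A hε
  obtain ⟨n, hn⟩ := hd.finset_subset F
  refine ⟨π B, vn_le_aux _ (rep_mem_vn π (localAlg_mono hn hB)), ?_⟩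
  rw [dist_eq_norm, ← map_sub π]
  exact (norm_rep_le π _).trans_lt h

theorem Implements.mono {W : H →L[ℂ] H} {ρ : QLA →⋆ₐ[ℂ] QLA} {L L' : Set Bond}
    (h : Implements π W ρ L') (hL : L ⊆ L') : Implements π W ρ L := fun A hA =>
  h A (localAlg_mono hL hA)

theorem Implements.star_mul {W : H →L[ℂ] H} {ρ : QLA →⋆ₐ[ℂ] QLA} {L : Set Bond}
    (h : Implements π W ρ L) (hW : W ∈ unitary (H →L[ℂ] H)) {A : QLA} (hA : A ∈ localAlg L) :
    star W * π (ρ A) = π A * star W := by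
  obtain ⟨h1, h2⟩ := Unitary.mem_iff.1 hW
  calc star W * π (ρ A) = star W * (π (ρ A) * W) * star W := by
        rw [mul_assoc (star W), mul_assoc (π (ρ A)), h2, mul_one]
    _ = (star W * W) * π A * star W := by rw [← h A hA]; simp only [mul_assoc]
    _ = π A * star W := by rw [h1, one_mul]

/-- Since `ρ` maps the local algebra into itself, `T ↦ W* T W` preserves the commutant of the
region; hence `Ad W` preserves the bicommutant. -/
theorem Implements.conj_mem {W : H →L[ℂ] H} {ρ : QLA →⋆ₐ[ℂ] QLA} {L : Set Bond}
    (h : Implements π W ρ L) (hW : W ∈ unitary (H →L[ℂ] H))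
    (hρ : ∀ A ∈ localAlg L, ρ A ∈ localAlg L) {B : H →L[ℂ] H} (hB : B ∈ vn π L) :
    W * B * star W ∈ vn π L := by
  obtain ⟨h1, h2⟩ := Unitary.mem_iff.1 hW
  rw [mem_vn_iff]
  intro T hT
  have h3 : (star W * T * W) * B = B * (star W * T * W) := by
    refine (mem_vn_iff π L B).1 hB _ fun A hA => ?_
    rw [mul_assoc _ W, h A hA, mul_assoc (star W), ← mul_assoc T, hT _ (hρ A hA), mul_assoc (π (ρ A)),
      ← mul_assoc (star W), h.star_mul hW hA]
    simp only [mul_assoc]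
  calc T * (W * B * star W) = W * ((star W * T * W) * B) * star W := by
        simp only [← mul_assoc, h2, one_mul]
    _ = W * B * star W * T := by
        rw [h3]; simp only [mul_assoc, h2, mul_one]

/-- The operator `W'* W` commutes with the observables of the region, hence with its bicommutant.
The extension therefore does not depend on the implementing unitary. -/
theorem Implements.conj_eq {W W' : H →L[ℂ] H} {ρ : QLA →⋆ₐ[ℂ] QLA} {L : Set Bond}
    (h : Implements π W ρ L) (hW : W ∈ unitary (H →L[ℂ] H)) (h' : Implements π W' ρ L)
    (hW' : W' ∈ unitary (H →L[ℂ] H)) {B : H →L[ℂ] H} (hB : B ∈ vn π L) :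
    W * B * star W = W' * B * star W' := by
  obtain ⟨h1, h2⟩ := Unitary.mem_iff.1 hW
  obtain ⟨h1', h2'⟩ := Unitary.mem_iff.1 hW'
  have h3 : (star W' * W) * B = B * (star W' * W) := by
    refine (mem_vn_iff π L B).1 hB _ fun A hA => ?_
    rw [mul_assoc, h A hA, ← mul_assoc, h'.star_mul hW' hA, mul_assoc]
  calc W * B * star W = W' * ((star W' * W) * B) * star W := by
        simp only [← mul_assoc, h2', one_mul]
    _ = W' * B * star W' := by rw [h3]; simp only [mul_assoc, h2, mul_one]

theorem norm_conj {W : H →L[ℂ] H} (hW : W ∈ unitary (H →L[ℂ] H)) (B : H →L[ℂ] H) :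
    ‖W * B * star W‖ = ‖B‖ := by
  rw [CStarRing.norm_mul_mem_unitary _ (Unitary.star_mem hW), CStarRing.norm_mem_unitary_mul _ hW]

/-- On the algebra of the `n`-th region the conjugations by `W m` agree for all `m ≥ n`. These
algebras are dense and conjugations are isometric, so the sequence is Cauchy on all of `aux`. -/
theorem exists_tendsto_conj {d : ℕ → Vertex} (hd : IsExhausting M d) {ρ : QLA →⋆ₐ[ℂ] QLA}
    {D : PauliType → Bond → ZMod 2} (hρ : IsPauliEndo ρ D) {W : ℕ → H →L[ℂ] H}
    (hW : ∀ n, W n ∈ unitary (H →L[ℂ] H)) (himp : ∀ n, Implements π (W n) ρ (M (d n)))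
    (B : aux π M) :
    ∃ L : aux π M, Tendsto (fun n => W n * B * star (W n)) atTop (𝓝 (L : H →L[ℂ] H)) := by
  have hev : ∀ n, ∀ B' ∈ vn π (M (d n)), ∀ m ≥ n, W m * B' * star (W m) = W n * B' * star (W n) :=
    fun n B' hB' m hm => ((himp m).mono (hd.mono hm)).conj_eq (hW m) (himp n) (hW n) hB'
  have hcs : CauchySeq fun n => W n * (B : H →L[ℂ] H) * star (W n) := by
    refine Metric.cauchySeq_iff'.2 fun ε hε => ?_
    obtain ⟨n, B', hB', h⟩ := exists_near_of_mem_aux hd B.2 (half_pos hε)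
    have h1 : ∀ m, ‖W m * (B : H →L[ℂ] H) * star (W m) - W m * B' * star (W m)‖ < ε / 2 := by
      intro m
      rw [← sub_mul, ← mul_sub, norm_conj (hW m)]
      exact h
    refine ⟨n, fun m hm => ?_⟩
    rw [dist_eq_norm]
    calc _ = ‖(W m * (B : H →L[ℂ] H) * star (W m) - W m * B' * star (W m)) -
          (W n * (B : H →L[ℂ] H) * star (W n) - W n * B' * star (W n))‖ := by
          rw [hev n B' hB' m hm]; congr 1; abel
      _ ≤ _ := norm_sub_le _ _
      _ < ε / 2 + ε / 2 := add_lt_add (h1 m) (h1 n)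
      _ = ε := add_halves ε
  obtain ⟨L, hL⟩ := cauchySeq_tendsto_of_complete hcs
  refine ⟨⟨L, ?_⟩, hL⟩
  have hc : IsClosed (aux π M : Set (H →L[ℂ] H)) := isClosed_aux π M
  rw [← SetLike.mem_coe, ← hc.closure_eq, Metric.mem_closure_iff]
  intro ε hε
  obtain ⟨n, B', hB', h⟩ := exists_near_of_mem_aux hd B.2 (half_pos hε)
  refine ⟨W n * B' * star (W n), vn_le_aux _ ((himp n).conj_mem (hW n)
    (fun A hA => hρ.apply_mem hA) hB'), ?_⟩
  rw [dist_eq_norm]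
  refine lt_of_le_of_lt (le_of_tendsto (hL.sub_const _).norm ?_) (half_lt_self hε)
  filter_upwards [eventually_ge_atTop n] with m hm
  rw [← hev n B' hB' m hm, ← sub_mul, ← mul_sub, norm_conj (hW m)]
  exact h.le

/-- The extension to the auxiliary algebra, as a norm limit of unitary conjugations. -/
theorem exists_starAlgHom_tendsto_conj {d : ℕ → Vertex} (hd : IsExhausting M d)
    {ρ : QLA →⋆ₐ[ℂ] QLA}
    {D : PauliType → Bond → ZMod 2} (hρ : IsPauliEndo ρ D) {W : ℕ → H →L[ℂ] H}
    (hW : ∀ n, W n ∈ unitary (H →L[ℂ] H)) (himp : ∀ n, Implements π (W n) ρ (M (d n))) :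
    ∃ E : aux π M →⋆ₐ[ℂ] aux π M, ∀ B : aux π M,
      Tendsto (fun n => W n * (B : H →L[ℂ] H) * star (W n)) atTop (𝓝 (E B : H →L[ℂ] H)) := by
  choose E hE using exists_tendsto_conj hd hρ hW himp
  have h1 : ∀ n, star (W n) * W n = 1 := fun n => (Unitary.mem_iff.1 (hW n)).1
  have h2 : ∀ n, W n * star (W n) = 1 := fun n => (Unitary.mem_iff.1 (hW n)).2
  have hone : E 1 = 1 := by
    refine Subtype.ext (tendsto_nhds_unique (hE 1) ?_)
    simp [h2]
  have hadd : ∀ A B, E (A + B) = E A + E B := by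
    intro A B
    refine Subtype.ext (tendsto_nhds_unique (hE (A + B)) (((hE A).add (hE B)).congr fun n => ?_))
    simp [mul_add, add_mul]
  have hsmul : ∀ (r : ℂ) A, E (r • A) = r • E A := by
    intro r A
    refine Subtype.ext (tendsto_nhds_unique (hE (r • A)) (((hE A).const_smul r).congr fun n => ?_))
    simp
  have hmul : ∀ A B, E (A * B) = E A * E B := by
    intro A B
    refine Subtype.ext (tendsto_nhds_unique (hE (A * B)) (((hE A).mul (hE B)).congr fun n => ?_))
    calc _ = W n * A * (star (W n) * W n) * B * star (W n) := by simp only [mul_assoc]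
      _ = _ := by rw [h1, mul_one, MulMemClass.coe_mul, ← mul_assoc (W n)]
  have hstar : ∀ A, E (star A) = star (E A) := by
    intro A
    refine Subtype.ext (tendsto_nhds_unique (hE (star A)) ((hE A).star.congr fun n => ?_))
    simp [mul_assoc]
  exact ⟨{ toFun := E
           map_one' := hone
           map_mul' := hmul
           map_zero' := by simpa using hsmul 0 0
           map_add' := hadd
           commutes' := fun r => by rw [Algebra.algebraMap_eq_smul_one, hsmul, hone]
           map_star' := hstar }, hE⟩

/-- Stated for an abstract induced topology, so that the weak topology does not collide with the
norm topology that `aux` carries as an instance. -/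
theorem continuousOn_induced {X Y : Type*} [TopologicalSpace Y] (g : X → Y) {f : X → X} {S : Set X}
    {Φ : Y → Y} (hΦ : Continuous Φ) (h : ∀ x ∈ S, g (f x) = Φ (g x)) :
    @ContinuousOn X X (TopologicalSpace.induced g inferInstance)
      (TopologicalSpace.induced g inferInstance) f S := by
  let _ : TopologicalSpace X := TopologicalSpace.induced g inferInstance
  have hg : Topology.IsInducing g := ⟨rfl⟩
  exact hg.continuousOn_iff.2 ((hΦ.comp hg.continuous).continuousOn.congr h)

theorem tendsto_of_continuousOn_induced {X Y ι : Type*} [TopologicalSpace Y] {g : X → Y} {f : X → X}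
    {S : Set X} (hf : @ContinuousOn X X (TopologicalSpace.induced g inferInstance)
      (TopologicalSpace.induced g inferInstance) f S) {l : Filter ι} {u : ι → X} {x : X}
    (hu : ∀ i, u i ∈ S) (hx : x ∈ S) (h : Tendsto (fun i => g (u i)) l (𝓝 (g x))) :
    Tendsto (fun i => g (f (u i))) l (𝓝 (g (f x))) := by
  let _ : TopologicalSpace X := TopologicalSpace.induced g inferInstance
  have hg : Topology.IsInducing g := ⟨rfl⟩
  have h1 : Tendsto u l (𝓝[S] x) :=
    tendsto_nhdsWithin_of_tendsto_nhds_of_eventually_within _ (hg.tendsto_nhds_iff.2 h)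
      (Eventually.of_forall hu)
  exact (hg.continuous.tendsto _).comp ((hf x hx).tendsto.comp h1)

theorem continuous_conj_wot (W : H →L[ℂ] H) :
    Continuous fun B : H →WOT[ℂ] H =>
      (ContinuousLinearMapWOT.ofCLM (W * B.toCLM * star W) : H →WOT[ℂ] H) := by
  refine ContinuousLinearMapWOT.continuous_of_dual_apply_continuous fun x y => ?_
  exact ContinuousLinearMapWOT.continuous_dual_apply (star W x) (y ∘L W)

/-- The extension exists if `ρ` is implemented by unitaries on the regions of an exhausting
sequence. -/
theorem exists_isExt {d : ℕ → Vertex} (hd : IsExhausting M d) {ρ : QLA →⋆ₐ[ℂ] QLA}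
    {D : PauliType → Bond → ZMod 2} (hρ : IsPauliEndo ρ D)
    (himp : ∀ n, ∃ W ∈ unitary (H →L[ℂ] H), Implements π W ρ (M (d n))) :
    ∃ E : aux π M →⋆ₐ[ℂ] aux π M, IsExt π M ρ E := by
  choose W hW himp using himp
  obtain ⟨E, hE⟩ := exists_starAlgHom_tendsto_conj hd hρ hW himp
  -- On the algebra of a single region the limit is attained after finitely many steps, which makes
  -- the extension weakly continuous there.
  have hE' : ∀ n, ∀ B : aux π M, (B : H →L[ℂ] H) ∈ vn π (M (d n)) →
      (E B : H →L[ℂ] H) = W n * B * star (W n) := by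
    intro n B hB
    refine tendsto_nhds_unique (hE B) (tendsto_const_nhds.congr' ?_)
    filter_upwards [eventually_ge_atTop n] with m hm
    exact (himp n).conj_eq (hW n) ((himp m).mono (hd.mono hm)) (hW m) hB
  refine ⟨E, fun A => ⟨rep_mem_aux hd A, ?_⟩, fun x => ?_⟩
  · have hcont : Continuous E := AddMonoidHomClass.continuous_of_bound E 1
      (by simpa using NonUnitalStarAlgHom.norm_apply_le E)
    have hcl : IsClosed {A : QLA | (E ⟨π A, rep_mem_aux hd A⟩ : H →L[ℂ] H) = π (ρ A)} := by
      refine isClosed_eq ?_ ((continuous_rep π).comp (continuous_endo ρ))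
      exact continuous_subtype_val.comp (hcont.comp ((continuous_rep π).subtype_mk _))
    have hdense : ∀ A, A ∈ closure {A : QLA | (E ⟨π A, rep_mem_aux hd A⟩ : H →L[ℂ] H) = π (ρ A)} := by
      intro A
      rw [Metric.mem_closure_iff]
      intro ε hε
      obtain ⟨F, B, hB, h⟩ := exists_finset_near A hε
      obtain ⟨n, hn⟩ := hd.finset_subset F
      refine ⟨B, ?_, by rwa [dist_eq_norm]⟩
      have hB' := localAlg_mono hn hB
      change (E ⟨π B, rep_mem_aux hd B⟩ : H →L[ℂ] H) = π (ρ B)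
      rw [hE' n _ (rep_mem_vn π hB'), himp n B hB', mul_assoc, (Unitary.mem_iff.1 (hW n)).2, mul_one]
    have hA := hdense A
    rw [hcl.closure_eq] at hA
    exact hA
  · obtain ⟨n, hn⟩ := hd.cofinal x
    exact continuousOn_induced _ (continuous_conj_wot (W n)) fun B hB =>
      congrArg ContinuousLinearMapWOT.ofCLM (hE' n B (vn_mono π hn hB))

/-- Uniqueness of the extension. It agrees with `Ad W` on the observables of the region, both maps
are weakly continuous on the von Neumann algebra, and each of its elements is a strong limit of a
net of such observables. -/
theorem IsExt.apply_eq_conj {ρ : QLA →⋆ₐ[ℂ] QLA} {E : aux π M →⋆ₐ[ℂ] aux π M}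
    (hE : IsExt π M ρ E) {x : Vertex} {W : H →L[ℂ] H} (hW : W ∈ unitary (H →L[ℂ] H))
    (himp : Implements π W ρ (M x)) (B : aux π M) (hB : (B : H →L[ℂ] H) ∈ vn π (M x)) :
    (E B : H →L[ℂ] H) = W * B * star W := by
  classical
  obtain ⟨A, hA, hlim⟩ := exists_net_of_mem_bicommutant ((localAlg (M x)).map π)
    (B := (B : H →L[ℂ] H)) fun T hT => (mem_vn_iff π _ _).1 hB T fun a ha => hT _ ⟨a, ha, rfl⟩
  choose a ha haA using hA
  have hmem : ∀ i, A i ∈ aux π M := fun i => by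
    rw [← haA i]
    exact (hE.1 (a i)).1
  have hvn : ∀ i, A i ∈ vn π (M x) := fun i => by
    rw [← haA i]
    exact rep_mem_vn π (ha i)
  have hEA : ∀ i, (E ⟨A i, hmem i⟩ : H →L[ℂ] H) = W * A i * star W := by
    intro i
    obtain ⟨h, h'⟩ := hE.1 (a i)
    have h2 : (⟨A i, hmem i⟩ : aux π M) = ⟨π (a i), h⟩ := Subtype.ext (haA i).symm
    have h3 : A i = π (a i) := (haA i).symm
    rw [h2, h', h3, himp _ (ha i), mul_assoc, (Unitary.mem_iff.1 hW).2, mul_one]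
  have h2 := tendsto_of_continuousOn_induced (hE.2 x) (l := atTop)
    (u := fun i => (⟨A i, hmem i⟩ : aux π M)) hvn hB
    (ContinuousLinearMapWOT.tendsto_iff_forall_dual_apply_tendsto.2 fun ξ y =>
      (y.continuous.tendsto _).comp (hlim ξ))
  rw [ContinuousLinearMapWOT.tendsto_iff_forall_dual_apply_tendsto] at h2
  refine ContinuousLinearMap.ext fun ξ => ext_inner_left ℂ fun η => ?_
  refine tendsto_nhds_unique (h2 ξ (innerSL ℂ η)) ?_
  have h3 : Tendsto (fun i => innerSL ℂ η ((W * A i * star W) ξ)) atTop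
      (𝓝 (innerSL ℂ η ((W * B * star W) ξ))) :=
    ((innerSL ℂ η).continuous.tendsto _).comp ((W.continuous.tendsto _).comp (hlim (star W ξ)))
  refine h3.congr fun i => ?_
  rw [← hEA i]
  rfl

/-- The extension fixes the operators commuting with cofinally many implementing unitaries. -/
theorem IsExt.apply_eq_self {d : ℕ → Vertex} (hd : IsExhausting M d) {ρ : QLA →⋆ₐ[ℂ] QLA}
    {E : aux π M →⋆ₐ[ℂ] aux π M} (hE : IsExt π M ρ E) (T : aux π M)
    (h : ∀ n, ∃ m ≥ n, ∃ W ∈ unitary (H →L[ℂ] H), Implements π W ρ (M (d m)) ∧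
      W * (T : H →L[ℂ] H) = T * W) : E T = T := by
  refine Subtype.ext ?_
  rw [← sub_eq_zero, ← norm_eq_zero]
  refine le_antisymm (le_of_forall_pos_le_add fun ε hε => ?_) (norm_nonneg _)
  obtain ⟨n, T', hT', hn⟩ := exists_near_of_mem_aux hd T.2 (half_pos hε)
  obtain ⟨m, hm, W, hW, himp, hWT⟩ := h n
  have hT'm := vn_mono π (hd.mono hm) hT'
  let S : aux π M := ⟨T', vn_le_aux _ hT'⟩
  have h1 : (E S : H →L[ℂ] H) = W * T' * star W := hE.apply_eq_conj hW himp S hT'm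
  have h2 : (T : H →L[ℂ] H) = W * T * star W := by
    rw [hWT, mul_assoc, (Unitary.mem_iff.1 hW).2, mul_one]
  have h3 : ‖(E (T - S) : H →L[ℂ] H)‖ ≤ ‖(T : H →L[ℂ] H) - T'‖ :=
    NonUnitalStarAlgHom.norm_apply_le E (T - S)
  have h4 : ‖W * (T' - (T : H →L[ℂ] H)) * star W‖ = ‖(T : H →L[ℂ] H) - T'‖ := by
    rw [norm_conj hW, norm_sub_rev]
  -- With `S` close to `T` and `E S = W S W*`, `T = W T W*`, the difference `E T - T` splits into
  -- the images of `T - S` under `E` and of `S - T` under conjugation by `W`. Both are small.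
  have h5 : (E T : H →L[ℂ] H) - T = (E (T - S) : H →L[ℂ] H) + W * (T' - (T : H →L[ℂ] H)) * star W := by
    rw [map_sub E, AddSubgroupClass.coe_sub, h1, mul_sub, sub_mul, ← h2]
    abel
  rw [h5, zero_add]
  calc _ ≤ _ := norm_add_le _ _
    _ ≤ ε / 2 + ε / 2 := add_le_add (h3.trans hn.le) (h4.le.trans hn.le)
    _ = ε := add_halves ε

end Auxiliary

end ToricCode

namespace ToricCode

/-! ### Charge transporters and the braiding -/

/-- The intersection number modulo two of a finite chain with a chain. -/
noncomputable def pair (x : Chain) (y : Bond → ZMod 2) : ZMod 2 :=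
  Finsupp.linearCombination (ZMod 2) y x

theorem IsPauliEndo.apply_pauli {ρ : QLA →⋆ₐ[ℂ] QLA} {D : PauliType → Bond → ZMod 2}
    (h : IsPauliEndo ρ D) (k : PauliType) (x : Chain) :
    ρ (pauli k x) = sgn (pair x (D k.dual)) • pauli k x := by
  induction x using chain_induction with
  | h0 => simp [pair]
  | h1 b x ih =>
    rw [pauli_single_add, map_mul, h, ih, smul_mul_smul_comm, ← sgn_add]
    simp [pair]

theorem IsTransport.trans {k : PauliType} {L : Set Bond} {x y z : Bond → ZMod 2} {F G : ℕ → Chain}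
    (hF : IsTransport k L x y F) (hG : IsTransport k L y z G) :
    IsTransport k L x z (fun n => F n + G n) where
  mem n b hb := by simp [hF.mem n b hb, hG.mem n b hb]
  bdry_eq n p := by
    rw [Finsupp.coe_add, Finsupp.coe_add, bdry_add, bdry_add, hF.bdry_eq, hG.bdry_eq]
  lim b := by
    filter_upwards [hF.lim b, hG.lim b] with n h1 h2
    rw [Finsupp.add_apply, h1, h2]
    linear_combination zmod_two_add_self (y b)

section Braiding

variable {H : Type*} [NormedAddCommGroup H] [InnerProductSpace ℂ H] [CompleteSpace H]
  {π : QLA →⋆ₐ[ℂ] (H →L[ℂ] H)} {M : Vertex → Set Bond} {Ω : H}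

theorem star_mul_eq_of_mul_eq {V P Q : H →L[ℂ] H} (hV : V ∈ unitary (H →L[ℂ] H))
    (h : V * P = Q * V) : star V * Q = P * star V := by
  obtain ⟨h1, h2⟩ := Unitary.mem_iff.1 hV
  calc star V * Q = star V * (Q * V) * star V := by
        rw [mul_assoc, mul_assoc Q, h2, mul_one]
    _ = P * star V := by rw [← h, ← mul_assoc, h1, one_mul]

/-- A charge transporter to strings outside of a region implements the endomorphism there. -/
theorem implements_star_of_intertwiner {V : H →L[ℂ] H} (hV : V ∈ unitary (H →L[ℂ] H))
    {ρ σ : QLA →⋆ₐ[ℂ] QLA} (h : ∀ A, V * π (ρ A) = π (σ A) * V) {L : Set Bond}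
    (hσ : ∀ A ∈ localAlg L, σ A = A) : Implements π (star V) ρ L := by
  intro A hA
  have h1 := h A
  rw [hσ A hA] at h1
  exact star_mul_eq_of_mul_eq hV h1

/-- If the strings `D` can be transported within `L` out of the region `M`, then the endomorphism is
implemented on `M` by a unitary of the von Neumann algebra of `L`. -/
theorem exists_implements (hΩ : IsVacuum π Ω) {ρ : QLA →⋆ₐ[ℂ] QLA}
    {D D'' : PauliType → Bond → ZMod 2} (hρ : IsPauliEndo ρ D) {L N : Set Bond}
    (hN : ∀ k, ∀ b ∈ N, D'' k b = 0) {F : PauliType → ℕ → Chain}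
    (hF : ∀ k, IsTransport k L (D k) (D'' k) (F k)) :
    ∃ W ∈ unitary (H →L[ℂ] H), W ∈ vn π L ∧ Implements π W ρ N := by
  obtain ⟨V, hV, hVL, -, hVi⟩ := exists_unitary_of_isTransport π hΩ hF
  obtain ⟨σ, hσ⟩ := exists_isPauliEndo D''
  refine ⟨star V, Unitary.star_mem hV, star_mem hVL,
    implements_star_of_intertwiner hV (hVi ρ σ hρ hσ) ?_⟩
  have h := hσ.isLocalizedIn (L := Nᶜ) fun k b hb => hN k b (not_not.1 hb)
  simpa only [IsLocalizedIn, compl_compl] using h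

/-- The charge transporter from `C` to `K'`, and its behaviour under the extension of the
endomorphism. -/
theorem exists_charge_transporter (hΩ : IsVacuum π Ω) {ρ : QLA →⋆ₐ[ℂ] QLA}
    {D D₀ D' D'' : PauliType → Bond → ZMod 2} (hρ : IsPauliEndo ρ D) {C K' : Set Bond} {x : Vertex}
    (hCK : C ⊆ K'ᶜ) (hCx : C ⊆ M x) (hD' : ∀ k, ∀ b ∉ K', D' k b = 0)
    (hD'' : ∀ k, ∀ b ∈ M x, D'' k b = 0) {U F G : PauliType → ℕ → Chain}
    (hU : ∀ k, IsTransport k C (D k) (D₀ k) (U k))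
    (hF : ∀ k, IsTransport k (M x) (D₀ k) (D' k) (F k))
    (hG : ∀ k, IsTransport k Set.univ (D₀ k) (D'' k) (G k)) {s : ZMod 2}
    (hs : ∀ᶠ n in atTop, pair (F .X n) (D₀ .Z) + pair (F .Z n) (D₀ .X) = s) :
    ∃ V ∈ unitary (H →L[ℂ] H), V ∈ vn π (M x) ∧
      (∀ ρ', IsPauliEndo ρ' D' → ∀ A, V * π (ρ A) = π (ρ' A) * V) ∧
      ∀ E : aux π M →⋆ₐ[ℂ] aux π M, IsExt π M ρ E → ∀ V' : aux π M, (V' : H →L[ℂ] H) = V →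
        E V' = sgn s • V' := by
  obtain ⟨σ, hσ⟩ := exists_isPauliEndo D₀
  obtain ⟨σ', hσ'⟩ := exists_isPauliEndo D'
  -- Three unitaries: `u` moves the given strings inside `C` to the reference strings `D₀`, `v`
  -- moves these to `K'` within `M x`, and `W` implements the endomorphism of `D₀` on `M x` by
  -- moving `D₀` outside.
  obtain ⟨u, hu, huC, -, hui⟩ := exists_unitary_of_isTransport π hΩ hU
  obtain ⟨v, hv, hvM, hvl, hvi⟩ := exists_unitary_of_isTransport π hΩ hF
  obtain ⟨W, hW, -, hWσ⟩ := exists_implements hΩ hσ hD'' hG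
  -- On each finite approximant of `v`, `W` acts as the endomorphism of `D₀`, that is, by the parity
  -- of the crossings of `F n` with `D₀`; the parity is eventually `s`.
  have hWv : W * v = sgn s • (v * W) := by
    refine (hvl.mul_left W).unique (((hvl.mul_right W).const_smul (sgn s)).congr' ?_)
    filter_upwards [hs] with n hn
    have hmem : ∀ k, pauli k (F k n) ∈ localAlg (M x) := fun k =>
      pauli_mem_localAlg k fun b hb => by
        by_contra h
        exact Finsupp.mem_support_iff.1 hb ((hF k).mem n b h)
    rw [hWσ _ (mul_mem (hmem .X) (hmem .Z)), map_mul σ, hσ.apply_pauli, hσ.apply_pauli,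
      smul_mul_smul_comm, ← sgn_add, map_smul π, smul_mul_assoc]
    simp only [PauliType.dual, hn]
  -- On observables of `C` the product `v W` implements `σ'`, whose strings lie in `K'` outside `C`.
  -- So it commutes with the von Neumann algebra of `C`, to which `u` belongs.
  have hQ : v * W * u = u * (v * W) := by
    refine (mem_vn_iff π C u).1 huC _ fun A hA => ?_
    have h1 : σ' A = A := hσ'.isLocalizedIn hD' A (localAlg_mono hCK hA)
    rw [mul_assoc, hWσ A (localAlg_mono hCx hA), ← mul_assoc, hvi σ σ' hσ hσ', h1, mul_assoc]
  obtain ⟨hu1, hu2⟩ := Unitary.mem_iff.1 hu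
  obtain ⟨hW1, hW2⟩ := Unitary.mem_iff.1 hW
  have huM : u ∈ vn π (M x) := vn_mono π hCx huC
  refine ⟨v * u, mul_mem hv hu, mul_mem hvM huM, fun ρ' hρ' A => ?_, fun E hE V' hV' => ?_⟩
  · rw [mul_assoc, hui ρ σ hρ hσ, ← mul_assoc, hvi σ ρ' hσ hρ', mul_assoc]
  · refine Subtype.ext ?_
    -- The strings `D` differ from `D₀` by `u`, so `u* W` implements `ρ` itself on `M x`.
    have himp : Implements π (star u * W) ρ (M x) := fun A hA => by
      rw [mul_assoc, hWσ A hA, ← mul_assoc, star_mul_eq_of_mul_eq hu (hui ρ σ hρ hσ A), mul_assoc]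
    rw [hE.apply_eq_conj (mul_mem (Unitary.star_mem hu) hW) himp V'
      (by rw [hV']; exact mul_mem hvM huM), hV', star_mul, star_star]
    calc star u * W * (v * u) * (star W * u) = star u * (W * v) * u * star W * u := by
          simp only [mul_assoc]
      _ = sgn s • (star u * (v * W * u) * star W * u) := by
          rw [hWv]; simp only [mul_smul_comm, smul_mul_assoc, mul_assoc]
      _ = sgn s • (v * u) := by
          rw [hQ]
          congr 1
          calc _ = (star u * u) * v * (W * star W) * u := by simp only [mul_assoc]
            _ = v * u := by rw [hu1, hW2, one_mul, mul_one]
      _ = _ := by rw [← hV']; rfl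

end Braiding

end ToricCode

namespace ToricCode

/-! ### Connections between sites, and the intersection form -/

/-- The indicator function modulo two of a site. -/
def pt (p q : Vertex) : ZMod 2 := if q = p then 1 else 0

theorem single_eq_pt (p q : Vertex) : (Finsupp.single p (1 : ZMod 2) : Vertex →₀ ZMod 2) q = pt p q := by
  rw [pt, Finsupp.single_apply]
  simp only [eq_comm]

/-- The bond between the sites `p` and `p + (1, 0)`. -/
def hBond : PauliType → Vertex → Bond
  | .X, p => ((p.1 + 1, p.2), true)
  | .Z, p => (p, false)

/-- The bond between the sites `p` and `p + (0, 1)`. -/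
def vBond : PauliType → Vertex → Bond
  | .X, p => ((p.1, p.2 + 1), false)
  | .Z, p => (p, true)

theorem bdry_hBond (k : PauliType) (p q : Vertex) :
    bdry k (Finsupp.single (hBond k p) (1 : ZMod 2)) q = pt p q + pt (p + (1, 0)) q := by
  obtain ⟨i, j⟩ := p
  obtain ⟨m, n⟩ := q
  cases k
  · simp only [bdry_X, hBond, Finsupp.single_apply, pt, Prod.mk.injEq, Prod.mk_add_mk, add_zero,
      and_false, Bool.true_eq_false, if_false, and_true, zero_add, add_left_inj]
    rw [add_comm]
    congr 2
    · simp only [eq_comm]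
    · simp only [eq_comm]
  · simp only [bdry_Z, hBond, Finsupp.single_apply, pt, Prod.mk.injEq, Prod.mk_add_mk, add_zero,
      and_false, Bool.false_eq_true, if_false, and_true]
    have e1 : (i = m - 1 ∧ j = n) ↔ (m = i + 1 ∧ n = j) := by omega
    have e2 : (i = m ∧ j = n) ↔ (m = i ∧ n = j) := by omega
    simp only [e1, e2]

theorem bdry_vBond (k : PauliType) (p q : Vertex) :
    bdry k (Finsupp.single (vBond k p) (1 : ZMod 2)) q = pt p q + pt (p + (0, 1)) q := by
  obtain ⟨i, j⟩ := p
  obtain ⟨m, n⟩ := q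
  cases k
  · simp only [bdry_X, vBond, Finsupp.single_apply, pt, Prod.mk.injEq, Prod.mk_add_mk, add_zero,
      and_false, Bool.false_eq_true, if_false, and_true, add_left_inj]
    rw [add_comm]
    congr 2
    · simp only [eq_comm]
    · simp only [eq_comm]
  · simp only [bdry_Z, vBond, Finsupp.single_apply, pt, Prod.mk.injEq, Prod.mk_add_mk, add_zero,
      and_false, Bool.true_eq_false, if_false, and_true, zero_add]
    have e1 : (i = m ∧ j = n - 1) ↔ (m = i ∧ n = j + 1) := by omega
    have e2 : (i = m ∧ j = n) ↔ (m = i ∧ n = j) := by omega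
    simp only [e1, e2]

theorem bdry_zero (k : PauliType) (p : Vertex) : bdry k (0 : Bond → ZMod 2) p = 0 := by
  cases k <;> simp [bdry_X, bdry_Z]

/-- The chain `F` lies in `L` and has the boundary `p + q`. -/
structure Joins (k : PauliType) (L : Set Bond) (p q : Vertex) (F : Chain) : Prop where
  mem : ∀ b, b ∉ L → F b = 0
  bdry_eq : ∀ r, bdry k F r = pt p r + pt q r

/-- The sites `p` and `q` are joined by a finite chain in `L`. -/
def Conn (k : PauliType) (L : Set Bond) (p q : Vertex) : Prop := ∃ F, Joins k L p q F

theorem Conn.refl (k : PauliType) (L : Set Bond) (p : Vertex) : Conn k L p p :=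
  ⟨0, fun _ _ => rfl, fun r => by rw [zmod_two_add_self]; exact bdry_zero k r⟩

theorem Joins.symm {k : PauliType} {L : Set Bond} {p q : Vertex} {F : Chain} (h : Joins k L p q F) :
    Joins k L q p F := ⟨h.mem, fun r => by rw [h.bdry_eq, add_comm]⟩

theorem Joins.mono {k : PauliType} {L L' : Set Bond} {p q : Vertex} {F : Chain}
    (h : Joins k L p q F) (hL : L ⊆ L') : Joins k L' p q F :=
  ⟨fun b hb => h.mem b fun h' => hb (hL h'), h.bdry_eq⟩

theorem Joins.trans {k : PauliType} {L : Set Bond} {p q r : Vertex} {F G : Chain}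
    (hF : Joins k L p q F) (hG : Joins k L q r G) : Joins k L p r (F + G) where
  mem b hb := by simp [hF.mem b hb, hG.mem b hb]
  bdry_eq t := by
    rw [Finsupp.coe_add, bdry_add, hF.bdry_eq, hG.bdry_eq]
    linear_combination zmod_two_add_self (pt q t)

theorem Conn.symm {k : PauliType} {L : Set Bond} {p q : Vertex} (h : Conn k L p q) :
    Conn k L q p := let ⟨F, hF⟩ := h; ⟨F, hF.symm⟩

theorem Conn.mono {k : PauliType} {L L' : Set Bond} {p q : Vertex} (h : Conn k L p q)
    (hL : L ⊆ L') : Conn k L' p q := let ⟨F, hF⟩ := h; ⟨F, hF.mono hL⟩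

theorem Conn.trans {k : PauliType} {L : Set Bond} {p q r : Vertex} (h : Conn k L p q)
    (h' : Conn k L q r) : Conn k L p r :=
  let ⟨F, hF⟩ := h; let ⟨G, hG⟩ := h'; ⟨F + G, hF.trans hG⟩

theorem joins_single {k : PauliType} {L : Set Bond} {p q : Vertex} {b : Bond} (hb : b ∈ L)
    (h : ∀ r, bdry k (Finsupp.single b (1 : ZMod 2)) r = pt p r + pt q r) :
    Joins k L p q (Finsupp.single b 1) :=
  ⟨fun c hc => by
    have : b ≠ c := fun h => hc (h ▸ hb)
    simp [this], h⟩

theorem conn_hBond {k : PauliType} {L : Set Bond} {p : Vertex} (h : hBond k p ∈ L) :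
    Conn k L p (p + (1, 0)) := ⟨_, joins_single h (bdry_hBond k p)⟩

theorem conn_vBond {k : PauliType} {L : Set Bond} {p : Vertex} (h : vBond k p ∈ L) :
    Conn k L p (p + (0, 1)) := ⟨_, joins_single h (bdry_vBond k p)⟩

/-- The bonds whose coordinates differ by at most `R` from those of the point `p`. -/
def nearBonds (R : ℕ) (p : Vertex) : Set Bond := {b | |b.1.1 - p.1| ≤ R ∧ |b.1.2 - p.2| ≤ R}

/-- An L-shaped walk, first horizontal and then vertical, a negative step being walked backwards
from its end. The extra `1` in the radius covers bonds of type `X`, which are labelled by a point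
next to the site. -/
theorem conn_near (k : PauliType) (p d : Vertex) :
    Conn k (nearBonds (d.1.natAbs + d.2.natAbs + 1) p) p (p + d) := by
  have hh : ∀ (L : Set Bond) (q : Vertex) (n : ℕ), (∀ i : ℤ, 0 ≤ i → i < n → hBond k (q + (i, 0)) ∈ L) →
      Conn k L q (q + ((n : ℤ), 0)) := by
    intro L q n
    induction n with
    | zero =>
      intro _
      have e : q + (((0 : ℕ) : ℤ), 0) = q := by ext <;> simp
      rw [e]
      exact Conn.refl k L q
    | succ n ih =>
      intro h
      refine (ih fun i hi hn => h i hi (by push_cast; omega)).trans ?_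
      have := conn_hBond (h n (by omega) (by push_cast; omega))
      have e : q + ((n : ℤ), 0) + (1, 0) = q + (((n + 1 : ℕ) : ℤ), 0) := by
        ext <;> simp [add_assoc]
      rwa [e] at this
  have hv : ∀ (L : Set Bond) (q : Vertex) (n : ℕ), (∀ i : ℤ, 0 ≤ i → i < n → vBond k (q + (0, i)) ∈ L) →
      Conn k L q (q + (0, (n : ℤ))) := by
    intro L q n
    induction n with
    | zero =>
      intro _
      have e : q + (0, ((0 : ℕ) : ℤ)) = q := by ext <;> simp
      rw [e]
      exact Conn.refl k L q
    | succ n ih =>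
      intro h
      refine (ih fun i hi hn => h i hi (by push_cast; omega)).trans ?_
      have := conn_vBond (h n (by omega) (by push_cast; omega))
      have e : q + (0, (n : ℤ)) + (0, 1) = q + (0, ((n + 1 : ℕ) : ℤ)) := by
        ext <;> simp [add_assoc]
      rwa [e] at this
  obtain ⟨i, j⟩ := p
  obtain ⟨m, n⟩ := d
  set L := nearBonds (m.natAbs + n.natAbs + 1) (i, j) with hL
  have h1 : Conn k L (i, j) (i + m, j) := by
    rcases le_total 0 m with hm | hm
    · have := hh L (i, j) m.natAbs fun t ht htm => by
        cases k <;> simp only [hBond, hL, nearBonds, Prod.mk_add_mk, Set.mem_ofPred_eq, abs_le,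
          Nat.cast_add, Nat.cast_one] <;> omega
      have e : ((i, j) : Vertex) + ((m.natAbs : ℤ), 0) = (i + m, j) :=
        Prod.ext (by change i + (m.natAbs : ℤ) = i + m; omega) (add_zero j)
      rwa [e] at this
    · have := hh L (i + m, j) m.natAbs fun t ht htm => by
        cases k <;> simp only [hBond, hL, nearBonds, Prod.mk_add_mk, Set.mem_ofPred_eq, abs_le,
          Nat.cast_add, Nat.cast_one] <;> omega
      have e : ((i + m, j) : Vertex) + ((m.natAbs : ℤ), 0) = (i, j) :=
        Prod.ext (by change i + m + (m.natAbs : ℤ) = i; omega) (add_zero j)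
      rw [e] at this
      exact this.symm
  have h2 : Conn k L (i + m, j) (i + m, j + n) := by
    rcases le_total 0 n with hm | hm
    · have := hv L (i + m, j) n.natAbs fun t ht htm => by
        cases k <;> simp only [vBond, hL, nearBonds, Prod.mk_add_mk, Set.mem_ofPred_eq, abs_le,
          Nat.cast_add, Nat.cast_one] <;> omega
      have e : ((i + m, j) : Vertex) + (0, (n.natAbs : ℤ)) = (i + m, j + n) :=
        Prod.ext (add_zero _) (by change j + (n.natAbs : ℤ) = j + n; omega)
      rwa [e] at this
    · have := hv L (i + m, j + n) n.natAbs fun t ht htm => by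
        cases k <;> simp only [vBond, hL, nearBonds, Prod.mk_add_mk, Set.mem_ofPred_eq, abs_le,
          Nat.cast_add, Nat.cast_one] <;> omega
      have e : ((i + m, j + n) : Vertex) + (0, (n.natAbs : ℤ)) = (i + m, j) :=
        Prod.ext (add_zero _) (by change j + n + (n.natAbs : ℤ) = j; omega)
      rw [e] at this
      exact this.symm
  exact h1.trans h2

/-- A chain joining the ends of an arithmetic progression of sites. -/
theorem conn_progression {k : PauliType} {L : Set Bond} (p d : Vertex) (n : ℕ)
    (h : ∀ j < n, nearBonds (d.1.natAbs + d.2.natAbs + 1) (p + j • d) ⊆ L) :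
    Conn k L p (p + n • d) := by
  induction n with
  | zero => simpa using Conn.refl k L p
  | succ n ih =>
    refine (ih fun j hj => h j (by omega)).trans ?_
    have := (conn_near k (p + n • d) d).mono (h n (by omega))
    rwa [add_assoc, ← succ_nsmul] at this

/-! ### Translation by half a diagonal and the parity of crossings. -/

/-- The translation of the dual lattice to the lattice by `(-1/2, -1/2)`, as a map of the bonds. -/
def shift : Bond ≃ Bond where
  toFun b := if b.2 then ((b.1.1 - 1, b.1.2), false) else ((b.1.1, b.1.2 - 1), true)
  invFun b := if b.2 then ((b.1.1, b.1.2 + 1), false) else ((b.1.1 + 1, b.1.2), true)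
  left_inv := by rintro ⟨⟨i, j⟩, b⟩; cases b <;> simp
  right_inv := by rintro ⟨⟨i, j⟩, b⟩; cases b <;> simp

/-- The translated chain. -/
noncomputable def shiftChain (x : Chain) : Chain := Finsupp.equivMapDomain shift x

theorem shiftChain_apply (x : Chain) (b : Bond) : shiftChain x b = x (shift.symm b) := rfl

theorem shiftChain_add (x y : Chain) : shiftChain (x + y) = shiftChain x + shiftChain y := by
  ext b; rfl

/-- The centre of the plaquette `p` is moved to the lattice point `p`, and its four sides to the
star of `p`. -/
theorem bdry_shift (x : Bond → ZMod 2) (p : Vertex) :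
    bdry .Z (fun b => x (shift.symm b)) p = bdry .X x p := by
  simp only [bdry_X, bdry_Z, shift, Equiv.coe_fn_symm_mk, if_true, Bool.false_eq_true, if_false,
    sub_add_cancel]
  ring

theorem IsTransport.shift {L L' : Set Bond} {x y : Bond → ZMod 2} {F : ℕ → Chain}
    (h : IsTransport .X L x y F) (hL : ∀ b ∈ L, shift b ∈ L') :
    IsTransport .Z L' (fun b => x (ToricCode.shift.symm b)) (fun b => y (ToricCode.shift.symm b))
      (fun n => shiftChain (F n)) where
  mem n b hb := by
    rw [shiftChain_apply]
    refine h.mem n _ fun h' => hb ?_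
    simpa using hL _ h'
  bdry_eq n p := (bdry_shift (F n) p).trans ((h.bdry_eq n p).trans (bdry_shift (F 0) p).symm)
  lim b := h.lim _

/-- The coefficient `a` records whether the string of a type is present, so that `X`, `Z` and `Y`
are treated at once. -/
theorem IsTransport.smul {k : PauliType} {L : Set Bond} {x y : Bond → ZMod 2} {F : ℕ → Chain}
    (h : IsTransport k L x y F) (a : ZMod 2) :
    IsTransport k L (a • x) (a • y) (fun n => a • F n) := by
  rcases zmod_two_cases a with rfl | rfl
  · simpa using isTransport_zero k L
  · simpa using h

theorem pair_smul_smul (x : Chain) (y : Bond → ZMod 2) (a c : ZMod 2) :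
    pair (a • x) (c • y) = a * c * pair x y := by
  rcases zmod_two_cases a with rfl | rfl <;> rcases zmod_two_cases c with rfl | rfl
  · simp [pair]
  · simp [pair]
  · simp only [zero_smul, one_smul, mul_zero, zero_mul]
    simp [pair]
  · simp

/-- The sum of the values of a function at the two sites of a bond of type `X`. -/
def siteSum (T : Vertex → ZMod 2) (b : Bond) : ZMod 2 :=
  T b.1 + if b.2 then T (b.1.1 - 1, b.1.2) else T (b.1.1, b.1.2 - 1)

/-- Summation by parts: `siteSum T` is the coboundary of `T`, so pairing it with a chain evaluates
`T` on the boundary. -/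
theorem pair_siteSum (T : Vertex → ZMod 2) (y : Chain) {p q : Vertex}
    (hy : ∀ r, bdry .X y r = pt p r + pt q r) : pair y (siteSum T) = T p + T q := by
  let S : Bond → (Vertex →₀ ZMod 2) := fun b =>
    Finsupp.single b.1 1 + if b.2 then Finsupp.single (b.1.1 - 1, b.1.2) 1
      else Finsupp.single (b.1.1, b.1.2 - 1) 1
  have h1 : ∀ y : Chain, pair y (siteSum T) =
      Finsupp.linearCombination (ZMod 2) T (Finsupp.linearCombination (ZMod 2) S y) := by
    intro y
    induction y using chain_induction with
    | h0 => simp [pair]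
    | h1 b x ih =>
      rw [pair, map_add, map_add, map_add, ← ih, pair]
      congr 1
      simp only [Finsupp.linearCombination_single, S, siteSum, one_smul, map_add]
      split_ifs <;> simp
  have h2 : ∀ (y : Chain) r, Finsupp.linearCombination (ZMod 2) S y r = bdry .X y r := by
    intro y r
    induction y using chain_induction with
    | h0 => simpa using (bdry_zero .X r).symm
    | h1 b x ih =>
      rw [map_add, Finsupp.add_apply, ih, Finsupp.coe_add, bdry_add]
      congr 1
      obtain ⟨⟨i, j⟩, c⟩ := b
      obtain ⟨m, n⟩ := r
      cases c
      · have e : (((i, j), false) : Bond) = vBond .X (i, j - 1) := by simp [vBond]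
        rw [e, bdry_vBond, ← e]
        simp only [S, Finsupp.linearCombination_single, one_smul, Bool.false_eq_true, if_false,
          Finsupp.add_apply, single_eq_pt, Prod.mk_add_mk, add_zero, sub_add_cancel]
        exact add_comm _ _
      · have e : (((i, j), true) : Bond) = hBond .X (i - 1, j) := by simp [hBond]
        rw [e, bdry_hBond, ← e]
        simp only [S, Finsupp.linearCombination_single, one_smul, if_true,
          Finsupp.add_apply, single_eq_pt, Prod.mk_add_mk, add_zero, sub_add_cancel]
        exact add_comm _ _
  have h3 : Finsupp.linearCombination (ZMod 2) S y = Finsupp.single p 1 + Finsupp.single q 1 := by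
    ext r
    rw [h2, hy, Finsupp.add_apply, single_eq_pt, single_eq_pt]
  rw [h1, h3]
  simp

/-- The symmetrized intersection form of a chain with the translate of another one depends only on
the chains near the boundaries. -/
theorem pair_shift_add_pair_shift (x : Bond → ZMod 2) (y : Chain) {p q : Vertex}
    (hx : ∀ r, bdry .X x r = pt p r) (hy : ∀ r, bdry .X y r = pt p r + pt q r) :
    pair y (fun b => x (shift.symm b)) + pair (shiftChain y) x =
      y (p, false) + y ((p.1 + 1, p.2), true) +
      (x ((p.1, p.2 + 1), false) + x (p, true)) + (x ((q.1, q.2 + 1), false) + x (q, true)) := by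
  -- `T r` adds the values of `x` on the upper and left sides of the plaquette `r`. As `x` has
  -- boundary `p` alone, the values of `x` on the two translates of a bond sum to the coboundary of
  -- `T` there, corrected by `1` on the lower and right sides of `p`. By linearity it suffices to
  -- check this on a single bond.
  let T : Vertex → ZMod 2 := fun r => x ((r.1, r.2 + 1), false) + x (r, true)
  have h1 : ∀ y : Chain, pair y (fun b => x (shift.symm b)) + pair (shiftChain y) x =
      y (p, false) + y ((p.1 + 1, p.2), true) + pair y (siteSum T) := by
    intro y
    have hadd : ∀ u v w, pair (u + v) w = pair u w + pair v w := fun u v w => map_add _ u v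
    induction y using chain_induction with
    | h0 => simp [pair, shiftChain]
    | h1 b z ih =>
      have h2 : pair (Finsupp.single b 1) (fun b => x (shift.symm b)) +
          pair (shiftChain (Finsupp.single b 1)) x =
          (Finsupp.single b 1 : Chain) (p, false) + (Finsupp.single b 1 : Chain) ((p.1 + 1, p.2), true) +
          pair (Finsupp.single b 1) (siteSum T) := by
        have h3 : shiftChain (Finsupp.single b 1) = Finsupp.single (shift b) 1 :=
          Finsupp.equivMapDomain_single _ _ _
        rw [h3]
        simp only [pair, Finsupp.linearCombination_single, one_smul]
        obtain ⟨⟨i, j⟩, c⟩ := b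
        obtain ⟨m, n⟩ := p
        cases c
        · have h4 := hx (i, j)
          rw [bdry_X] at h4
          have h5 : (Finsupp.single ((i, j), false) 1 : Chain) ((m, n), false) = pt (m, n) (i, j) := by
            simp [pt, Finsupp.single_apply]
          have h6 : (Finsupp.single ((i, j), false) 1 : Chain) ((m + 1, n), true) = 0 := by
            simp
          rw [h5, h6, ← h4]
          simp only [shift, Equiv.coe_fn_symm_mk, Equiv.coe_fn_mk, Bool.false_eq_true, if_false,
            siteSum, T, sub_add_cancel]
          linear_combination -zmod_two_add_self (x ((i, j), false)) -
            zmod_two_add_self (x ((i, j), true)) - zmod_two_add_self (x ((i, j + 1), false))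
        · have h4 := hx (i - 1, j)
          rw [bdry_X] at h4
          have h5 : (Finsupp.single ((i, j), true) 1 : Chain) ((m + 1, n), true) =
              pt (m, n) (i - 1, j) := by
            simp only [pt, Finsupp.single_apply, Prod.mk.injEq, and_true]
            have : (i = m + 1 ∧ j = n) ↔ (i - 1 = m ∧ j = n) := by omega
            simp only [this]
          have h6 : (Finsupp.single ((i, j), true) 1 : Chain) ((m, n), false) = 0 := by
            simp
          rw [h5, h6, ← h4]
          simp only [shift, Equiv.coe_fn_symm_mk, Equiv.coe_fn_mk, if_true,
            siteSum, T, sub_add_cancel]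
          linear_combination -zmod_two_add_self (x ((i, j), true)) -
            zmod_two_add_self (x ((i - 1, j), true)) - zmod_two_add_self (x ((i - 1, j + 1), false))
      rw [shiftChain_add, hadd, hadd, hadd, Finsupp.add_apply, Finsupp.add_apply]
      linear_combination ih + h2
  rw [h1, pair_siteSum T y hy]
  ring

end ToricCode

namespace ToricCode

/-! ### Wedges in the plane -/

/-- A lattice point as a point of the plane. -/
def toPlane (v : Vertex) : ℝ × ℝ := ((v.1 : ℝ), (v.2 : ℝ))

/-- A linear functional on the plane, as an additive map on the lattice points. -/
def lin (f : ℝ × ℝ →ₗ[ℝ] ℝ) : Vertex →+ ℝ where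
  toFun v := f (toPlane v)
  map_zero' := by
    have : toPlane 0 = 0 := by ext <;> simp [toPlane]
    rw [this, map_zero]
  map_add' v w := by
    have : toPlane (v + w) = toPlane v + toPlane w := by ext <;> simp [toPlane]
    rw [this, map_add]

/-- The norm of a linear functional dual to the supremum norm. -/
def nrm (f : ℝ × ℝ →ₗ[ℝ] ℝ) : ℝ := |lin f (1, 0)| + |lin f (0, 1)|

theorem nrm_nonneg (f : ℝ × ℝ →ₗ[ℝ] ℝ) : 0 ≤ nrm f := by unfold nrm; positivity

theorem lin_apply (f : ℝ × ℝ →ₗ[ℝ] ℝ) (v : Vertex) : lin f v = f (toPlane v) := rfl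

theorem map_eq_coordinates (f : ℝ × ℝ →ₗ[ℝ] ℝ) (q : ℝ × ℝ) :
    f q = q.1 * lin f (1, 0) + q.2 * lin f (0, 1) := by
  have h : q = q.1 • toPlane (1, 0) + q.2 • toPlane (0, 1) := by
    ext <;> simp [toPlane]
  conv_lhs => rw [h]
  simp [lin_apply]

theorem abs_map_le (f : ℝ × ℝ →ₗ[ℝ] ℝ) {q : ℝ × ℝ} {R : ℝ} (h1 : |q.1| ≤ R) (h2 : |q.2| ≤ R) :
    |f q| ≤ nrm f * R := by
  rw [map_eq_coordinates f q, nrm, add_mul]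
  refine (abs_add_le _ _).trans (add_le_add ?_ ?_)
  · rw [abs_mul, mul_comm]; gcongr
  · rw [abs_mul, mul_comm]; gcongr

theorem abs_lin_le (f : ℝ × ℝ →ₗ[ℝ] ℝ) {v : Vertex} {R : ℕ} (h1 : |v.1| ≤ R) (h2 : |v.2| ≤ R) :
    |lin f v| ≤ nrm f * R := by
  refine abs_map_le f (q := toPlane v) ?_ ?_
  · simp only [toPlane]; exact_mod_cast h1
  · simp only [toPlane]; exact_mod_cast h2

/-- The second end point of a bond. -/
def bondEnd (b : Bond) : Vertex := if b.2 then b.1 + (0, 1) else b.1 + (1, 0)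

theorem bondSegment_eq (b : Bond) : bondSegment b = segment ℝ (toPlane b.1) (toPlane (bondEnd b)) := by
  obtain ⟨⟨i, j⟩, c⟩ := b
  cases c <;> simp [bondSegment, toPlane, bondEnd]

theorem abs_lin_bondEnd_sub_le (f : ℝ × ℝ →ₗ[ℝ] ℝ) (b : Bond) :
    |lin f (bondEnd b) - lin f b.1| ≤ nrm f := by
  unfold bondEnd nrm
  split_ifs
  · rw [map_add, add_sub_cancel_left]; linarith [abs_nonneg (lin f (1, 0))]
  · rw [map_add, add_sub_cancel_left]; linarith [abs_nonneg (lin f (0, 1))]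

/-- `K` consists of the bonds that meet the set where `f (q - a)` and `g (q - a)` are nonnegative. -/
def IsWedge (K : Set Bond) (a : Vertex) (f g : ℝ × ℝ →ₗ[ℝ] ℝ) : Prop :=
  ∀ b, b ∈ K ↔ ∃ q ∈ bondSegment b, 0 ≤ f (q - toPlane a) ∧ 0 ≤ g (q - toPlane a)

section Wedge

variable {K : Set Bond} {a : Vertex} {f g : ℝ × ℝ →ₗ[ℝ] ℝ}

theorem IsWedge.swap (h : IsWedge K a f g) : IsWedge K a g f := fun b => by
  rw [h b]; simp only [and_comm]

/-- `c` is an end point of the bond `b`. -/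
def IsEnd (c : Vertex) (b : Bond) : Prop := c = b.1 ∨ c = bondEnd b

theorem IsEnd.abs_lin_sub_le {c : Vertex} {b : Bond} (h : IsEnd c b) (f : ℝ × ℝ →ₗ[ℝ] ℝ) :
    |lin f c - lin f b.1| ≤ nrm f := by
  rcases h with rfl | rfl
  · simpa using nrm_nonneg f
  · exact abs_lin_bondEnd_sub_le f b

theorem IsWedge.mem_of_isEnd (h : IsWedge K a f g) {c : Vertex} {b : Bond} (hc : IsEnd c b)
    (hf : lin f a ≤ lin f c) (hg : lin g a ≤ lin g c) : b ∈ K := by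
  refine (h b).2 ⟨toPlane c, ?_, ?_, ?_⟩
  · rw [bondSegment_eq]
    rcases hc with rfl | rfl
    · exact left_mem_segment _ _ _
    · exact right_mem_segment _ _ _
  · rw [map_sub]; exact sub_nonneg.2 hf
  · rw [map_sub]; exact sub_nonneg.2 hg

/-- An affine function on a segment is largest at an end point. Only one functional is controlled:
the good end points for `f` and for `g` may differ. -/
theorem IsWedge.exists_isEnd (h : IsWedge K a f g) {b : Bond} (hb : b ∈ K) :
    ∃ c, IsEnd c b ∧ lin f a ≤ lin f c := by
  obtain ⟨q, hq, hf, -⟩ := (h b).1 hb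
  rw [bondSegment_eq] at hq
  obtain ⟨s, t, hs, ht, hst, rfl⟩ := hq
  rw [map_sub, map_add, map_smul, map_smul] at hf
  by_contra hcon
  have h1 : lin f b.1 < lin f a := not_le.1 fun h => hcon ⟨_, Or.inl rfl, h⟩
  have h2 : lin f (bondEnd b) < lin f a := not_le.1 fun h => hcon ⟨_, Or.inr rfl, h⟩
  simp only [lin_apply] at h1 h2
  simp only [smul_eq_mul] at hf
  have h3 : s * (f (toPlane b.1) - f (toPlane a)) + t * (f (toPlane (bondEnd b)) - f (toPlane a)) ≥ 0 := by
    have : t = 1 - s := by linarith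
    subst this
    linarith
  rcases hs.eq_or_lt with rfl | hs
  · have : t = 1 := by linarith
    subst this
    linarith
  · nlinarith [mul_pos hs (sub_pos.2 h1), mul_nonneg ht (sub_pos.2 h2).le]

theorem IsWedge.le_of_mem (h : IsWedge K a f g) {b : Bond} (hb : b ∈ K) :
    lin f a - nrm f ≤ lin f b.1 := by
  obtain ⟨c, hc, hf⟩ := h.exists_isEnd hb
  have := (abs_le.1 (hc.abs_lin_sub_le f)).2
  linarith

theorem lin_le_of_mem_nearBonds (f : ℝ × ℝ →ₗ[ℝ] ℝ) {R : ℕ} {p : Vertex} {b : Bond}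
    (hb : b ∈ nearBonds R p) : |lin f b.1 - lin f p| ≤ nrm f * R := by
  rw [← map_sub]
  exact abs_lin_le f hb.1 hb.2

/-- All bonds near a lattice point deep in the wedge belong to it. -/
theorem IsWedge.nearBonds_subset (h : IsWedge K a f g) {R : ℕ} {p : Vertex}
    (hf : lin f a + nrm f * R ≤ lin f p) (hg : lin g a + nrm g * R ≤ lin g p) :
    nearBonds R p ⊆ K := by
  intro b hb
  have h1 := (abs_le.1 (lin_le_of_mem_nearBonds f hb)).1
  have h2 := (abs_le.1 (lin_le_of_mem_nearBonds g hb)).1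
  exact h.mem_of_isEnd (Or.inl rfl) (by linarith) (by linarith)

/-- The part of the wedge where `f + g` is large. -/
def farBonds (K : Set Bond) (f g : ℝ × ℝ →ₗ[ℝ] ℝ) (B : ℝ) : Set Bond :=
  {b | b ∈ K ∧ B ≤ lin f b.1 + lin g b.1}

/-- A point deep in the wedge is connected to any ray in an interior direction. -/
theorem IsWedge.exists_conn_of_deep (h : IsWedge K a f g) (k : PauliType) {d : Vertex} (hf : 0 < lin f d)
    (hg : 0 < lin g d) : ∃ m₀ : ℝ, ∀ (B : ℝ) (s t : Vertex), lin f a + m₀ ≤ lin f s →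
      lin g a + m₀ ≤ lin g s → B + m₀ ≤ lin f s + lin g s →
      ∃ N : ℕ, ∀ n ≥ N, Conn k (farBonds K f g B) s (t + n • d) := by
  set R : ℕ := d.1.natAbs + d.2.natAbs + 1 with hR
  have hnf := nrm_nonneg f
  have hng := nrm_nonneg g
  -- With this margin a whole `R`-neighbourhood of `s` lies in the far part of the wedge, and moving
  -- along `d` only goes deeper.
  refine ⟨(nrm f + nrm g) * R, fun B s t h1 h2 h3 => ?_⟩
  set R' : ℕ := (t - s).1.natAbs + (t - s).2.natAbs + 1 with hR'
  have hprog : ∀ j : ℕ, nearBonds R (s + j • d) ⊆ farBonds K f g B := by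
    intro j b hb
    have hjf : 0 ≤ (j : ℝ) * lin f d := by positivity
    have hjg : 0 ≤ (j : ℝ) * lin g d := by positivity
    have e1 : lin f (s + j • d) = lin f s + j * lin f d := by rw [map_add, map_nsmul, nsmul_eq_mul]
    have e2 : lin g (s + j • d) = lin g s + j * lin g d := by rw [map_add, map_nsmul, nsmul_eq_mul]
    have e3 : 0 ≤ nrm f * R := by positivity
    have e4 : 0 ≤ nrm g * R := by positivity
    refine ⟨h.nearBonds_subset (R := R) ?_ ?_ hb, ?_⟩
    · rw [e1]; linarith
    · rw [e2]; linarith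
    · have h4 := (abs_le.1 (lin_le_of_mem_nearBonds f hb)).1
      have h5 := (abs_le.1 (lin_le_of_mem_nearBonds g hb)).1
      rw [e1] at h4
      rw [e2] at h5
      linarith
  -- After this many steps the depth exceeds the length `R'` of the detour from the progression
  -- through `s` to the one through `t`.
  obtain ⟨N1, hN1⟩ := exists_nat_gt ((nrm f * R') / lin f d)
  obtain ⟨N2, hN2⟩ := exists_nat_gt ((nrm g * R') / lin g d)
  rw [div_lt_iff₀ hf] at hN1
  rw [div_lt_iff₀ hg] at hN2
  refine ⟨max N1 N2, fun n hn => ?_⟩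
  have hn1 : (N1 : ℝ) ≤ n := by exact_mod_cast (le_max_left _ _).trans hn
  have hn2 : (N2 : ℝ) ≤ n := by exact_mod_cast (le_max_right _ _).trans hn
  have hm1 := mul_le_mul_of_nonneg_right hn1 hf.le
  have hm2 := mul_le_mul_of_nonneg_right hn2 hg.le
  refine (conn_progression s d n fun j _ => hprog j).trans ?_
  have h4 := conn_near k (s + n • d) (t - s)
  have e : s + n • d + (t - s) = t + n • d := by abel
  rw [e] at h4
  refine h4.mono fun b hb => ?_
  have e1 : lin f (s + n • d) = lin f s + n * lin f d := by rw [map_add, map_nsmul, nsmul_eq_mul]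
  have e2 : lin g (s + n • d) = lin g s + n * lin g d := by rw [map_add, map_nsmul, nsmul_eq_mul]
  have e3 : 0 ≤ (nrm f + nrm g) * R := by positivity
  refine ⟨h.nearBonds_subset (R := R') ?_ ?_ hb, ?_⟩
  · rw [e1]; linarith
  · rw [e2]; linarith
  · have h5 := (abs_le.1 (lin_le_of_mem_nearBonds (R := R') f hb)).1
    have h6 := (abs_le.1 (lin_le_of_mem_nearBonds (R := R') g hb)).1
    rw [e1] at h5
    rw [e2] at h6
    linarith

/-! ### Walking from the sides of a wedge into its depth. -/

/-- The lattice points at a site: the point itself (on the lattice), or the corners of the plaquette. -/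
def IsCorner : PauliType → Vertex → Vertex → Prop
  | .X, s, c => (c.1 = s.1 ∨ c.1 = s.1 + 1) ∧ (c.2 = s.2 ∨ c.2 = s.2 + 1)
  | .Z, s, c => c = s

theorem IsCorner.abs_lin_sub_le {k : PauliType} {s c : Vertex} (h : IsCorner k s c)
    (f : ℝ × ℝ →ₗ[ℝ] ℝ) : |lin f c - lin f s| ≤ nrm f := by
  rw [← map_sub]
  have := abs_lin_le f (v := c - s) (R := 1) ?_ ?_
  · simpa using this
  · cases k
    · obtain ⟨h1, -⟩ := h
      rw [Prod.fst_sub, abs_le]; push_cast; omega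
    · rw [show c = s from h]; simp
  · cases k
    · obtain ⟨-, h1⟩ := h
      rw [Prod.snd_sub, abs_le]; push_cast; omega
    · rw [show c = s from h]; simp

theorem IsCorner.add {k : PauliType} {s c : Vertex} (h : IsCorner k s c) (e : Vertex) :
    IsCorner k (s + e) (c + e) := by
  cases k
  · obtain ⟨h1, h2⟩ := h
    simp only [IsCorner, Prod.fst_add, Prod.snd_add]
    omega
  · rw [show c = s from h]; rfl

/-- The unit steps on the lattice. -/
def IsUnitStep (e : Vertex) : Prop := e = (1, 0) ∨ e = (-1, 0) ∨ e = (0, 1) ∨ e = (0, -1)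

/-- Otherwise `f` would vanish on both coordinate vectors, hence everywhere. -/
theorem exists_unitStep {d : Vertex} (hf : 0 < lin f d) : ∃ e, IsUnitStep e ∧ 0 < lin f e := by
  by_contra hcon
  have h : ∀ e, IsUnitStep e → lin f e ≤ 0 := fun e he => not_lt.1 fun h => hcon ⟨e, he, h⟩
  have h1 := h (1, 0) (Or.inl rfl)
  have h2 := h (-(1, 0)) (Or.inr (Or.inl rfl))
  have h3 := h (0, 1) (Or.inr (Or.inr (Or.inl rfl)))
  have h4 := h (-(0, 1)) (Or.inr (Or.inr (Or.inr rfl)))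
  rw [map_neg] at h2 h4
  rw [lin_apply, map_eq_coordinates f (toPlane d), le_antisymm h1 (by linarith),
    le_antisymm h3 (by linarith)] at hf
  simp at hf

theorem abs_lin_unitStep_le {e : Vertex} (he : IsUnitStep e) (f : ℝ × ℝ →ₗ[ℝ] ℝ) :
    |lin f e| ≤ nrm f := by
  have := abs_lin_le f (v := e) (R := 1) ?_ ?_
  · simpa using this
  · rcases he with rfl | rfl | rfl | rfl <;> simp
  · rcases he with rfl | rfl | rfl | rfl <;> simp

/-- The bond of a unit step contains a corner of the first site or its translate. -/
theorem exists_bond_unitStep (k : PauliType) {s e : Vertex} (he : IsUnitStep e) :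
    ∃ b, (∀ r, bdry k (Finsupp.single b (1 : ZMod 2)) r = pt s r + pt (s + e) r) ∧
      ∀ c, IsCorner k s c → IsEnd c b ∨ IsEnd (c + e) b := by
  rcases he with rfl | rfl | rfl | rfl
  · refine ⟨hBond k s, bdry_hBond k s, fun c hc => ?_⟩
    obtain ⟨i, j⟩ := s
    obtain ⟨m, n⟩ := c
    cases k <;> simp [IsCorner, IsEnd, hBond, bondEnd] at hc ⊢ <;> omega
  · refine ⟨hBond k (s + (-1, 0)), fun r => ?_, fun c hc => ?_⟩
    · have e : s + (-1, 0) + (1, 0) = s := by ext <;> simp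
      rw [bdry_hBond, e, add_comm]
    · obtain ⟨i, j⟩ := s
      obtain ⟨m, n⟩ := c
      cases k <;> simp [IsCorner, IsEnd, hBond, bondEnd] at hc ⊢ <;> omega
  · refine ⟨vBond k s, bdry_vBond k s, fun c hc => ?_⟩
    obtain ⟨i, j⟩ := s
    obtain ⟨m, n⟩ := c
    cases k <;> simp [IsCorner, IsEnd, vBond, bondEnd] at hc ⊢ <;> omega
  · refine ⟨vBond k (s + (0, -1)), fun r => ?_, fun c hc => ?_⟩
    · have e : s + (0, -1) + (0, 1) = s := by ext <;> simp
      rw [bdry_vBond, e, add_comm]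
    · obtain ⟨i, j⟩ := s
      obtain ⟨m, n⟩ := c
      cases k <;> simp [IsCorner, IsEnd, vBond, bondEnd] at hc ⊢ <;> omega

/-- From a site at one side of the wedge, far from the other side, one can walk into the depth. -/
theorem IsWedge.exists_conn_deep (h : IsWedge K a f g) (k : PauliType) {d : Vertex} (hf : 0 < lin f d)
    (m₀ : ℝ) : ∃ m₁ : ℝ, ∀ (B : ℝ) (s c : Vertex), IsCorner k s c → lin f a ≤ lin f c →
      lin g a + m₁ ≤ lin g c → B + m₁ ≤ lin f c + lin g c →
      ∃ s', Conn k (farBonds K f g B) s s' ∧ lin f a + m₀ ≤ lin f s' ∧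
        lin g a + m₀ ≤ lin g s' ∧ B + m₀ ≤ lin f s' + lin g s' := by
  have hnf := nrm_nonneg f
  have hng := nrm_nonneg g
  obtain ⟨e, he, hfe⟩ := exists_unitStep hf
  -- After `I` unit steps `f` has grown by more than `m₀ + nrm f` at the corner; the term `nrm f` is
  -- lost on passing from the corner to the site.
  obtain ⟨I, hI⟩ := exists_nat_gt ((m₀ + nrm f) / lin f e)
  rw [div_lt_iff₀ hfe] at hI
  -- Each step may lower `g` by `nrm g`. The two additional norms pay for passing between corners,
  -- sites and base points of bonds.
  refine ⟨(nrm f + nrm g) * (I + 2) + |m₀|, fun B s c hc h1 h2 h3 => ?_⟩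
  have hm : m₀ ≤ |m₀| := le_abs_self _
  have hm' : 0 ≤ |m₀| := abs_nonneg _
  have hge := abs_lin_unitStep_le he g
  have hval : ∀ i : ℕ, i ≤ I → lin f c ≤ lin f (c + i • e) ∧
      lin g c - nrm g * I ≤ lin g (c + i • e) := by
    intro i hi
    have hi' : (i : ℝ) ≤ I := by exact_mod_cast hi
    rw [map_add, map_add, map_nsmul, map_nsmul, nsmul_eq_mul, nsmul_eq_mul]
    constructor
    · have : 0 ≤ (i : ℝ) * lin f e := by positivity
      linarith
    · have h5 : |(i : ℝ) * lin g e| ≤ nrm g * I := by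
        rw [abs_mul, Nat.abs_cast, mul_comm (nrm g)]
        gcongr
      have := (abs_le.1 h5).1
      linarith
  have hpos : 0 ≤ nrm f * I := by positivity
  have hexp : (nrm f + nrm g) * ((I : ℝ) + 2) = nrm f * I + nrm g * I + 2 * nrm f + 2 * nrm g := by ring
  rw [hexp] at h2 h3
  have hconn : ∀ i : ℕ, i ≤ I → Conn k (farBonds K f g B) s (s + i • e) := by
    intro i
    induction i with
    | zero => intro _; simpa using Conn.refl k _ s
    | succ i ih =>
      intro hi
      refine (ih (by omega)).trans ?_
      obtain ⟨b, hb, hbc⟩ := exists_bond_unitStep k (s := s + i • e) he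
      have e1 : s + (i + 1) • e = s + i • e + e := by rw [succ_nsmul, add_assoc]
      have e2 : c + (i + 1) • e = c + i • e + e := by rw [succ_nsmul, add_assoc]
      rw [e1]
      refine ⟨_, joins_single ?_ hb⟩
      obtain ⟨j, hj, hjb⟩ : ∃ j ≤ I, IsEnd (c + j • e) b := by
        rcases hbc _ (hc.add (i • e)) with h5 | h5
        · exact ⟨i, by omega, h5⟩
        · exact ⟨i + 1, hi, by rwa [e2]⟩
      obtain ⟨h6, h7⟩ := hval j hj
      refine ⟨h.mem_of_isEnd hjb (by linarith) (by linarith), ?_⟩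
      have h8 := (abs_le.1 (hjb.abs_lin_sub_le f)).2
      have h9 := (abs_le.1 (hjb.abs_lin_sub_le g)).2
      linarith
  refine ⟨s + I • e, hconn I le_rfl, ?_⟩
  have hcI := hc.add (I • e)
  have h4 := (abs_le.1 (hcI.abs_lin_sub_le f)).2
  have h5 := (abs_le.1 (hcI.abs_lin_sub_le g)).2
  obtain ⟨h6, h7⟩ := hval I le_rfl
  have h8 : lin f (c + I • e) = lin f c + I * lin f e := by rw [map_add, map_nsmul, nsmul_eq_mul]
  refine ⟨by linarith, by linarith, by linarith⟩

theorem bond_cases {k : PauliType} {s t : Vertex} {b : Bond} (hne : s ≠ t) (hs : b ∈ siteBonds k s)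
    (ht : b ∈ siteBonds k t) :
    (b = hBond k s ∧ t = s + (1, 0)) ∨ (b = hBond k t ∧ s = t + (1, 0)) ∨
    (b = vBond k s ∧ t = s + (0, 1)) ∨ (b = vBond k t ∧ s = t + (0, 1)) := by
  obtain ⟨⟨p, q⟩, c⟩ := b
  obtain ⟨i, j⟩ := s
  obtain ⟨m, n⟩ := t
  cases k <;> cases c <;>
    simp [siteBonds, plaqBonds, starBonds, hBond, vBond] at hne hs ht ⊢ <;> omega

theorem bdry_single_of_step {k : PauliType} {s t : Vertex} {b : Bond} (hne : s ≠ t)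
    (hs : b ∈ siteBonds k s) (ht : b ∈ siteBonds k t) (r : Vertex) :
    bdry k (Finsupp.single b (1 : ZMod 2)) r = pt s r + pt t r := by
  rcases bond_cases hne hs ht with ⟨rfl, rfl⟩ | ⟨rfl, rfl⟩ | ⟨rfl, rfl⟩ | ⟨rfl, rfl⟩
  · exact bdry_hBond k s r
  · rw [bdry_hBond, add_comm]
  · exact bdry_vBond k s r
  · rw [bdry_vBond, add_comm]

theorem isCorner_of_isEnd {k : PauliType} {s t c : Vertex} {b : Bond} (hne : s ≠ t)
    (hs : b ∈ siteBonds k s) (ht : b ∈ siteBonds k t) (hc : IsEnd c b) :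
    IsCorner k s c ∨ IsCorner k t c := by
  obtain ⟨i, j⟩ := s
  obtain ⟨m, n⟩ := t
  obtain ⟨p, q⟩ := c
  rcases bond_cases hne hs ht with ⟨rfl, h⟩ | ⟨rfl, h⟩ | ⟨rfl, h⟩ | ⟨rfl, h⟩ <;>
    cases k <;> simp [IsCorner, IsEnd, hBond, vBond, bondEnd] at hc h ⊢ <;> omega

/-- The bonds of a wedge with independent functionals leave every region bounded with respect to
`f + g`. -/
theorem IsWedge.finite_not_far (h : IsWedge K a f g)
    (hfin : ∀ B : ℝ, {v : Vertex | |lin f v| ≤ B ∧ |lin g v| ≤ B}.Finite) (B : ℝ) :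
    {b | b ∈ K ∧ lin f b.1 + lin g b.1 < B}.Finite := by
  -- On the wedge both functionals are bounded below, so an upper bound on their sum bounds each of
  -- them.
  set B' : ℝ := |B| + |lin f a| + |lin g a| + nrm f + nrm g
  have h1 : {b : Bond | b ∈ K ∧ lin f b.1 + lin g b.1 < B} ⊆
      {v : Vertex | |lin f v| ≤ B' ∧ |lin g v| ≤ B'} ×ˢ (Set.univ : Set Bool) := by
    rintro b ⟨hb, hB⟩
    have h2 := h.le_of_mem hb
    have h3 := h.swap.le_of_mem hb
    have h4 := neg_abs_le (lin f a)
    have h5 := neg_abs_le (lin g a)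
    have h6 := le_abs_self B
    have h7 := abs_nonneg B
    have h8 := abs_nonneg (lin f a)
    have h9 := abs_nonneg (lin g a)
    have hnf := nrm_nonneg f
    have hng := nrm_nonneg g
    refine ⟨⟨?_, ?_⟩, trivial⟩
    · rw [abs_le]; constructor <;> simp only [B'] <;> linarith
    · rw [abs_le]; constructor <;> simp only [B'] <;> linarith
  exact ((hfin B').prod Set.finite_univ).subset h1

/-- A path in a wedge is connected, far out in the wedge, to any ray in an interior direction. -/
theorem IsWedge.exists_conn_path (h : IsWedge K a f g)
    (hfin : ∀ B : ℝ, {v : Vertex | |lin f v| ≤ B ∧ |lin g v| ≤ B}.Finite) {k : PauliType}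
    (γ : InfPath k) (hγ : ∀ n, γ.bond n ∈ K) {d : Vertex} (hf : 0 < lin f d) (hg : 0 < lin g d)
    (t : Vertex) (B : ℝ) (n₀ : ℕ) : ∃ m ≥ n₀, ∃ n ≥ n₀,
      Conn k (farBonds K f g B) (γ.site m) (t + n • d) := by
  have hnf := nrm_nonneg f
  have hng := nrm_nonneg g
  obtain ⟨m₀, hm₀⟩ := h.exists_conn_of_deep k hf hg
  obtain ⟨m₁, hm₁⟩ := h.exists_conn_deep k hf m₀
  obtain ⟨m₂, hm₂⟩ := h.swap.exists_conn_deep k hg m₀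
  have hfar : ∀ s s', Conn k (farBonds K g f B) s s' → Conn k (farBonds K f g B) s s' :=
    fun s s' hs => hs.mono fun b hb => ⟨hb.1, by rw [add_comm]; exact hb.2⟩
  set T : ℝ := |m₁| + |m₂| + |B| + |lin f a| + |lin g a| + nrm f + nrm g
  have hT : {b | b ∈ K ∧ lin f b.1 + lin g b.1 < 2 * T}.Finite := h.finite_not_far hfin _
  -- The path uses no bond twice and only finitely many bonds of the wedge are not far out, so
  -- arbitrarily late bonds are far out.
  obtain ⟨m, hm, hmn⟩ : ∃ m ≥ n₀, γ.bond m ∉ {b | b ∈ K ∧ lin f b.1 + lin g b.1 < 2 * T} := by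
    have h1 := (hT.preimage γ.bond_injective.injOn).infinite_compl
    obtain ⟨m, hm, hm'⟩ := h1.exists_gt n₀
    exact ⟨m, hm'.le, hm⟩
  have hbig : 2 * T ≤ lin f (γ.bond m).1 + lin g (γ.bond m).1 := not_lt.1 fun h => hmn ⟨hγ m, h⟩
  obtain ⟨hne, hs, ht⟩ := γ.step m
  have habs := And.intro (le_abs_self m₁) (And.intro (le_abs_self m₂) (le_abs_self B))
  have habs2 := And.intro (abs_nonneg m₁) (And.intro (abs_nonneg m₂) (abs_nonneg B))
  have habs3 := And.intro (neg_abs_le (lin f a)) (neg_abs_le (lin g a))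
  have habs4 := And.intro (le_abs_self (lin f a)) (le_abs_self (lin g a))
  have habs5 := And.intro (abs_nonneg (lin f a)) (abs_nonneg (lin g a))
  have hcorner : ∀ c, IsEnd c (γ.bond m) → ∃ m' ≥ n₀, IsCorner k (γ.site m') c := by
    intro c hc
    rcases isCorner_of_isEnd hne hs ht hc with h1 | h1
    · exact ⟨m, hm, h1⟩
    · exact ⟨m + 1, by omega, h1⟩
  have hdeep : ∃ m' ≥ n₀, ∃ s', Conn k (farBonds K f g B) (γ.site m') s' ∧
      lin f a + m₀ ≤ lin f s' ∧ lin g a + m₀ ≤ lin g s' ∧ B + m₀ ≤ lin f s' + lin g s' := by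
    -- The larger functional is at least `T` on this bond, hence beyond all margins. The smaller one
    -- is at least its value at the apex at some end point, and the walk into the depth starts at
    -- the site that has this end point as a corner.
    rcases le_total (lin f (γ.bond m).1) (lin g (γ.bond m).1) with hle | hle
    · obtain ⟨c, hc, hfc⟩ := h.exists_isEnd (hγ m)
      obtain ⟨m', hm', hcm⟩ := hcorner c hc
      have h1 := (abs_le.1 (hc.abs_lin_sub_le g)).1
      obtain ⟨s', hs', h2, h3, h4⟩ := hm₁ B (γ.site m') c hcm hfc
        (by simp only [T] at hbig; linarith) (by simp only [T] at hbig; linarith)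
      exact ⟨m', hm', s', hs', h2, h3, h4⟩
    · obtain ⟨c, hc, hfc⟩ := h.swap.exists_isEnd (hγ m)
      obtain ⟨m', hm', hcm⟩ := hcorner c hc
      have h1 := (abs_le.1 (hc.abs_lin_sub_le f)).1
      obtain ⟨s', hs', h2, h3, h4⟩ := hm₂ B (γ.site m') c hcm hfc
        (by simp only [T] at hbig; linarith) (by simp only [T] at hbig; linarith)
      exact ⟨m', hm', s', hfar _ _ hs', h3, h2, by linarith⟩
  obtain ⟨m', hm', s', hs', h2, h3, h4⟩ := hdeep
  obtain ⟨N, hN⟩ := hm₀ B s' t h2 h3 h4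
  exact ⟨m', hm', max N n₀, le_max_right _ _, hs'.trans (hN _ (le_max_left _ _))⟩

end Wedge

end ToricCode

namespace ToricCode

/-! ### Cones as wedges -/

/-- The functional `v ↦ u × v`, nonnegative on the directions counter-clockwise from `u`. -/
noncomputable def Cone.fst (C : Cone) : ℝ × ℝ →ₗ[ℝ] ℝ :=
  C.u.1 • LinearMap.snd ℝ ℝ ℝ - C.u.2 • LinearMap.fst ℝ ℝ ℝ

/-- The functional `v ↦ v × w`, nonnegative on the directions clockwise from `w`. -/
noncomputable def Cone.snd (C : Cone) : ℝ × ℝ →ₗ[ℝ] ℝ :=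
  C.w.2 • LinearMap.fst ℝ ℝ ℝ - C.w.1 • LinearMap.snd ℝ ℝ ℝ

theorem Cone.fst_apply (C : Cone) (v : ℝ × ℝ) : C.fst v = C.u.1 * v.2 - C.u.2 * v.1 := rfl

theorem Cone.snd_apply (C : Cone) (v : ℝ × ℝ) : C.snd v = C.w.2 * v.1 - C.w.1 * v.2 := rfl

/-- Cramer's rule: in the basis `u`, `w` the coordinates of a vector are its values under `snd` and
`fst`, divided by the positive determinant. -/
theorem Cone.isWedge (C : Cone) : IsWedge C.bonds C.apex C.fst C.snd := by
  have hΔ := C.angle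
  have hne := hΔ.ne'
  have harea : ∀ q, q ∈ C.area ↔ 0 ≤ C.fst (q - toPlane C.apex) ∧ 0 ≤ C.snd (q - toPlane C.apex) := by
    intro q
    simp only [Cone.fst_apply, Cone.snd_apply, toPlane, Prod.fst_sub, Prod.snd_sub]
    constructor
    · rintro ⟨s, t, hs, ht, rfl⟩
      constructor
      · have := mul_nonneg ht hΔ.le
        simp only
        linarith
      · have := mul_nonneg hs hΔ.le
        simp only
        linarith
    · rintro ⟨h1, h2⟩
      refine ⟨_, _, div_nonneg h2 hΔ.le, div_nonneg h1 hΔ.le, ?_⟩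
      rw [mul_comm C.w.2, mul_comm C.w.1]
      generalize hD : C.u.1 * C.w.2 - C.u.2 * C.w.1 = Δ at hne
      ext
      · simp only
        field_simp
        rw [← hD]
        ring
      · simp only
        field_simp
        rw [← hD]
        ring
  intro b
  simp only [← harea]
  rfl

/-- The two functionals are independent, so bounds on them bound both coordinates of a lattice
point. -/
theorem Cone.finite_bounded (C : Cone) (B : ℝ) :
    {v : Vertex | |lin C.fst v| ≤ B ∧ |lin C.snd v| ≤ B}.Finite := by
  have hΔ := C.angle
  set Δ := C.u.1 * C.w.2 - C.u.2 * C.w.1 with hΔ'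
  have key : ∀ x y α β : ℝ, |x| ≤ B → |y| ≤ B → |(y * α + x * β) / Δ| ≤ B * (|α| + |β|) / Δ := by
    intro x y α β hx hy
    rw [abs_div, abs_of_pos hΔ]
    gcongr
    refine (abs_add_le _ _).trans ?_
    rw [abs_mul, abs_mul, mul_add]
    gcongr
  obtain ⟨N1, hN1⟩ := exists_nat_gt (B * (|C.u.1| + |C.w.1|) / Δ)
  obtain ⟨N2, hN2⟩ := exists_nat_gt (B * (|C.u.2| + |C.w.2|) / Δ)
  have hbox : (Set.Icc (-(N1 : ℤ)) N1 ×ˢ Set.Icc (-(N2 : ℤ)) N2).Finite :=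
    (Set.finite_Icc _ _).prod (Set.finite_Icc _ _)
  refine hbox.subset ?_
  rintro ⟨i, j⟩ ⟨h1, h2⟩
  rw [lin_apply] at h1 h2
  have e1 : (i : ℝ) = (C.snd (toPlane (i, j)) * C.u.1 + C.fst (toPlane (i, j)) * C.w.1) / Δ := by
    rw [eq_div_iff hΔ.ne']; simp only [Cone.fst_apply, Cone.snd_apply, toPlane, hΔ']; ring
  have e2 : (j : ℝ) = (C.snd (toPlane (i, j)) * C.u.2 + C.fst (toPlane (i, j)) * C.w.2) / Δ := by
    rw [eq_div_iff hΔ.ne']; simp only [Cone.fst_apply, Cone.snd_apply, toPlane, hΔ']; ring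
  have h3 := (key _ _ C.u.1 C.w.1 h1 h2).trans hN1.le
  have h4 := (key _ _ C.u.2 C.w.2 h1 h2).trans hN2.le
  rw [← e1] at h3
  rw [← e2] at h4
  have h5 : |i| ≤ N1 := by exact_mod_cast h3
  have h6 : |j| ≤ N2 := by exact_mod_cast h4
  exact ⟨abs_le.1 h5, abs_le.1 h6⟩

/-- The lattice vector `d` points to the interior of the cone. -/
def Cone.IsInner (C : Cone) (d : Vertex) : Prop := 0 < lin C.fst d ∧ 0 < lin C.snd d

/-- The vector `u + w` is interior. Rounding a large multiple of it to the lattice costs a bounded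
amount, while both functionals grow linearly. -/
theorem Cone.exists_isInner (C : Cone) : ∃ d, C.IsInner d := by
  have hΔ := C.angle
  have key : ∀ f : ℝ × ℝ →ₗ[ℝ] ℝ, 0 < f (C.u + C.w) → ∃ N : ℕ, ∀ n ≥ N,
      0 < lin f (⌊((n : ℝ) • (C.u + C.w)).1⌋, ⌊((n : ℝ) • (C.u + C.w)).2⌋) := by
    intro f hf
    obtain ⟨N, hN⟩ := exists_nat_gt (nrm f / f (C.u + C.w))
    rw [div_lt_iff₀ hf] at hN
    refine ⟨N, fun n hn => ?_⟩
    set z := (n : ℝ) • (C.u + C.w) with hz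
    have hn' : (N : ℝ) ≤ n := by exact_mod_cast hn
    have h1 : |f (z - toPlane (⌊z.1⌋, ⌊z.2⌋))| ≤ nrm f * 1 := by
      refine abs_map_le f ?_ ?_
      · simp only [toPlane, Prod.fst_sub]
        rw [abs_le]
        constructor <;> linarith [Int.floor_le z.1, Int.lt_floor_add_one z.1]
      · simp only [toPlane, Prod.snd_sub]
        rw [abs_le]
        constructor <;> linarith [Int.floor_le z.2, Int.lt_floor_add_one z.2]
    rw [map_sub, ← lin_apply, hz, map_smul, ← hz, smul_eq_mul] at h1
    have h2 := (abs_le.1 h1).2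
    have h3 := mul_le_mul_of_nonneg_right hn' hf.le
    linarith
  obtain ⟨N1, h1⟩ := key C.fst (by
    rw [Cone.fst_apply, Prod.fst_add, Prod.snd_add]; linarith)
  obtain ⟨N2, h2⟩ := key C.snd (by
    rw [Cone.snd_apply, Prod.fst_add, Prod.snd_add]; linarith)
  exact ⟨_, h1 _ (le_max_left N1 N2), h2 _ (le_max_right N1 N2)⟩

theorem Cone.translate_bonds_subset (C : Cone) {x y : Vertex} (hf : lin C.fst x ≤ lin C.fst y)
    (hg : lin C.snd x ≤ lin C.snd y) : (C.translate y).bonds ⊆ (C.translate x).bonds := by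
  intro b hb
  obtain ⟨q, hq, h1, h2⟩ := ((C.translate y).isWedge b).1 hb
  refine ((C.translate x).isWedge b).2 ⟨q, hq, ?_, ?_⟩
  · change 0 ≤ C.fst _ at h1
    change 0 ≤ C.fst _
    rw [map_sub, ← lin_apply] at h1 ⊢
    change 0 ≤ _ - lin C.fst (C.apex + y) at h1
    change 0 ≤ _ - lin C.fst (C.apex + x)
    rw [map_add] at h1 ⊢
    linarith
  · change 0 ≤ C.snd _ at h2
    change 0 ≤ C.snd _
    rw [map_sub, ← lin_apply] at h2 ⊢
    change 0 ≤ _ - lin C.snd (C.apex + y) at h2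
    change 0 ≤ _ - lin C.snd (C.apex + x)
    rw [map_add] at h2 ⊢
    linarith

theorem eventually_le_nsmul {f : ℝ × ℝ →ₗ[ℝ] ℝ} {d : Vertex} (hd : 0 < lin f d) (B : ℝ) :
    ∀ᶠ n : ℕ in atTop, B ≤ lin f (n • d) := by
  have h : Tendsto (fun n : ℕ => lin f (n • d)) atTop atTop := by
    simp_rw [map_nsmul]
    simp only [nsmul_eq_mul]
    exact tendsto_natCast_atTop_atTop.atTop_mul_const hd
  exact h.eventually_ge_atTop B

/-- Translating a cone along an interior direction shrinks it, and it finally leaves every bond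
behind. -/
theorem Cone.isExhausting (C : Cone) {d : Vertex} (hd : C.IsInner d) :
    IsExhausting (fun x => (C.translate x).bondsᶜ) (fun n => n • d) where
  mono m n hmn := by
    have hmn' : (m : ℝ) ≤ n := by exact_mod_cast hmn
    refine Set.compl_subset_compl.2 (C.translate_bonds_subset ?_ ?_)
    · rw [map_nsmul, map_nsmul, nsmul_eq_mul, nsmul_eq_mul]
      exact mul_le_mul_of_nonneg_right hmn' hd.1.le
    · rw [map_nsmul, map_nsmul, nsmul_eq_mul, nsmul_eq_mul]
      exact mul_le_mul_of_nonneg_right hmn' hd.2.le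
  cofinal x := by
    obtain ⟨n, h1, h2⟩ := ((eventually_le_nsmul hd.1 (lin C.fst x)).and
      (eventually_le_nsmul hd.2 (lin C.snd x))).exists
    exact ⟨n, Set.compl_subset_compl.2 (C.translate_bonds_subset h1 h2)⟩
  mem b := by
    obtain ⟨n, h1⟩ := (eventually_le_nsmul hd.1
      (lin C.fst b.1 + nrm C.fst - lin C.fst C.apex + 1)).exists
    refine ⟨n, fun hb => ?_⟩
    have h2 := (C.translate (n • d)).isWedge.le_of_mem hb
    change lin C.fst (C.apex + n • d) - nrm C.fst ≤ lin C.fst b.1 at h2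
    rw [map_add] at h2
    linarith

/-- An interior direction of a cone leaves any disjoint cone. -/
theorem Cone.lin_neg_of_disjoint {C K : Cone} (h : Disjoint C.bonds K.bonds) {d : Vertex}
    (hd : C.IsInner d) : lin K.fst d < 0 ∨ lin K.snd d < 0 := by
  by_contra! hcon
  obtain ⟨e, he⟩ := K.exists_isInner
  -- If `d` did not leave `K`, then `N • d + e` would be interior to both cones for large `N`, and
  -- its large multiples would give a common bond.
  obtain ⟨N, h1, h2⟩ := ((eventually_le_nsmul hd.1 (1 - lin C.fst e)).and
    (eventually_le_nsmul hd.2 (1 - lin C.snd e))).exists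
  have h3 : 0 < lin K.fst (N • d + e) := by
    rw [map_add, map_nsmul, nsmul_eq_mul]
    have := mul_nonneg (Nat.cast_nonneg (α := ℝ) N) hcon.1
    linarith [he.1]
  have h4 : 0 < lin K.snd (N • d + e) := by
    rw [map_add, map_nsmul, nsmul_eq_mul]
    have := mul_nonneg (Nat.cast_nonneg (α := ℝ) N) hcon.2
    linarith [he.2]
  have h5 : 0 < lin C.fst (N • d + e) := by rw [map_add]; linarith
  have h6 : 0 < lin C.snd (N • d + e) := by rw [map_add]; linarith
  obtain ⟨n, h7, h8, h9, h10⟩ := ((eventually_le_nsmul h3 (lin K.fst K.apex - lin K.fst C.apex)).and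
    ((eventually_le_nsmul h4 (lin K.snd K.apex - lin K.snd C.apex)).and
    ((eventually_le_nsmul h5 0).and (eventually_le_nsmul h6 0)))).exists
  have hC : (C.apex + n • (N • d + e), false) ∈ C.bonds :=
    C.isWedge.mem_of_isEnd (Or.inl rfl) (by rw [map_add]; linarith) (by rw [map_add]; linarith)
  exact Set.disjoint_left.1 h hC
    (K.isWedge.mem_of_isEnd (Or.inl rfl) (by rw [map_add]; linarith) (by rw [map_add]; linarith))

/-! ### Rays and transports between them -/

/-- The bonds that belong to `L` together with their translates. -/
def thick (L : Set Bond) : Set Bond := {b | b ∈ L ∧ shift b ∈ L}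

theorem thick_mono {L L' : Set Bond} (h : L ⊆ L') : thick L ⊆ thick L' :=
  fun _ hb => ⟨h hb.1, h hb.2⟩

theorem nearBonds_subset_thick {L : Set Bond} {R : ℕ} {p : Vertex} (h : nearBonds (R + 1) p ⊆ L) :
    nearBonds R p ⊆ thick L := by
  rintro ⟨⟨i, j⟩, c⟩ ⟨h1, h2⟩
  simp only [abs_le] at h1 h2
  refine ⟨h ?_, h ?_⟩
  · simp only [nearBonds, Set.mem_ofPred_eq, abs_le]
    push_cast
    omega
  · cases c <;> simp only [nearBonds, Set.mem_ofPred_eq, abs_le, shift, Equiv.coe_fn_mk,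
      Bool.false_eq_true, if_false, if_true] <;> push_cast <;> omega

/-- A string in the region `K` of a cone that goes to infinity in the direction of `d`, given by the
chains of its initial parts. -/
structure Ray (C : Cone) where
  start : Vertex
  d : Vertex
  chain : ℕ → Chain
  lim : Bond → ZMod 2
  isInner : C.IsInner d
  joins : ∀ n, Joins .X (thick C.bonds) start (start + n • d) (chain n)
  eventually_eq : ∀ b, ∀ᶠ n in atTop, chain n b = lim b
  near : nearBonds 1 start ⊆ C.bonds

/-- Start so deep that the neighbourhoods of all `s + n • d` lie in the cone, and join consecutive
points by short chains. A given bond meets only finitely many of these, since `fst` grows along `d`,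
so the partial sums stabilize at each bond. -/
theorem Cone.nonempty_ray (C : Cone) : Nonempty (Ray C) := by
  obtain ⟨d, hd⟩ := C.exists_isInner
  set R : ℕ := d.1.natAbs + d.2.natAbs + 1 with hR
  obtain ⟨J, h1, h2⟩ := ((eventually_le_nsmul hd.1 (nrm C.fst * (R + 1 : ℕ))).and
    (eventually_le_nsmul hd.2 (nrm C.snd * (R + 1 : ℕ)))).exists
  set s := C.apex + J • d with hs
  have hnear : ∀ n : ℕ, nearBonds (R + 1) (s + n • d) ⊆ C.bonds := by
    intro n
    have h3 : 0 ≤ lin C.fst (n • d) := by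
      rw [map_nsmul]; exact nsmul_nonneg hd.1.le n
    have h4 : 0 ≤ lin C.snd (n • d) := by
      rw [map_nsmul]; exact nsmul_nonneg hd.2.le n
    refine C.isWedge.nearBonds_subset ?_ ?_
    · rw [hs, map_add, map_add]; linarith
    · rw [hs, map_add, map_add]; linarith
  have hstep : ∀ n : ℕ, Conn .X (nearBonds R (s + n • d)) (s + n • d) (s + (n + 1) • d) := by
    intro n
    have h3 := conn_near .X (s + n • d) d
    have e : s + n • d + d = s + (n + 1) • d := by rw [add_assoc, ← succ_nsmul]
    rwa [e] at h3
  choose L hL using hstep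
  have hev : ∀ b, ∃ N : ℕ, ∀ n ≥ N, L n b = 0 := by
    intro b
    obtain ⟨N, hN⟩ := eventually_atTop.1
      (eventually_le_nsmul hd.1 (lin C.fst b.1 - lin C.fst s + nrm C.fst * R + 1))
    refine ⟨N, fun n hn => (hL n).mem b fun hb => ?_⟩
    have h3 := (abs_le.1 (lin_le_of_mem_nearBonds C.fst hb)).1
    have h4 := hN n hn
    rw [map_add] at h3
    linarith
  choose N hN using hev
  refine ⟨{ start := s, d := d, chain := fun n => ∑ i ∈ Finset.range n, L i,
            lim := fun b => (∑ i ∈ Finset.range (N b), L i) b, isInner := hd,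
            joins := fun n => ?_, eventually_eq := fun b => ?_, near := ?_ }⟩
  · induction n with
    | zero =>
      refine ⟨fun b _ => rfl, fun r => ?_⟩
      rw [zero_smul, add_zero, zmod_two_add_self]
      exact bdry_zero .X r
    | succ n ih =>
      rw [Finset.sum_range_succ]
      exact ih.trans ((hL n).mono (nearBonds_subset_thick (hnear n)))
  · filter_upwards [eventually_ge_atTop (N b)] with n hn
    induction n, hn using Nat.le_induction with
    | base => rfl
    | succ n hn ih => rw [Finset.sum_range_succ, Finsupp.add_apply, hN b n hn, add_zero, ih]
  · refine subset_trans ?_ (hnear 0)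
    rintro b ⟨h3, h4⟩
    rw [zero_smul, add_zero]
    exact ⟨h3.trans (by push_cast; omega), h4.trans (by push_cast; omega)⟩

theorem Ray.lim_eq_zero {C : Cone} (R : Ray C) {b : Bond} (hb : b ∉ thick C.bonds) : R.lim b = 0 := by
  obtain ⟨n, hn⟩ := (R.eventually_eq b).exists
  rw [← hn, (R.joins n).mem b hb]

/-- Only the four bonds at `r` matter, and the moving end of the finite chains has passed beyond
`r`. -/
theorem Ray.bdry_lim {C : Cone} (R : Ray C) (r : Vertex) : bdry .X R.lim r = pt R.start r := by
  obtain ⟨n, h1, h2, h3, h4, h5⟩ := ((R.eventually_eq _).and ((R.eventually_eq _).and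
    ((R.eventually_eq _).and ((R.eventually_eq _).and
    (eventually_le_nsmul R.isInner.1 (lin C.fst r - lin C.fst R.start + 1)))))).exists
  have h6 := (R.joins n).bdry_eq r
  have h7 : pt (R.start + n • R.d) r = 0 := by
    rw [pt, if_neg]
    rintro rfl
    rw [map_add] at h5
    linarith
  rw [h7, add_zero, bdry_X, h1, h2, h3, h4] at h6
  rw [bdry_X, h6]

/-- The string of type `k` that corresponds to a string of type `X`. -/
def ofType (x : Bond → ZMod 2) : PauliType → Bond → ZMod 2
  | .X => x
  | .Z => fun b => x (shift.symm b)

/-- The finite chain of type `k` that corresponds to a chain of type `X`. -/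
noncomputable def chainOfType (x : Chain) : PauliType → Chain
  | .X => x
  | .Z => shiftChain x

theorem Joins.ofType {L : Set Bond} {p q : Vertex} {F : Chain} (h : Joins .X (thick L) p q F)
    (k : PauliType) : Joins k L p q (chainOfType F k) := by
  cases k
  · exact h.mono fun b hb => hb.1
  · refine ⟨fun b hb => ?_, fun r => (bdry_shift F r).trans (h.bdry_eq r)⟩
    refine h.mem _ fun h' => hb ?_
    simpa using h'.2

theorem IsTransport.ofType {L : Set Bond} {x y : Bond → ZMod 2} {F : ℕ → Chain}
    (h : IsTransport .X (thick L) x y F) (k : PauliType) :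
    IsTransport k L (ToricCode.ofType x k) (ToricCode.ofType y k) (fun n => chainOfType (F n) k) := by
  cases k
  · exact h.mono fun b hb => hb.1
  · exact h.shift fun b hb => hb.2

theorem Ray.ofType_lim_eq_zero {C : Cone} (R : Ray C) (k : PauliType) {b : Bond} (hb : b ∉ C.bonds) :
    ofType R.lim k b = 0 := by
  cases k
  · exact R.lim_eq_zero fun h => hb h.1
  · exact R.lim_eq_zero fun h => hb (by simpa using h.2)

/-- From a ray that leaves a wedge to the ray in the direction opposite to the wedge. -/
theorem eventually_conn_opposite (k : PauliType) {f g : ℝ × ℝ →ₗ[ℝ] ℝ} {e d : Vertex}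
    (hf : 0 < lin f e) (hg : 0 < lin g e) (hd : lin f d < 0 ∨ lin g d < 0) (p : Vertex) (B : ℝ) :
    ∀ᶠ n : ℕ in atTop, Conn k {b | lin f b.1 ≤ B ∨ lin g b.1 ≤ B} (p + n • d) (p - n • e) := by
  -- The roles of `f` and `g` are symmetric.
  wlog h : lin f d < 0 generalizing f g
  · simp only [or_comm (a := lin f _ ≤ B)]
    exact this hg hf hd.symm (hd.resolve_left h)
  set R : ℕ := (-(d + e)).1.natAbs + (-(d + e)).2.natAbs + 1 with hR
  -- The walk goes in steps `-(d + e)`, so after `j` steps it is at `p + (n - j) • d - j • e`. There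
  -- `f` is at most its value at `p` minus `n * c`, uniformly in `j`.
  set c := min (-lin f d) (lin f e) with hc
  have hc0 : 0 < c := lt_min (neg_pos.2 h) hf
  obtain ⟨N, hN⟩ := exists_nat_gt ((lin f p + nrm f * R - B) / c)
  rw [div_lt_iff₀ hc0] at hN
  filter_upwards [eventually_ge_atTop N] with n hn
  have hn' : (N : ℝ) ≤ n := by exact_mod_cast hn
  have h1 := conn_progression (k := k) (L := {b | lin f b.1 ≤ B ∨ lin g b.1 ≤ B}) (p + n • d) (-(d + e)) n
    fun j hj b hb => by
      have hj' : (j : ℝ) ≤ n := by exact_mod_cast hj.le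
      have h2 := (abs_le.1 (lin_le_of_mem_nearBonds f hb)).2
      rw [map_add, map_add, map_nsmul, map_nsmul, map_neg, map_add, nsmul_eq_mul, nsmul_eq_mul] at h2
      have h3 : c ≤ -lin f d := min_le_left _ _
      have h4 : c ≤ lin f e := min_le_right _ _
      have h5 := mul_le_mul_of_nonneg_left h3 (sub_nonneg.2 hj')
      have h6 := mul_le_mul_of_nonneg_left h4 (Nat.cast_nonneg (α := ℝ) j)
      have h7 := mul_le_mul_of_nonneg_right hn' hc0.le
      refine Or.inl ?_
      linarith
  have e1 : p + n • d + n • -(d + e) = p - n • e := by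
    rw [smul_neg, smul_add]; abel
  rwa [e1] at h1

/-- Two rays that leave a wedge are connected far out in the complement of the wedge. -/
theorem eventually_conn_around (k : PauliType) {f g : ℝ × ℝ →ₗ[ℝ] ℝ} {e d d' : Vertex}
    (hf : 0 < lin f e) (hg : 0 < lin g e) (hd : lin f d < 0 ∨ lin g d < 0)
    (hd' : lin f d' < 0 ∨ lin g d' < 0) (p p' : Vertex) (B : ℝ) :
    ∀ᶠ n : ℕ in atTop, Conn k {b | lin f b.1 ≤ B ∨ lin g b.1 ≤ B} (p + n • d) (p' + n • d') := by
  filter_upwards [eventually_conn_opposite k hf hg hd p B, eventually_conn_opposite k hf hg hd' p' B,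
    eventually_le_nsmul hf (lin f p + nrm f * ((p' - p).1.natAbs + (p' - p).2.natAbs + 1 : ℕ) - B)]
    with n h1 h2 h3
  -- Both rays are led to the side opposite to the wedge, where a walk of fixed length between `p -
  -- n • e` and `p' - n • e` joins them.
  refine h1.trans (Conn.trans ?_ h2.symm)
  have h4 := conn_near k (p - n • e) (p' - p)
  have e1 : p - n • e + (p' - p) = p' - n • e := by abel
  rw [e1] at h4
  refine h4.mono fun b hb => Or.inl ?_
  have h5 := (abs_le.1 (lin_le_of_mem_nearBonds f hb)).2
  rw [map_sub] at h5
  linarith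

theorem abs_lin_shift_sub_le (f : ℝ × ℝ →ₗ[ℝ] ℝ) (b : Bond) :
    |lin f (shift b).1 - lin f b.1| ≤ nrm f := by
  rw [← map_sub]
  have := abs_lin_le f (v := (shift b).1 - b.1) (R := 1) ?_ ?_
  · simpa using this
  · obtain ⟨⟨i, j⟩, c⟩ := b
    cases c <;> simp [shift]
  · obtain ⟨⟨i, j⟩, c⟩ := b
    cases c <;> simp [shift]

/-- Strings going to infinity in two cones can be transported into each other in the complement of
a third cone. -/
theorem Ray.exists_isTransport {C C' K : Cone} (R : Ray C) (R' : Ray C')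
    (h : Disjoint C.bonds K.bonds) (h' : Disjoint C'.bonds K.bonds) :
    ∃ F : ℕ → Chain, IsTransport .X (thick K.bondsᶜ) R.lim R'.lim F ∧
      ∀ n r, bdry .X (F n) r = pt R.start r + pt R'.start r := by
  obtain ⟨e, he⟩ := K.exists_isInner
  -- One norm allows for the extent of a bond, the other for the translation `shift`.
  obtain ⟨m₀, hm₀⟩ := exists_nat_gt (max (2 * nrm K.fst - lin K.fst K.apex)
    (2 * nrm K.snd - lin K.snd K.apex))
  rw [max_lt_iff] at hm₀
  have hconn : ∀ m : ℕ, ∃ n ≥ m, Conn .X {b | lin K.fst b.1 ≤ -((m : ℝ) + m₀) ∨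
      lin K.snd b.1 ≤ -((m : ℝ) + m₀)} (R.start + n • R.d) (R'.start + n • R'.d) := fun m => by
    obtain ⟨n, h1, h2⟩ := ((eventually_conn_around .X he.1 he.2 (Cone.lin_neg_of_disjoint h R.isInner)
      (Cone.lin_neg_of_disjoint h' R'.isInner) R.start R'.start (-((m : ℝ) + m₀))).and
      (eventually_ge_atTop m)).exists
    exact ⟨n, h2, h1⟩
  choose n hn G hG using hconn
  have hnt : Tendsto n atTop atTop := tendsto_atTop_mono hn tendsto_id
  have hsub : ∀ m : ℕ, {b : Bond | lin K.fst b.1 ≤ -((m : ℝ) + m₀) ∨ lin K.snd b.1 ≤ -((m : ℝ) + m₀)} ⊆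
      thick K.bondsᶜ := by
    rintro m b hb
    have hm : (0 : ℝ) ≤ m := Nat.cast_nonneg m
    have h1 := (abs_le.1 (abs_lin_shift_sub_le K.fst b)).2
    have h2 := (abs_le.1 (abs_lin_shift_sub_le K.snd b)).2
    have h3 := nrm_nonneg K.fst
    have h4 := nrm_nonneg K.snd
    refine ⟨fun hbK => ?_, fun hbK => ?_⟩
    · have h5 := K.isWedge.le_of_mem hbK
      have h6 := K.isWedge.swap.le_of_mem hbK
      rcases hb with hb | hb <;> linarith
    · have h5 := K.isWedge.le_of_mem hbK
      have h6 := K.isWedge.swap.le_of_mem hbK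
      rcases hb with hb | hb <;> linarith
  -- Out along the first ray, around `K` at a distance growing with `m`, and back along the second
  -- ray.
  have hJ : ∀ m, Joins .X (thick K.bondsᶜ) R.start R'.start
      (R.chain (n m) + (G m + R'.chain (n m))) := fun m =>
    ((R.joins _).mono (thick_mono h.subset_compl_right)).trans (((hG m).mono (hsub m)).trans
      ((R'.joins _).mono (thick_mono h'.subset_compl_right)).symm)
  refine ⟨_, ⟨fun m => (hJ m).mem, fun m r => ((hJ m).bdry_eq r).trans ((hJ 0).bdry_eq r).symm,
    fun b => ?_⟩, fun m => (hJ m).bdry_eq⟩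
  -- The arc around `K` recedes to infinity and eventually avoids `b`, so only the two rays
  -- contribute to the limit.
  obtain ⟨N, hN⟩ := exists_nat_gt (max (-lin K.fst b.1) (-lin K.snd b.1))
  rw [max_lt_iff] at hN
  filter_upwards [hnt.eventually (R.eventually_eq b), hnt.eventually (R'.eventually_eq b),
    eventually_ge_atTop N] with m h1 h2 h3
  have h3' : (N : ℝ) ≤ m := by exact_mod_cast h3
  have h4 : G m b = 0 := (hG m).mem b fun hb => by
    have hm₀' : (0 : ℝ) ≤ m₀ := Nat.cast_nonneg m₀
    rcases hb with hb | hb <;> linarith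
  rw [Finsupp.add_apply, Finsupp.add_apply, h1, h2, h4, zero_add]

/-! ### Moving a path in a cone to a ray. -/

/-- The chain of the first bonds of a path. -/
noncomputable def InfPath.chain {k : PauliType} (γ : InfPath k) (n : ℕ) : Chain :=
  ∑ i ∈ Finset.range n, Finsupp.single (γ.bond i) 1

theorem InfPath.joins {k : PauliType} (γ : InfPath k) {L : Set Bond} (hγ : ∀ n, γ.bond n ∈ L) (n : ℕ) :
    Joins k L (γ.site 0) (γ.site n) (γ.chain n) := by
  induction n with
  | zero =>
    refine ⟨fun b _ => rfl, fun r => ?_⟩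
    rw [zmod_two_add_self]
    exact bdry_zero k r
  | succ n ih =>
    rw [InfPath.chain, Finset.sum_range_succ]
    obtain ⟨h1, h2, h3⟩ := γ.step n
    exact ih.trans (joins_single (hγ n) (bdry_single_of_step h1 h2 h3))

theorem InfPath.eventually_chain {k : PauliType} (γ : InfPath k) (b : Bond) :
    ∀ᶠ n in atTop, γ.chain n b = ind (Set.range γ.bond) b := by
  classical
  by_cases hb : b ∈ Set.range γ.bond
  · obtain ⟨j, rfl⟩ := hb
    filter_upwards [eventually_gt_atTop j] with n hn
    rw [InfPath.chain, Finsupp.finsetSum_apply, Finset.sum_eq_single j]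
    · simp [ind]
    · intro i _ hi
      rw [Finsupp.single_apply, if_neg fun h => hi (γ.bond_injective h)]
    · intro h
      exact absurd (Finset.mem_range.2 hn) h
  · refine Eventually.of_forall fun n => ?_
    rw [InfPath.chain, Finsupp.finsetSum_apply, Finset.sum_eq_zero]
    · simp [ind, hb]
    · intro i _
      rw [Finsupp.single_apply, if_neg fun h => hb ⟨i, h⟩]

/-- A path in a cone can be transported to any ray in the cone. -/
theorem InfPath.exists_isTransport {k : PauliType} (γ : InfPath k) {C : Cone} (hγ : γ.IsIn C)
    (R : Ray C) : ∃ U, IsTransport k C.bonds (ind (Set.range γ.bond)) (ofType R.lim k) U := by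
  have hconn := fun m : ℕ => C.isWedge.exists_conn_path C.finite_bounded γ hγ R.isInner.1 R.isInner.2
    R.start m m
  choose i hi n hn G hG using hconn
  have hit : Tendsto i atTop atTop := tendsto_atTop_mono hi tendsto_id
  have hnt : Tendsto n atTop atTop := tendsto_atTop_mono hn tendsto_id
  -- Out along the path, across at a distance growing with `m`, and back along the ray.
  have hJ : ∀ m, Joins k C.bonds (γ.site 0) R.start
      (γ.chain (i m) + (G m + chainOfType (R.chain (n m)) k)) := fun m =>
    (γ.joins hγ _).trans (((hG m).mono fun b hb => hb.1).trans ((R.joins _).ofType k).symm)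
  refine ⟨_, fun m => (hJ m).mem, fun m r => ((hJ m).bdry_eq r).trans ((hJ 0).bdry_eq r).symm,
    fun b => ?_⟩
  obtain ⟨N, hN⟩ := exists_nat_gt (lin C.fst b.1 + lin C.snd b.1)
  have hR : ∀ᶠ n in atTop, chainOfType (R.chain n) k b = ofType R.lim k b := by
    cases k
    · exact R.eventually_eq b
    · exact R.eventually_eq _
  filter_upwards [hit.eventually (γ.eventually_chain b), hnt.eventually hR, eventually_ge_atTop N]
    with m h1 h2 h3
  have h3' : (N : ℝ) ≤ m := by exact_mod_cast h3
  have h4 : G m b = 0 := (hG m).mem b fun hb => by linarith [hb.2]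
  rw [Finsupp.add_apply, Finsupp.add_apply, h1, h2, h4, zero_add]

end ToricCode

namespace ToricCode

/-! ### The braiding and the twist of string automorphisms -/

/-- A string in one cone and the translate of a string from there to a disjoint cone cross an odd
number of times. -/
theorem Ray.eventually_pair {C C' : Cone} (R : Ray C) (R' : Ray C') (h : Disjoint C.bonds C'.bonds)
    {F : ℕ → Chain} {L : Set Bond} (hF : IsTransport .X L R.lim R'.lim F)
    (hb : ∀ n r, bdry .X (F n) r = pt R.start r + pt R'.start r) :
    ∀ᶠ n in atTop, pair (F n) (ofType R.lim .Z) + pair (shiftChain (F n)) (ofType R.lim .X) = 1 := by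
  have hnear : ∀ (q : Vertex) (b : Bond), b ∈ [(q, false), ((q.1 + 1, q.2), true),
      ((q.1, q.2 + 1), false), (q, true)] → b ∈ nearBonds 1 q := by
    intro q b hb
    simp only [List.mem_cons, List.not_mem_nil, or_false] at hb
    rcases hb with rfl | rfl | rfl | rfl <;> simp [nearBonds]
  -- The field `near` puts the bonds around the start of each ray into its own cone, where the other
  -- ray does not pass.
  have h1 : ∀ b ∈ nearBonds 1 R.start, R'.lim b = 0 := fun b hb =>
    R'.lim_eq_zero fun hb' => Set.disjoint_left.1 h (R.near hb) hb'.1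
  have h2 : ∀ b ∈ nearBonds 1 R'.start, R.lim b = 0 := fun b hb =>
    R.lim_eq_zero fun hb' => Set.disjoint_left.1 h hb'.1 (R'.near hb)
  have h3 := R.bdry_lim R.start
  rw [bdry_X, pt, if_pos rfl] at h3
  filter_upwards [hF.lim (R.start, false), hF.lim ((R.start.1 + 1, R.start.2), true)] with n h4 h5
  rw [h1 _ (hnear _ _ (by simp)), add_zero] at h4 h5
  -- In the end-point formula, `F n` agrees with `R.lim` at the start of `R`, so the four terms
  -- there form the boundary of `R.lim`, which is `1`. The terms at the start of `R'` vanish.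
  refine (pair_shift_add_pair_shift R.lim (F n) R.bdry_lim (hb n)).trans ?_
  rw [h4, h5, h2 (R'.start, true) (hnear _ _ (by simp)),
    h2 ((R'.start.1, R'.start.2 + 1), false) (hnear _ _ (by simp)), ← h3]
  ring

section Twist

variable {H : Type*} [NormedAddCommGroup H] [InnerProductSpace ℂ H] [CompleteSpace H]
  {π : QLA →⋆ₐ[ℂ] (H →L[ℂ] H)} {Ω : H} {Λa C K : Cone} {ρ : QLA →⋆ₐ[ℂ] QLA}
  {D : PauliType → Bond → ZMod 2} {R : Ray C} {a : PauliType → ZMod 2} {x : Vertex}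

/-- The endomorphism `ρ` with strings in a cone is implemented on the complements of the translates of
the forbidden cone by observables in the complement of a cone that is disjoint from both. -/
theorem exists_implements_compl (hΩ : IsVacuum π Ω) (hρ : IsPauliEndo ρ D)
    (hU : ∀ k, ∃ U, IsTransport k C.bonds (D k) (a k • ofType R.lim k) U)
    (hCK : Disjoint C.bonds K.bonds) (hK : K.bonds ⊆ (Λa.translate x).bondsᶜ) {d : Vertex}
    (hd : Λa.IsInner d) (n : ℕ) : ∃ m ≥ n, ∃ W ∈ unitary (H →L[ℂ] H), W ∈ vn π K.bondsᶜ ∧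
      Implements π W ρ (Λa.translate (m • d)).bondsᶜ := by
  obtain ⟨m₁, hm₁⟩ := (Λa.isExhausting hd).cofinal x
  set m := max m₁ n
  have hm : (Λa.translate (m • d)).bonds ⊆ (Λa.translate x).bonds :=
    Set.compl_subset_compl.1 (hm₁.trans ((Λa.isExhausting hd).mono (le_max_left _ _)))
  obtain ⟨R'⟩ := (Λa.translate (m • d)).nonempty_ray
  -- The cone `K` is disjoint from `C` and from the smaller forbidden cone, so the strings can be
  -- moved from the one to the other without touching `K`.
  obtain ⟨F, hF, -⟩ := R.exists_isTransport R' hCK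
    (Set.disjoint_left.2 fun b hb hbK => hK hbK (hm hb))
  choose U hU using hU
  obtain ⟨W, hW, hWK, hWi⟩ := exists_implements hΩ hρ (N := (Λa.translate (m • d)).bondsᶜ)
    (D'' := fun k => a k • ofType R'.lim k)
    (fun k b hb => by rw [Pi.smul_apply, R'.ofType_lim_eq_zero k hb, smul_zero])
    fun k => ((hU k).mono hCK.subset_compl_right).trans ((hF.ofType k).smul (a k))
  exact ⟨m, le_max_right _ _, W, hW, hWK, hWi⟩

/-- The braiding of an endomorphism with strings in a cone is a sign. -/
theorem exists_transporter_sign (hΩ : IsVacuum π Ω) (hρ : IsPauliEndo ρ D)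
    (hU : ∀ k, ∃ U, IsTransport k C.bonds (D k) (a k • ofType R.lim k) U)
    (hCK : Disjoint C.bonds K.bonds) (hK : K.bonds ⊆ (Λa.translate x).bondsᶜ)
    (hC : C.bonds ⊆ (Λa.translate x).bondsᶜ) :
    ∃ V ∈ unitary (H →L[ℂ] H), V ∈ vn π (Λa.translate x).bondsᶜ ∧
      (∃ ρ', IsLocalizedIn ρ' K.bonds ∧ ∀ A, V * π (ρ A) = π (ρ' A) * V) ∧
      ∀ E, IsExt π (fun x => (Λa.translate x).bondsᶜ) ρ E →
        ∀ V' : aux π fun x => (Λa.translate x).bondsᶜ, (V' : H →L[ℂ] H) = V →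
          E V' = sgn (a .X * a .Z) • V' := by
  -- `R'` is the target of the charge transporter and is reached while avoiding `Λa + x`; `R''` lies
  -- in `Λa + x` and serves to implement the endomorphism outside it.
  obtain ⟨R'⟩ := K.nonempty_ray
  obtain ⟨R''⟩ := (Λa.translate x).nonempty_ray
  have hKa : Disjoint K.bonds (Λa.translate x).bonds := Set.disjoint_left.2 fun b hb => hK hb
  have hCa : Disjoint C.bonds (Λa.translate x).bonds := Set.disjoint_left.2 fun b hb => hC hb
  obtain ⟨F, hF, hFb⟩ := R.exists_isTransport R' hCa hKa
  obtain ⟨G, hG, -⟩ := R.exists_isTransport R'' hCK hKa.symm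
  choose U hU using hU
  have hD' : ∀ k, ∀ b ∉ K.bonds, (a k • ofType R'.lim k) b = 0 := fun k b hb => by
    rw [Pi.smul_apply, R'.ofType_lim_eq_zero k hb, smul_zero]
  obtain ⟨V, hV, hVM, hVi, hVE⟩ := exists_charge_transporter (s := a .X * a .Z)
    (M := fun x => (Λa.translate x).bondsᶜ) (K' := K.bonds) (x := x)
    (D' := fun k => a k • ofType R'.lim k) (D'' := fun k => a k • ofType R''.lim k) hΩ hρ
    hCK.subset_compl_right hC hD'
    (fun k b hb => by rw [Pi.smul_apply, R''.ofType_lim_eq_zero k hb, smul_zero]) hU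
    (fun k => (hF.ofType k).smul (a k))
    (fun k => ((hG.ofType k).smul (a k)).mono (Set.subset_univ _)) (by
      filter_upwards [R.eventually_pair R' hCK hF hFb] with n hn
      rw [pair_smul_smul, pair_smul_smul, mul_comm (a .Z), ← mul_add]
      exact (congrArg _ hn).trans (mul_one _))
  obtain ⟨ρ', hρ'⟩ := exists_isPauliEndo fun k => a k • ofType R'.lim k
  exact ⟨V, hV, hVM, ⟨ρ', hρ'.isLocalizedIn hD', hVi ρ' hρ'⟩, hVE⟩

theorem exists_isExt_of_disjoint (hΩ : IsVacuum π Ω) (hρ : IsPauliEndo ρ D)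
    (hU : ∀ k, ∃ U, IsTransport k C.bonds (D k) (a k • ofType R.lim k) U)
    (hCK : Disjoint C.bonds K.bonds) (hK : K.bonds ⊆ (Λa.translate x).bondsᶜ) :
    ∃ E, IsExt π (fun x => (Λa.translate x).bondsᶜ) ρ E := by
  obtain ⟨d, hd⟩ := Λa.exists_isInner
  refine exists_isExt (Λa.isExhausting hd) hρ fun n => ?_
  obtain ⟨m, hm, W, hW, -, hWi⟩ := exists_implements_compl hΩ hρ hU hCK hK hd n
  exact ⟨W, hW, hWi.mono ((Λa.isExhausting hd).mono hm)⟩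

/-- The extension fixes what commutes with the observables in the complement of a cone that is
disjoint from the strings. -/
theorem IsExt.apply_eq_self_of_commute (hΩ : IsVacuum π Ω) (hρ : IsPauliEndo ρ D)
    (hU : ∀ k, ∃ U, IsTransport k C.bonds (D k) (a k • ofType R.lim k) U)
    (hCK : Disjoint C.bonds K.bonds) (hK : K.bonds ⊆ (Λa.translate x).bondsᶜ)
    {E : (aux π fun x => (Λa.translate x).bondsᶜ) →⋆ₐ[ℂ] aux π fun x => (Λa.translate x).bondsᶜ}
    (hE : IsExt π (fun x => (Λa.translate x).bondsᶜ) ρ E) (T : aux π fun x => (Λa.translate x).bondsᶜ)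
    (hT : ∀ A ∈ localAlg K.bondsᶜ, (T : H →L[ℂ] H) * π A = π A * T) : E T = T := by
  obtain ⟨d, hd⟩ := Λa.exists_isInner
  refine hE.apply_eq_self (Λa.isExhausting hd) T fun n => ?_
  obtain ⟨m, hm, W, hW, hWK, hWi⟩ := exists_implements_compl hΩ hρ hU hCK hK hd n
  -- `W` lies in the bicommutant of the observables outside `K`, and `T` in their commutant.
  exact ⟨m, hm, W, hW, hWi, ((mem_vn_iff π _ W).1 hWK _ hT).symm⟩

/-- The braiding does not depend on the choice of the charge transporter. -/
theorem star_mul_ext_eq (hΩ : IsVacuum π Ω) (hρ : IsPauliEndo ρ D)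
    (hU : ∀ k, ∃ U, IsTransport k C.bonds (D k) (a k • ofType R.lim k) U)
    (hCK : Disjoint C.bonds K.bonds) (hK : K.bonds ⊆ (Λa.translate x).bondsᶜ)
    (hC : C.bonds ⊆ (Λa.translate x).bondsᶜ)
    {E : (aux π fun x => (Λa.translate x).bondsᶜ) →⋆ₐ[ℂ] aux π fun x => (Λa.translate x).bondsᶜ}
    (hE : IsExt π (fun x => (Λa.translate x).bondsᶜ) ρ E) {V : aux π fun x => (Λa.translate x).bondsᶜ}
    (hV : V ∈ unitary (aux π fun x => (Λa.translate x).bondsᶜ)) {σ : QLA →⋆ₐ[ℂ] QLA}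
    (hσ : IsLocalizedIn σ K.bonds) (hVi : ∀ A, (V : H →L[ℂ] H) * π (ρ A) = π (σ A) * V) :
    star V * E V = sgn (a .X * a .Z) • 1 := by
  obtain ⟨v, hv, hvM, ⟨ρ', hρ', hvi⟩, hvE⟩ := exists_transporter_sign hΩ hρ hU hCK hK hC
  let v' : aux π fun x => (Λa.translate x).bondsᶜ :=
    ⟨v, vn_le_aux (M := fun x => (Λa.translate x).bondsᶜ) x hvM⟩
  have h1 : star v' * v' = 1 := Subtype.ext (Unitary.mem_iff.1 hv).1
  -- `V v*` intertwines two endomorphisms that act trivially outside `K`, so it commutes with the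
  -- observables there and the extension fixes it.
  have hT : E (V * star v') = V * star v' := by
    refine hE.apply_eq_self_of_commute hΩ hρ hU hCK hK _ fun A hA => ?_
    change (V : H →L[ℂ] H) * star v * π A = π A * (V * star v)
    have h2 := hvi A
    rw [hρ' A hA] at h2
    have h3 := hVi A
    rw [hσ A hA] at h3
    rw [mul_assoc, star_mul_eq_of_mul_eq hv h2, ← mul_assoc, h3, mul_assoc]
  have h4 : E V = sgn (a .X * a .Z) • V := by
    calc E V = E (V * star v' * v') := by rw [mul_assoc, h1, mul_one]
      _ = V * star v' * (sgn (a .X * a .Z) • v') := by rw [map_mul E, hT, hvE E hE v' rfl]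
      _ = sgn (a .X * a .Z) • V := by rw [mul_smul_comm, mul_assoc, h1, mul_one]
  rw [h4, mul_smul_comm, (Unitary.mem_iff.1 hV).1]

theorem exists_aux_transporter (hΩ : IsVacuum π Ω) (hρ : IsPauliEndo ρ D)
    (hU : ∀ k, ∃ U, IsTransport k C.bonds (D k) (a k • ofType R.lim k) U)
    (hCK : Disjoint C.bonds K.bonds) (hK : K.bonds ⊆ (Λa.translate x).bondsᶜ)
    (hC : C.bonds ⊆ (Λa.translate x).bondsᶜ) :
    ∃ V : aux π fun x => (Λa.translate x).bondsᶜ,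
      V ∈ unitary (aux π fun x => (Λa.translate x).bondsᶜ) ∧
      ∃ ρ', IsLocalizedIn ρ' K.bonds ∧ ∀ A, (V : H →L[ℂ] H) * π (ρ A) = π (ρ' A) * V := by
  obtain ⟨v, hv, hvM, ⟨ρ', hρ', hvi⟩, -⟩ := exists_transporter_sign hΩ hρ hU hCK hK hC
  exact ⟨⟨v, vn_le_aux (M := fun x => (Λa.translate x).bondsᶜ) x hvM⟩,
    Unitary.mem_iff.2 ⟨Subtype.ext (Unitary.mem_iff.1 hv).1, Subtype.ext (Unitary.mem_iff.1 hv).2⟩,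
    ρ', hρ', hvi⟩

end Twist

theorem star_one_mul_map_mul_one {A : Type*} [Ring A] [StarRing A] [Algebra ℂ A] (E : A →⋆ₐ[ℂ] A)
    (c : ℂ) : star 1 * E (c • 1) * 1 = c • 1 := by
  rw [map_smul, map_one, star_one, one_mul, mul_one]

theorem star_one_mul_map_one {A : Type*} [Ring A] [StarRing A] [Algebra ℂ A] (E : A →⋆ₐ[ℂ] A) :
    star 1 * E 1 = 1 := by
  rw [map_one, star_one, one_mul]

/-! ### The twist in the GNS representation. -/

section Vacuum

variable (ω : VacuumState) {Λa C K : Cone} {ρ : QLA →⋆ₐ[ℂ] QLA}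
  {D : PauliType → Bond → ZMod 2} {R : Ray C} {a : PauliType → ZMod 2}

/-- `auxAlg` and `IsAuxExtension` unfold to `aux` and `IsExt` for `π = rep ω` and the complements of
the translated forbidden cones, so the general results apply as they stand. -/
theorem exists_isAuxExtension (hK : Precedes Λa K C) (hρ : IsPauliEndo ρ D)
    (hU : ∀ k, ∃ U, IsTransport k C.bonds (D k) (a k • ofType R.lim k) U) :
    ∃ E, IsAuxExtension ω Λa ρ E := by
  obtain ⟨hdis, x, hKx, -⟩ := hK
  exact exists_isExt_of_disjoint (π := rep ω) (isVacuum_vac ω) hρ hU hdis.symm hKx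

theorem IsAuxExtension.apply_eq_self {ω : VacuumState} {E : auxAlg ω Λa →⋆ₐ[ℂ] auxAlg ω Λa}
    (hE : IsAuxExtension ω Λa ρ E) (hK : Precedes Λa K C) (hρ : IsPauliEndo ρ D)
    (hU : ∀ k, ∃ U, IsTransport k C.bonds (D k) (a k • ofType R.lim k) U) (T : auxAlg ω Λa)
    (hT : ∀ A, (T : Ops ω) * rep ω A = rep ω A * T) : E T = T := by
  obtain ⟨hdis, x, hKx, -⟩ := hK
  exact IsExt.apply_eq_self_of_commute (π := rep ω) (isVacuum_vac ω) hρ hU hdis.symm hKx hE T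
    fun A _ => hT A

theorem IsAuxExtension.star_mul_eq {ω : VacuumState} {E : auxAlg ω Λa →⋆ₐ[ℂ] auxAlg ω Λa}
    (hE : IsAuxExtension ω Λa ρ E) (hK : Precedes Λa K C) (hρ : IsPauliEndo ρ D)
    (hU : ∀ k, ∃ U, IsTransport k C.bonds (D k) (a k • ofType R.lim k) U) {V : auxAlg ω Λa}
    (hV : V ∈ unitary (auxAlg ω Λa)) {σ : QLA →⋆ₐ[ℂ] QLA} (hσ : IsLocalizedIn σ K.bonds)
    (hVi : IsIntertwiner (V : Ops ω) ρ σ) : star V * E V = sgn (a .X * a .Z) • (1 : auxAlg ω Λa) := by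
  obtain ⟨hdis, x, hKx, hCx, -⟩ := hK
  exact star_mul_ext_eq (π := rep ω) (Λa := Λa) (isVacuum_vac ω) hρ hU hdis.symm hKx hCx hE hV hσ hVi

theorem exists_isIntertwiner (hK : Precedes Λa K C) (hρ : IsPauliEndo ρ D)
    (hU : ∀ k, ∃ U, IsTransport k C.bonds (D k) (a k • ofType R.lim k) U) :
    ∃ V ∈ unitary (auxAlg ω Λa), ∃ ρ', IsLocalizedIn ρ' K.bonds ∧ IsIntertwiner (V : Ops ω) ρ ρ' := by
  obtain ⟨hdis, x, hKx, hCx, -⟩ := hK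
  exact exists_aux_transporter (π := rep ω) (Λa := Λa) (isVacuum_vac ω) hρ hU hdis.symm hKx hCx

/-- The twist of an endomorphism with strings in a cone. -/
theorem hasTwist_of_isTransport (hK : Precedes Λa K C) (hρ : IsPauliEndo ρ D)
    (hD : ∀ k, ∀ b ∉ C.bonds, D k b = 0)
    (hU : ∀ k, ∃ U, IsTransport k C.bonds (D k) (a k • ofType R.lim k) U) :
    HasTwist ω Λa C ρ (sgn (a .X * a .Z)) := by
  obtain ⟨E, hE⟩ := exists_isAuxExtension ω hK hρ hU
  have hloc : IsLocalizedIn ρ C.bonds := hρ.isLocalizedIn hD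
  have hint : IsIntertwiner (1 : Ops ω) (StarAlgHom.id ℂ QLA) (tensorEndo ρ ρ) := fun A => by
    have : tensorEndo ρ ρ A = A := hρ.apply_apply A
    rw [this, one_mul, mul_one]
    rfl
  have h1 : star 1 * E 1 = 1 := star_one_mul_map_one E
  refine ⟨⟨hint, hint, E, E, hE, hE, h1, h1, rfl, fun T hT => ?_⟩, fun Θ => ⟨?_, ?_⟩⟩
  -- Replacing `A` by `ρ A` and using `ρ ∘ ρ = id`, a self-intertwiner of `ρ` commutes with all
  -- observables and is therefore fixed by the extension.
  · rw [hE.apply_eq_self hK hρ hU T fun A => by simpa only [hρ.apply_apply] using hT (ρ A)]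
  · rintro ⟨ε, E', ⟨-, -, -, Λ₂, ρ₂, V, E₁, hΛ₂, hρ₂, hV, hVi, hE₁, hε⟩, -, hΘ⟩
    -- Whatever the choices, the braiding is a scalar, and a unital extension leaves it unchanged.
    have hε' := hε.trans (hE₁.star_mul_eq hΛ₂ hρ hU hV hρ₂ hVi)
    subst hε'
    exact hΘ.trans (star_one_mul_map_mul_one E' _)
  · intro hΘ
    obtain ⟨V, hV, ρ', hρ', hVi⟩ := exists_isIntertwiner ω hK hρ hU
    have hε := hE.star_mul_eq hK hρ hU hV hρ' hVi
    exact ⟨_, E, ⟨hloc, hloc, ⟨C, (Set.union_self _).subset⟩, K, ρ', V, E, hK, hρ', hV, hVi, hE, hε.symm⟩,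
      hE, hΘ.trans (star_one_mul_map_mul_one E _).symm⟩

end Vacuum

/-! ### The strings of paths of type `X` and `Z` and of their product. -/

theorem ind_eq_zero {S : Set Bond} {b : Bond} (h : b ∉ S) : ind S b = 0 := by
  simp [ind, h]

theorem InfPath.IsIn.only_eq_zero {k : PauliType} {γ : InfPath k} {C : Cone} (h : γ.IsIn C)
    (l : PauliType) {b : Bond} (hb : b ∉ C.bonds) : only k (ind (Set.range γ.bond)) l b = 0 := by
  rw [only, ind_eq_zero, mul_zero]
  rintro ⟨n, rfl⟩
  exact hb (h n)

theorem only_X_Z (x : Bond → ZMod 2) : only .X x .Z = 0 := by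
  ext b; simp [only, cross, PauliType.dual]

theorem only_Z_X (x : Bond → ZMod 2) : only .Z x .X = 0 := by
  ext b; simp [only, cross, PauliType.dual]

theorem only_self (k : PauliType) (x : Bond → ZMod 2) : only k x k = x := by
  ext b; cases k <;> simp [only, cross, PauliType.dual]

/-- The twist of a path automorphism is trivial. -/
theorem InfPath.IsIn.hasTwist (ω : VacuumState) {Λa C C' : Cone} (hC' : Precedes Λa C' C)
    {k : PauliType} {γ : InfPath k} (h : γ.IsIn C) : HasTwist ω Λa C γ.auto 1 := by
  obtain ⟨R⟩ := C.nonempty_ray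
  obtain ⟨U, hU⟩ := γ.exists_isTransport h R
  have h1 : IsPauliEndo γ.auto _ := isPauliEndo_stringEndo k γ.bond γ.bond_injective
  cases k
  -- Only the string of the path's own type is present; the other coefficient is `0`, so the
  -- exponent `a .X * a .Z` vanishes.
  · have := hasTwist_of_isTransport ω hC' h1 (fun l b => h.only_eq_zero l) (R := R)
      (a := fun | .X => 1 | .Z => 0) (fun l => by
        cases l
        · exact ⟨U, by simpa only [only_self, one_smul] using hU⟩
        · exact ⟨_, by simpa only [only_X_Z, zero_smul] using isTransport_zero _ _⟩)
    simpa [sgn] using this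
  · have := hasTwist_of_isTransport ω hC' h1 (fun l b => h.only_eq_zero l) (R := R)
      (a := fun | .X => 0 | .Z => 1) (fun l => by
        cases l
        · exact ⟨_, by simpa only [only_Z_X, zero_smul] using isTransport_zero _ _⟩
        · exact ⟨U, by simpa only [only_self, one_smul] using hU⟩)
    simpa [sgn] using this

/-- The twist of the product of two path automorphisms of different types is `-1`. -/
theorem InfPath.IsIn.hasTwist_tensorEndo (ω : VacuumState) {Λa C C' : Cone} (hC' : Precedes Λa C' C)
    {γX : InfPath .X} {γZ : InfPath .Z} (hX : γX.IsIn C) (hZ : γZ.IsIn C) :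
    HasTwist ω Λa C (tensorEndo γX.auto γZ.auto) (-1) := by
  obtain ⟨R⟩ := C.nonempty_ray
  obtain ⟨U, hU⟩ := γX.exists_isTransport hX R
  obtain ⟨U', hU'⟩ := γZ.exists_isTransport hZ R
  have h1 : IsPauliEndo γX.auto _ := isPauliEndo_stringEndo .X γX.bond γX.bond_injective
  have h2 : IsPauliEndo γZ.auto _ := isPauliEndo_stringEndo .Z γZ.bond γZ.bond_injective
  -- Both strings are present and are moved to the same ray `R` and its translate, so the exponent
  -- is `1`.
  have := hasTwist_of_isTransport ω hC' (h1.tensorEndo h2)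
    (fun l b hb => by rw [hX.only_eq_zero l hb, hZ.only_eq_zero l hb, add_zero]) (R := R)
    (a := fun _ => 1) (fun l => by
      cases l
      · refine ⟨U, ?_⟩
        simpa only [only_self, only_Z_X, one_smul, Pi.zero_apply, add_zero] using hU
      · refine ⟨U', ?_⟩
        simpa only [only_self, only_X_Z, one_smul, Pi.zero_apply, zero_add] using hU')
  simpa [sgn] using this

end ToricCode
theorem mainTheorem4 (ω : ToricCode.VacuumState) (Λa C : ToricCode.Cone)
    (hC : ∃ C' : ToricCode.Cone, ToricCode.Precedes Λa C' C) :
    (∀ γ : ToricCode.InfPath .X, γ.IsIn C → ToricCode.HasTwist ω Λa C γ.auto 1) ∧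
    (∀ γ : ToricCode.InfPath .Z, γ.IsIn C → ToricCode.HasTwist ω Λa C γ.auto 1) ∧
    (∀ (γX : ToricCode.InfPath .X) (γZ : ToricCode.InfPath .Z), γX.IsIn C → γZ.IsIn C →
      ToricCode.HasTwist ω Λa C (ToricCode.tensorEndo γX.auto γZ.auto) (-1)) := by
  obtain ⟨C', hC'⟩ := hC
  exact ⟨fun γ h => h.hasTwist ω hC', fun γ h => h.hasTwist ω hC',
    fun γX γZ hX hZ => hX.hasTwist_tensorEndo ω hC' hZ⟩
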